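/- \textbf{Setting.} Let $(N,\alpha_N)$ be a non-empty closed contact manifold with contact form $\alpha_N$, let $\varepsilon>0$ and put $(V,\omega_V)=\big((-\varepsilon,0]\times N,\ \mathrm d(\mathrm e^{a}\alpha_N)\big)$. Let $J_V$ be an almost complex structure on $V$ compatible with $\alpha_N$: it is invariant under translations in $a$, restricts to a compatible complex structure of the symplectic bundle $(\ker\alpha_N,\mathrm d\alpha_N)$, and sends $\partial_a$ to the Reeb vector field of $\alpha_N$. Let $(Q,\omega_Q)$ be a non-empty closed symplectic manifold with a compatible almost complex structure $J_Q$. Its rational area spectrum is the image of the homomorphism $H_2(Q;\mathbb Q)\to\mathbb R$, $A\mapsto\int_A\omega_Q$. Let $\omega_{FS}$ be the Fubini--Study form on $\mathbb CP^1$ of total area $\pi$, and let $\varrho>0$. \textbf{Local foliation.} Let $(W,\omega)$ be a symplectic manifold with boundary, without concave or convex boundary components. A local foliation by holomorphic spheres of $(W,\omega)$, for a symplectic manifold $(B,\omega_B)$ with compact (possibly empty) boundary, is a codimension-zero symplectic embedding $F\colon(B\times\mathbb CP^1,\ \omega_B+\varrho^2\omega_{FS})\to(W,\omega)$ that maps $\partial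 B\times\mathbb CP^1$ onto $\partial W$. Suppose that $B$ carries a compatible almost complex structure $J_B$. An almost complex structure $J$ on $W$ compatible with $\omega$ is admissible if it restricts to $J_B\oplus\mathrm i$ on $B\times\mathbb CP^1$ (via $F$). \textbf{Nodal spheres.} A nodal $J$-holomorphic sphere in $W$ is given by a Riemann surface $S$ with finitely many connected components, each diffeomorphic to $S^2$, a finite set $D$ of pairwise disjoint two-point subsets of $S$ (nodal pairs) such that $S/D$ is connected and $S$ has exactly $\#D+1$ components, and a smooth $J$-holomorphic map $u\colon S\to W$ that descends to $S/D$. It is un-noded if $D=\emptyset$. \textbf{Essential.} The local foliation is essential if there is a point $*\in B$ such that, for every admissible $J$, every nodal $J$-holomorphic sphere $u$ in $W$ which is homologous to $F(*\times\mathbb CP^1)$ in $H_2(W;\mathbb Z)$, is non-constant on every component of $S$, and meets $F(B\times\mathbb CP^1)$, is un-noded and, up to a biholomorphic identification of its domain with $\mathbb CP^1$, equal to $z\mapsto F(b,z)$ for some $b\in B$. \textbf{Proposition.} Assume that $(W,\omega)$ admits a local foliation $F\colon\big(V\times Q\times\mathbb CP^1,\ \omega_V+\omega_Q+\varrho^2\omega_{FS}\big)\to(W,\omega)$,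 with $B=V\times Q$ and $\partial W=F(\{0\}\times N\times Q\times\mathbb CP^1)\cong N\times Q\times\mathbb CP^1$, equipped with the almost complex structure $J_V\oplus J_Q\oplus\mathrm i$. If $\pi\varrho^2$ does not belong to the rational area spectrum of $(Q,\omega_Q)$, then this local foliation is essential. -/

import Mathlib

open Set Topology MeasureTheory
open scoped Manifold ContDiff

noncomputable section

namespace EssFol

/-! ## Differential forms on manifolds (possibly with boundary) -/

section Forms

variable {E H : Type*} [NormedAddCommGroup E] [NormedSpace ℝ E] [TopologicalSpace H]
  (I : ModelWithCorners ℝ E H) {M : Type*} [TopologicalSpace M] [ChartedSpace H M]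
  {E' H' : Type*} [NormedAddCommGroup E'] [NormedSpace ℝ E'] [TopologicalSpace H']
  (I' : ModelWithCorners ℝ E' H') {M' : Type*} [TopologicalSpace M'] [ChartedSpace H' M']

variable (M) in
/-- A (not necessarily continuous) differential form of degree `k` on `M`. -/
abbrev DForm (k : ℕ) := ∀ x : M, TangentSpace I x [⋀^Fin k]→L[ℝ] ℝ

variable (M) in
/-- A (not necessarily continuous) field of endomorphisms of the tangent bundle of `M`. -/
abbrev EndoField := ∀ x : M, TangentSpace I x →L[ℝ] TangentSpace I x

/-- The coordinate expression of a form in the chart around `x₀`. -/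
def chartForm {k : ℕ} (η : DForm I M k) (x₀ : M) : E → E [⋀^Fin k]→L[ℝ] ℝ := fun y =>
  (η ((extChartAt I x₀).symm y)).compContinuousLinearMap
    (mfderivWithin 𝓘(ℝ, E) I (extChartAt I x₀).symm (range I) y)

/-- A form is smooth if its coordinate expressions are smooth. -/
def IsSmoothForm {k : ℕ} (η : DForm I M k) : Prop :=
  ∀ x₀ : M, ContDiffOn ℝ ∞ (chartForm I η x₀) (extChartAt I x₀).target

/-- The exterior derivative, computed in a chart. -/
def extD {k : ℕ} (η : DForm I M k) : DForm I M (k + 1) := fun x =>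
  (extDerivWithin (chartForm I η x) (range I) (extChartAt I x x)).compContinuousLinearMap
    (mfderiv I 𝓘(ℝ, E) (extChartAt I x) x)

/-- The pull-back of a form under a map. -/
def pullback {k : ℕ} (f : M → M') (η : DForm I' M' k) : DForm I M k := fun x =>
  (η (f x)).compContinuousLinearMap (mfderiv I I' f x)

/-- Symplectic forms: smooth, closed, non-degenerate 2-forms. -/
structure IsSymplectic (Ω : DForm I M 2) : Prop where
  smooth : IsSmoothForm I Ω
  closed : ∀ x, extD I Ω x = 0
  nondegenerate : ∀ (x : M) (v : TangentSpace I x), v ≠ 0 → ∃ w : TangentSpace I x, Ω x ![v, w] ≠ 0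

/-- The form `ω₁ + c ω₂` on a product, where `ω₁`, `ω₂` are forms on the factors. -/
def sumForm {k : ℕ} (ω₁ : DForm I M k) (c : ℝ) (ω₂ : DForm I' M' k) :
    DForm (I.prod I') (M × M') k := fun p =>
  pullback (I.prod I') I Prod.fst ω₁ p + c • pullback (I.prod I') I' Prod.snd ω₂ p

/-! ## Almost complex structures -/

/-- The coordinate expression of an endomorphism field in the chart around `x₀`. -/
def chartEndo (J : EndoField I M) (x₀ : M) : E → E →L[ℝ] E := fun y =>
  (mfderiv I 𝓘(ℝ, E) (extChartAt I x₀) ((extChartAt I x₀).symm y)).comp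
    ((J ((extChartAt I x₀).symm y)).comp
      (mfderivWithin 𝓘(ℝ, E) I (extChartAt I x₀).symm (range I) y))

/-- Almost complex structures: smooth endomorphism fields with square `-1`. -/
structure IsAlmostComplex (J : EndoField I M) : Prop where
  smooth : ∀ x₀ : M, ContDiffOn ℝ ∞ (chartEndo I J x₀) (extChartAt I x₀).target
  sq : ∀ (x : M) (v : TangentSpace I x), J x (J x v) = -v

/-- `J` is an almost complex structure compatible with the 2-form `Ω`. -/
structure IsCompatible (Ω : DForm I M 2) (J : EndoField I M) : Prop where
  almostComplex : IsAlmostComplex I J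
  invariant : ∀ (x : M) (v w : TangentSpace I x), Ω x ![J x v, J x w] = Ω x ![v, w]
  positive : ∀ (x : M) (v : TangentSpace I x), v ≠ 0 → 0 < Ω x ![v, J x v]

/-- The split endomorphism field `J₁ ⊕ J₂` on a product. -/
def splitJ (J₁ : EndoField I M) (J₂ : EndoField I' M') : EndoField (I.prod I') (M × M') :=
  fun p => ContinuousLinearMap.prodMap (J₁ p.1) (J₂ p.2)

/-! ## Smooth singular chains -/

/-- The standard simplex `{t | 0 ≤ tᵢ, ∑ tᵢ ≤ 1}` in `ℝᵏ`, with vertices `0, e₁, …, e_k`. -/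
def Simplex (k : ℕ) : Set (Fin k → ℝ) := {t | (∀ i, 0 ≤ t i) ∧ ∑ i, t i ≤ 1}

/-- The affine parametrization of the face opposite to the `i`-th vertex. -/
def faceMap {k : ℕ} (i : Fin (k + 2)) (s : Fin k → ℝ) : Fin (k + 1) → ℝ :=
  Fin.cases (motive := fun _ => Fin (k + 1) → ℝ)
    (Fin.cons (1 - ∑ j, s j) s) (fun j => j.insertNth 0 s) i

theorem zero_mem_simplex (k : ℕ) : (0 : Fin k → ℝ) ∈ Simplex k := by
  simp [Simplex]

theorem faceMap_mem {k : ℕ} (i : Fin (k + 2)) {s : Fin k → ℝ} (hs : s ∈ Simplex k) :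
    faceMap i s ∈ Simplex (k + 1) := by
  obtain ⟨h0, h1⟩ := hs
  refine Fin.cases ?_ (fun j => ?_) i
  · refine ⟨fun l => ?_, ?_⟩
    · refine Fin.cases ?_ (fun m => ?_) l
      · simpa [faceMap] using h1
      · simpa [faceMap] using h0 m
    · simp [faceMap, Fin.sum_univ_succ]
  · refine ⟨fun l => ?_, ?_⟩
    · refine Fin.succAboveCases j ?_ (fun m => ?_) l
      · simp [faceMap]
      · simpa [faceMap] using h0 m
    · rw [Fin.sum_univ_succAbove _ j]
      simpa [faceMap] using h1

theorem contDiff_faceMap {k : ℕ} (i : Fin (k + 2)) :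
    ContDiff ℝ ∞ (faceMap i : (Fin k → ℝ) → Fin (k + 1) → ℝ) := by
  rw [contDiff_pi]
  intro l
  refine Fin.cases ?_ (fun j => ?_) i
  · refine Fin.cases ?_ (fun m => ?_) l
    · simp only [faceMap, Fin.cases_zero, Fin.cons_zero]
      fun_prop
    · simp only [faceMap, Fin.cases_zero, Fin.cons_succ]
      fun_prop
  · refine Fin.succAboveCases j ?_ (fun m => ?_) l
    · simp only [faceMap, Fin.cases_succ, Fin.insertNth_apply_same]
      fun_prop
    · simp only [faceMap, Fin.cases_succ, Fin.insertNth_apply_succAbove]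
      fun_prop

variable (M) in
/-- Smooth singular `k`-simplices `Δᵏ → M`. Such a map is stored as a function on all of `ℝᵏ`
which is smooth on the simplex and, by convention, takes the value at the vertex `0` outside of the
simplex, so that two of these functions are equal iff they agree on the simplex. -/
def SmoothSimplex (k : ℕ) : Type _ :=
  {σ : (Fin k → ℝ) → M //
    ContMDiffOn 𝓘(ℝ, Fin k → ℝ) I ∞ σ (Simplex k) ∧ ∀ t, t ∉ Simplex k → σ t = σ 0}

open Classical in
/-- The `i`-th face of a smooth singular simplex. -/
def SmoothSimplex.face {k : ℕ} (σ : SmoothSimplex I M (k + 1)) (i : Fin (k + 2)) :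
    SmoothSimplex I M k :=
  ⟨fun s => if s ∈ Simplex k then σ.1 (faceMap i s) else σ.1 (faceMap i 0), by
    constructor
    · refine ContMDiffOn.congr (f := fun s => σ.1 (faceMap i s)) ?_ ?_
      · exact σ.2.1.comp (contDiff_faceMap i).contMDiff.contMDiffOn fun s hs => faceMap_mem i hs
      · intro s hs
        simp [hs]
    · intro t ht
      simp [ht, zero_mem_simplex]⟩

/-- The image of a smooth singular simplex under a smooth map. -/
def SmoothSimplex.map {k : ℕ} (f : C^∞⟮I, M; I', M'⟯) (σ : SmoothSimplex I M k) :
    SmoothSimplex I' M' k :=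
  ⟨fun t => f (σ.1 t), f.contMDiff.comp_contMDiffOn σ.2.1, fun t ht =>
    congrArg f (σ.2.2 t ht)⟩

variable (M) in
/-- Smooth singular `k`-chains with coefficients in `R`. -/
abbrev Chain (R : Type*) [CommRing R] (k : ℕ) := SmoothSimplex I M k →₀ R

/-- The boundary operator of the smooth singular chain complex. -/
def boundary {R : Type*} [CommRing R] {k : ℕ} (c : Chain I M R (k + 1)) : Chain I M R k :=
  c.sum fun σ a => ∑ i : Fin (k + 2), Finsupp.single (σ.face I i) ((-1) ^ (i : ℕ) * a)

/-- The push-forward of smooth singular chains under a smooth map. -/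
def pushforward {R : Type*} [CommRing R] {k : ℕ} (f : C^∞⟮I, M; I', M'⟯) (c : Chain I M R k) :
    Chain I' M' R k :=
  Finsupp.mapDomain (SmoothSimplex.map I I' f) c

/-- The integral of a 2-form over a smooth singular 2-simplex. -/
def simplexIntegral (η : DForm I M 2) (σ : SmoothSimplex I M 2) : ℝ :=
  ∫ t in Simplex 2, (η (σ.1 t)).compContinuousLinearMap
    (mfderivWithin 𝓘(ℝ, Fin 2 → ℝ) I σ.1 (Simplex 2) t) ![Pi.single 0 1, Pi.single 1 1]

/-- The integral of a 2-form over a smooth singular 2-chain. -/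
def chainIntegral {R : Type*} [CommRing R] [Algebra R ℝ] (η : DForm I M 2) (c : Chain I M R 2) :
    ℝ :=
  c.sum fun σ a => algebraMap R ℝ a * simplexIntegral I η σ

/-- The rational area spectrum of a 2-form: its integrals over the rational (smooth singular)
2-cycles. For a closed form this is the image of the second homology with rational coefficients
under integration. -/
def rationalAreaSpectrum (Ω : DForm I M 2) : Set ℝ :=
  {r | ∃ c : Chain I M ℚ 2, boundary I c = 0 ∧ chainIntegral I Ω c = r}

end Forms

/-! ## Riemann surfaces

A Riemann surface is a complex manifold `C` with charts in `ℂ`. It is also a real manifold, with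
model `𝓘(ℝ, ℂ)` and the same charts. -/

section RiemannSurface

variable (C : Type*) [TopologicalSpace C] [ChartedSpace ℂ C]

/-- The complex structure of a Riemann surface: multiplication by the imaginary unit. -/
def complexJ : EndoField 𝓘(ℝ, ℂ) C := fun _ =>
  (Complex.I • ContinuousLinearMap.id ℝ ℂ : ℂ →L[ℝ] ℂ)

variable {C} in
/-- An integral smooth singular 2-cycle that represents the fundamental class of a closed connected
Riemann surface, which is oriented by its complex structure: it generates the second integral
homology, and integration over it is integration over the surface. The latter is expressed for the
2-forms supported in the domain of a chart. -/
structure IsFundamentalCycle (c : Chain 𝓘(ℝ, ℂ) C ℤ 2) : Prop where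
  cycle : boundary 𝓘(ℝ, ℂ) c = 0
  generates : ∀ z : Chain 𝓘(ℝ, ℂ) C ℤ 2, boundary 𝓘(ℝ, ℂ) z = 0 →
    ∃ (m : ℤ) (b : Chain 𝓘(ℝ, ℂ) C ℤ 3), z - m • c = boundary 𝓘(ℝ, ℂ) b
  integral_eq : ∀ (x₀ : C) (η : DForm 𝓘(ℝ, ℂ) C 2), IsSmoothForm 𝓘(ℝ, ℂ) η →
    closure {x | η x ≠ 0} ⊆ (chartAt ℂ x₀).source →
    chainIntegral 𝓘(ℝ, ℂ) η c =
      ∫ z in (chartAt ℂ x₀).target, chartForm 𝓘(ℝ, ℂ) η x₀ z ![1, Complex.I]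

end RiemannSurface

/-! ## The complex projective line -/

/-- The complex projective line `ℂ ∪ {∞}`. -/
def CP1 : Type := OnePoint ℂ

namespace CP1

instance : TopologicalSpace CP1 := inferInstanceAs (TopologicalSpace (OnePoint ℂ))
instance : CompactSpace CP1 := inferInstanceAs (CompactSpace (OnePoint ℂ))
instance : T2Space CP1 := inferInstanceAs (T2Space (OnePoint ℂ))
instance : ConnectedSpace CP1 := inferInstanceAs (ConnectedSpace (OnePoint ℂ))

/-- The inclusion of the affine line. -/
def coe (z : ℂ) : CP1 := OnePoint.some z

/-- The point at infinity. -/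
def infty : CP1 := OnePoint.infty

open Classical in
/-- The inversion `z ↦ 1 / z`, exchanging `0` and `∞`. -/
def inv (p : CP1) : CP1 :=
  OnePoint.elim (X := ℂ) p (coe 0) fun z : ℂ => if z = 0 then infty else coe z⁻¹

theorem inv_infty : inv infty = coe 0 := rfl

theorem inv_zero : inv (coe 0) = infty := by
  change (if (0 : ℂ) = 0 then infty else coe 0⁻¹) = infty
  simp

theorem inv_coe {z : ℂ} (hz : z ≠ 0) : inv (coe z) = coe z⁻¹ := by
  change (if z = 0 then infty else coe z⁻¹) = _
  simp [hz]

theorem inv_inv (p : CP1) : inv (inv p) = p := by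
  induction p using OnePoint.rec with
  | infty => exact inv_zero
  | coe z =>
    change inv (inv (coe z)) = coe z
    by_cases hz : z = 0
    · subst hz; rw [inv_zero, inv_infty]
    · rw [inv_coe hz, inv_coe (inv_ne_zero hz), _root_.inv_inv]

theorem tendsto_coe : Filter.Tendsto coe (Bornology.cobounded ℂ) (𝓝 infty) := by
  have h := OnePoint.tendsto_coe_infty (X := ℂ)
  rwa [Filter.coclosedCompact_eq_cocompact, ← Metric.cobounded_eq_cocompact] at h

theorem continuous_coe : Continuous coe := OnePoint.continuous_coe

theorem continuous_inv : Continuous inv := by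
  rw [continuous_iff_continuousAt]
  intro p
  induction p using OnePoint.rec with
  | infty =>
    refine OnePoint.continuousAt_infty'.2 ?_
    rw [Filter.coclosedCompact_eq_cocompact, ← Metric.cobounded_eq_cocompact]
    change Filter.Tendsto (fun z => inv (coe z)) _ (𝓝 (coe 0))
    have h1 : Filter.Tendsto (fun z : ℂ => coe z⁻¹) (Bornology.cobounded ℂ) (𝓝 (coe 0)) :=
      (continuous_coe.tendsto 0).comp Filter.tendsto_inv₀_cobounded
    refine h1.congr' ?_
    filter_upwards [Bornology.eventually_ne_cobounded (0 : ℂ)] with z hz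
    exact (inv_coe hz).symm
  | coe z =>
    refine OnePoint.continuousAt_coe.2 ?_
    change Filter.Tendsto (fun w => inv (coe w)) (𝓝 z) (𝓝 (inv (coe z)))
    by_cases hz : z = 0
    · subst hz
      rw [inv_zero, ← nhdsNE_sup_pure, Filter.tendsto_sup]
      constructor
      · have h1 : Filter.Tendsto (fun w : ℂ => coe w⁻¹) (𝓝[≠] 0) (𝓝 infty) :=
          tendsto_coe.comp Filter.tendsto_inv₀_nhdsNE_zero
        refine h1.congr' ?_
        filter_upwards [self_mem_nhdsWithin] with w hw
        exact (inv_coe hw).symm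
      · rw [Filter.tendsto_pure_left]
        intro s hs
        rw [inv_zero]
        exact mem_of_mem_nhds hs
    · rw [inv_coe hz]
      have h1 : Filter.Tendsto (fun w : ℂ => coe w⁻¹) (𝓝 z) (𝓝 (coe z⁻¹)) :=
        (continuous_coe.tendsto _).comp (tendsto_inv₀ hz)
      refine h1.congr' ?_
      filter_upwards [isOpen_ne.mem_nhds hz] with w hw
      exact (inv_coe hw).symm

/-- The inversion as a homeomorphism. -/
def invHomeo : CP1 ≃ₜ CP1 where
  toFun := inv
  invFun := inv
  left_inv := inv_inv
  right_inv := inv_inv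
  continuous_toFun := continuous_inv
  continuous_invFun := continuous_inv

/-- The affine chart `z ↦ z` on the complement of `∞`. -/
def affineChart : OpenPartialHomeomorph CP1 ℂ :=
  ((OnePoint.isOpenEmbedding_coe (X := ℂ)).toOpenPartialHomeomorph _).symm

/-- The chart `z ↦ 1 / z` on the complement of `0`. -/
def inftyChart : OpenPartialHomeomorph CP1 ℂ :=
  invHomeo.toOpenPartialHomeomorph.trans affineChart

theorem mem_affineChart_source {p : CP1} (hp : p ≠ infty) : p ∈ affineChart.source := by
  change p ∈ ((OnePoint.isOpenEmbedding_coe (X := ℂ)).toOpenPartialHomeomorph _).target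
  rw [IsOpenEmbedding.toOpenPartialHomeomorph_target]
  exact OnePoint.ne_infty_iff_exists.1 hp

open Classical in
instance : ChartedSpace ℂ CP1 where
  atlas := {affineChart, inftyChart}
  chartAt p := if p = infty then inftyChart else affineChart
  mem_chart_source p := by
    by_cases hp : p = infty
    · subst hp
      have h : coe 0 ∈ affineChart.source := mem_affineChart_source (OnePoint.coe_ne_infty 0)
      simpa [inftyChart, invHomeo, inv_infty] using h
    · simpa [hp] using mem_affineChart_source hp
  chart_mem_atlas p := by
    by_cases hp : p = infty <;> simp [hp]

/-- The standard area form `dx ∧ dy` of the complex plane. -/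
def areaForm : ℂ [⋀^Fin 2]→L[ℝ] ℝ where
  toFun v := (v 0).re * (v 1).im - (v 0).im * (v 1).re
  map_update_add' v i x y := by
    fin_cases i <;> simp <;> ring
  map_update_smul' v i c x := by
    fin_cases i <;> simp <;> ring
  map_eq_zero_of_eq' v i j h hij := by
    fin_cases i <;> fin_cases j <;> simp_all <;> ring
  cont := by fun_prop

/-- The Fubini–Study form of total area `π`. It equals `(1 + |z|²)⁻² dx ∧ dy` in the coordinate
`z = x + iy` given by either of the two charts. -/
def fubiniStudy : DForm 𝓘(ℝ, ℂ) CP1 2 := fun p =>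
  (((1 + ‖chartAt ℂ p p‖ ^ 2) ^ 2)⁻¹ : ℝ) • (areaForm : ℂ [⋀^Fin 2]→L[ℝ] ℝ)

end CP1

/-! ## Nodal spheres -/

/-- Nodal Riemann surfaces of genus zero. The surface is the disjoint union of the finitely many
connected Riemann surfaces `C i`, each of which is diffeomorphic to the 2-sphere; `D` is the set of
nodal pairs. (Up to isomorphism every such surface lives in `Type`.) -/
structure NodalSurface where
  /-- the index set of the connected components -/
  ι : Type
  [fintype : Fintype ι]
  /-- the connected components -/
  C : ι → Type
  [topology : ∀ i, TopologicalSpace (C i)]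
  [charted : ∀ i, ChartedSpace ℂ (C i)]
  [riemannSurface : ∀ i, IsManifold 𝓘(ℂ) ∞ (C i)]
  sphere : ∀ i, Nonempty
    (C i ≃ₘ^∞⟮𝓘(ℝ, ℂ), 𝓡 2⟯ (Metric.sphere (0 : EuclideanSpace ℝ (Fin 3)) 1))
  /-- the set of nodal pairs -/
  D : Finset (Sym2 (Σ i, C i))
  distinct : ∀ e ∈ D, ¬ e.IsDiag
  disjoint : ∀ e₁ ∈ D, ∀ e₂ ∈ D, ∀ x, x ∈ e₁ → x ∈ e₂ → e₁ = e₂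
  connected : ConnectedSpace (Quot fun x y : (Σ i, C i) => s(x, y) ∈ D)
  card_components : Fintype.card ι = D.card + 1

attribute [instance] NodalSurface.fintype NodalSurface.topology NodalSurface.charted
  NodalSurface.riemannSurface

section Essential

variable {E H : Type*} [NormedAddCommGroup E] [NormedSpace ℝ E] [TopologicalSpace H]
  (I : ModelWithCorners ℝ E H) {W : Type*} [TopologicalSpace W] [ChartedSpace H W]
  {EB HB : Type*} [NormedAddCommGroup EB] [NormedSpace ℝ EB] [TopologicalSpace HB]
  (IB : ModelWithCorners ℝ EB HB) {B : Type*} [TopologicalSpace B] [ChartedSpace HB B]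

variable (W) in
/-- Smooth maps from a nodal Riemann surface of genus zero that descend to the nodal quotient. -/
structure NodalMap (S : NodalSurface) where
  /-- the restrictions of the map to the connected components -/
  map : ∀ i, C^∞⟮𝓘(ℝ, ℂ), S.C i; I, W⟯
  descends : ∀ x y : (Σ i, S.C i), s(x, y) ∈ S.D → map x.1 x.2 = map y.1 y.2

/-- A nodal map is `J`-holomorphic if it solves `Tu ∘ j = J(u) ∘ Tu`. -/
def NodalMap.IsHolomorphic {S : NodalSurface} (J : EndoField I W) (u : NodalMap I W S) : Prop :=
  ∀ (i : S.ι) (p : S.C i) (v : TangentSpace 𝓘(ℝ, ℂ) p),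
    mfderiv 𝓘(ℝ, ℂ) I (u.map i) p (complexJ (S.C i) p v) =
      J (u.map i p) (mfderiv 𝓘(ℝ, ℂ) I (u.map i) p v)

/-- The nodal map `u` is homologous to the map `v` from `CP1`: the images of the fundamental classes
coincide in the second integral homology of `W`. -/
def NodalMap.IsHomologous {S : NodalSurface} (u : NodalMap I W S)
    (v : C^∞⟮𝓘(ℝ, ℂ), CP1; I, W⟯) : Prop :=
  ∃ (c : ∀ i, Chain 𝓘(ℝ, ℂ) (S.C i) ℤ 2) (e : Chain 𝓘(ℝ, ℂ) CP1 ℤ 2) (b : Chain I W ℤ 3),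
    (∀ i, IsFundamentalCycle (c i)) ∧ IsFundamentalCycle e ∧
      ∑ i, pushforward 𝓘(ℝ, ℂ) I (u.map i) (c i) - pushforward 𝓘(ℝ, ℂ) I v e = boundary I b

variable {IB} in
/-- The leaf `z ↦ F (b, z)` of a family of spheres. -/
def leaf (F : C^∞⟮IB.prod 𝓘(ℝ, ℂ), B × CP1; I, W⟯) (b : B) : C^∞⟮𝓘(ℝ, ℂ), CP1; I, W⟯ :=
  F.comp (ContMDiffMap.prodMk (ContMDiffMap.const b) ContMDiffMap.id)

/-- A local foliation by holomorphic spheres of area `π ϱ²` in the symplectic manifold `(W, Ω)`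
without concave and convex boundary components: a symplectic embedding `F`, of codimension zero, of
`(B × CP1, ω_B + ϱ² ω_FS)` such that `∂B × CP1` is mapped onto the boundary of `W`. -/
structure IsLocalFoliation (Ω : DForm I W 2) (ΩB : DForm IB B 2) (ϱ : ℝ)
    (F : C^∞⟮IB.prod 𝓘(ℝ, ℂ), B × CP1; I, W⟯) : Prop where
  radius_pos : 0 < ϱ
  base_symplectic : IsSymplectic IB ΩB
  base_boundary_compact : IsCompact (IB.boundary B)
  isEmbedding : IsEmbedding F
  bijective_mfderiv : ∀ p, Function.Bijective (mfderiv (IB.prod 𝓘(ℝ, ℂ)) I F p)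
  pullback_eq : ∀ p, pullback (IB.prod 𝓘(ℝ, ℂ)) I F Ω p =
    sumForm IB 𝓘(ℝ, ℂ) ΩB (ϱ ^ 2) CP1.fubiniStudy p
  boundary_image : F '' (IB.boundary B ×ˢ univ) = I.boundary W

variable {IB} in
/-- `J` is an admissible almost complex structure on `W`: it is compatible with `Ω` and restricts to
`J_B ⊕ i` on `B × CP1`. -/
structure IsAdmissible (Ω : DForm I W 2) (JB : EndoField IB B)
    (F : C^∞⟮IB.prod 𝓘(ℝ, ℂ), B × CP1; I, W⟯) (J : EndoField I W) : Prop where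
  compatible : IsCompatible I Ω J
  restricts : ∀ (p : B × CP1) (v : TangentSpace (IB.prod 𝓘(ℝ, ℂ)) p),
    J (F p) (mfderiv (IB.prod 𝓘(ℝ, ℂ)) I F p v) =
      mfderiv (IB.prod 𝓘(ℝ, ℂ)) I F p (splitJ IB 𝓘(ℝ, ℂ) JB (complexJ CP1) p v)

variable {IB} in
/-- The local foliation `F` is essential. The last line says that `u` is un-noded and equal to
`z ↦ F (b, z)` up to a biholomorphic identification of its domain with `CP1`. -/
def IsEssential (Ω : DForm I W 2) (JB : EndoField IB B)
    (F : C^∞⟮IB.prod 𝓘(ℝ, ℂ), B × CP1; I, W⟯) : Prop :=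
  ∃ b₀ : B, ∀ J : EndoField I W, IsAdmissible I Ω JB F J →
    ∀ (S : NodalSurface) (u : NodalMap I W S), u.IsHolomorphic I J →
      u.IsHomologous I (leaf I F b₀) →
      (∀ i, ¬ ∃ w, ∀ p, u.map i p = w) →
      (∃ i p, u.map i p ∈ range F) →
      S.D = ∅ ∧ ∃ b : B, ∀ i, ∃ φ : S.C i ≃ₘ^∞⟮𝓘(ℂ), 𝓘(ℂ)⟯ CP1,
        ∀ p, u.map i p = F (b, φ p)

end Essential

/-! ## Contact manifolds and collars in the symplectization -/

/-- The half-line `(-∞, 0]` as a model for one-dimensional manifolds with boundary. -/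
def halfLine : ModelWithCorners ℝ ℝ (Iic (0 : ℝ)) where
  toFun := Subtype.val
  invFun x := ⟨min x 0, min_le_right x 0⟩
  source := univ
  target := Iic 0
  map_source' x _ := x.2
  map_target' _ _ := mem_univ _
  left_inv' x _ := Subtype.ext (min_eq_left x.2)
  right_inv' x hx := min_eq_left hx
  source_eq := rfl
  convex_range' := by
    simp only [instIsRCLikeNormedField, ↓reduceDIte]
    apply Convex.convex_isRCLikeNormedField
    change Convex ℝ (range (Subtype.val : Iic (0 : ℝ) → ℝ))
    rw [Subtype.range_val]
    exact convex_Iic (0 : ℝ)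
  nonempty_interior' := by
    change (interior (range (Subtype.val : Iic (0 : ℝ) → ℝ))).Nonempty
    rw [Subtype.range_val, interior_Iic]
    exact nonempty_Iio
  continuous_toFun := continuous_subtype_val
  continuous_invFun := by fun_prop

/-- The interval `(-ε, 0]`. -/
def Collar (ε : ℝ) : TopologicalSpace.Opens (Iic (0 : ℝ)) :=
  ⟨{a | -ε < a.1}, isOpen_lt continuous_const continuous_subtype_val⟩

section Contact

variable {E H : Type*} [NormedAddCommGroup E] [NormedSpace ℝ E] [TopologicalSpace H]
  (I : ModelWithCorners ℝ E H) {N : Type*} [TopologicalSpace N] [ChartedSpace H N]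

/-- Contact forms: smooth nowhere vanishing 1-forms `α` such that `dα` is non-degenerate on the
kernel of `α`. -/
structure IsContactForm (α : DForm I N 1) : Prop where
  smooth : IsSmoothForm I α
  ne_zero : ∀ x, α x ≠ 0
  nondegenerate : ∀ (x : N) (v : TangentSpace I x), α x ![v] = 0 → v ≠ 0 →
    ∃ w : TangentSpace I x, α x ![w] = 0 ∧ extD I α x ![v, w] ≠ 0

/-- `R` is the value of the Reeb vector field of `α` at the point `x`. -/
def IsReebVector (α : DForm I N 1) (x : N) (R : TangentSpace I x) : Prop :=
  α x ![R] = 1 ∧ ∀ v : TangentSpace I x, extD I α x ![R, v] = 0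

variable {I} (ε : ℝ)

/-- The 1-form `eᵃ α` on `(-ε, 0] × N`. -/
def liouvilleForm (α : DForm I N 1) : DForm (halfLine.prod I) (Collar ε × N) 1 := fun p =>
  Real.exp p.1.1.1 • pullback (halfLine.prod I) I Prod.snd α p

/-- The symplectic form `d(eᵃ α)` on `(-ε, 0] × N`. -/
def symplectizationForm (α : DForm I N 1) : DForm (halfLine.prod I) (Collar ε × N) 2 :=
  extD (halfLine.prod I) (liouvilleForm ε α)

variable {ε} in
/-- The tangent vector `s ∂ₐ + v` at the point `p` of `(-ε, 0] × N`. -/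
def collarVector (p : Collar ε × N) (s : ℝ) (v : TangentSpace I p.2) :
    TangentSpace (halfLine.prod I) p :=
  ((s, v) : ℝ × E)

/-- The almost complex structure `J` on `(-ε, 0] × N` is compatible with the contact form `α`. -/
structure IsContactCompatible (α : DForm I N 1)
    (J : EndoField (halfLine.prod I) (Collar ε × N)) : Prop where
  almostComplex : IsAlmostComplex (halfLine.prod I) J
  translation_invariant : ∀ (a a' : Collar ε) (x : N) (s s' : ℝ) (v v' : TangentSpace I x),
    J (a, x) (collarVector (a, x) s v) = collarVector (a, x) s' v' →
      J (a', x) (collarVector (a', x) s v) = collarVector (a', x) s' v'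
  map_liouville : ∀ (a : Collar ε) (x : N), ∃ R : TangentSpace I x, IsReebVector I α x R ∧
    J (a, x) (collarVector (a, x) 1 0) = collarVector (a, x) 0 R
  /-- `J` restricts to a complex structure of the contact hyperplanes which is compatible
  with `dα`. -/
  map_contact : ∀ (a : Collar ε) (x : N) (v : TangentSpace I x), α x ![v] = 0 →
    ∃ w : TangentSpace I x, α x ![w] = 0 ∧
      J (a, x) (collarVector (a, x) 0 v) = collarVector (a, x) 0 w ∧
      (v ≠ 0 → 0 < extD I α x ![v, w])
  contact_invariant : ∀ (a : Collar ε) (x : N) (v₁ v₂ w₁ w₂ : TangentSpace I x),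
    α x ![v₁] = 0 → α x ![v₂] = 0 →
    J (a, x) (collarVector (a, x) 0 v₁) = collarVector (a, x) 0 w₁ →
    J (a, x) (collarVector (a, x) 0 v₂) = collarVector (a, x) 0 w₂ →
    extD I α x ![w₁, w₂] = extD I α x ![v₁, v₂]

end Contact

end EssFol

end

open EssFol

/-! A nodal holomorphic sphere that meets the image of `F` cannot leave it. Where it meets the image
it lifts to a triple of maps to the collar, to `Q` and to `CP1`, each of them holomorphic because
the almost complex structure is split. In the collar, the Cauchy–Riemann equation identifies the
Laplacian of the coordinate `a` with the dα-area density, which is non-negative, so `a` is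
subharmonic along the curve. Superlevel sets of `a` have compact image in `W`, since `N`, `Q` and
`CP1` are compact and the collar is closed at `0`. Hence `a` attains a maximum on the part of a
component inside the image, and the strong maximum principle makes the set of maximum points open
and closed. So the whole component lies in the image with `a` constant, and then its collar part is
constant (`collar_eventually_eq_of_isLocalMax`, `mfderiv_eq_zero_of_collar_const`,
`exists_lift_of_compact`). Nodes carry the property to all components (`exists_nodal_lift`).

Now areas are compared. Let `a i` be the ω_Q-area of the `Q`-part of the `i`-th component and `m i`
the degree of its `CP1`-part. Stokes' theorem applied to the homology with a leaf gives ∑ a i + πϱ²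
∑ m i = πϱ². If ∑ m i ≠ 1, then πϱ² = (∑ a i) / (1 - ∑ m i) is the area of a rational cycle in `Q`,
which is excluded. Thus ∑ m i = 1 and ∑ a i = 0. By positivity every `a i` vanishes and all
`Q`-parts are constant. A component with `m i = 0` would have a constant `CP1`-part and so be
constant; hence every `m i` is at least 1. There is exactly one component, there are no nodes, and
the `CP1`-part is holomorphic of degree one, hence biholomorphic.

Homology is expressed by smooth singular chains, so Stokes' theorem is proved on the 3-simplex
(`sum_integral_faces_eq_zero`, `chainIntegral_boundary`). Integrals over a fundamental cycle are
given only for forms supported in a chart; partitions of unity yield positivity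
(`chainIntegral_nonneg`, `eq_zero_of_chainIntegral_eq_zero`) and the area of the projective line. A
map of degree one is injective because two sheets would count the integral of a bump form twice
(`injective_of_degree_one`). As `W` and the collar have boundary, openness of the image of `F` and
smoothness of lifts need arguments valid at boundary points (`isOpen_range_of_boundary`,
`contMDiffOn_of_comp`). -/

noncomputable section

namespace EssFol

/-! ## Pull-backs of differential forms -/

section AlternatingMaps

variable {E F : Type*} [NormedAddCommGroup E] [NormedSpace ℝ E]
  [NormedAddCommGroup F] [NormedSpace ℝ F]

/-- The normalized alternatization, a continuous linear retraction of the multilinear maps onto the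
alternating maps. -/
def altRetraction (E : Type*) [NormedAddCommGroup E] [NormedSpace ℝ E] (k : ℕ) :
    ContinuousMultilinearMap ℝ (fun _ : Fin k => E) ℝ →L[ℝ] E [⋀^Fin k]→L[ℝ] ℝ :=
  LinearMap.mkContinuous
    { toFun := fun f => ((Nat.factorial k : ℝ)⁻¹) • ContinuousMultilinearMap.alternatization f
      map_add' := fun f g => by simp
      map_smul' := fun c f => by
        ext v
        simp only [ContinuousAlternatingMap.smul_apply,
          ContinuousMultilinearMap.alternatization_apply_apply, smul_apply,
          RingHom.id_apply, smul_eq_mul, Finset.mul_sum]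
        refine Finset.sum_congr rfl fun σ _ => ?_
        rcases Int.units_eq_one_or (Equiv.Perm.sign σ) with h | h <;> simp [h] <;> ring } 1 (by
    intro f
    refine ContinuousAlternatingMap.opNorm_le_bound _ (by positivity) fun v => ?_
    simp only [LinearMap.coe_mk, AddHom.coe_mk, ContinuousAlternatingMap.smul_apply,
      ContinuousMultilinearMap.alternatization_apply_apply, norm_smul, norm_inv, one_mul]
    have h : ‖∑ σ : Equiv.Perm (Fin k), Equiv.Perm.sign σ • f (v ∘ σ)‖ ≤
        (Nat.factorial k : ℝ) * (‖f‖ * ∏ i, ‖v i‖) := by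
      refine (norm_sum_le _ _).trans ?_
      have : ∀ σ ∈ (Finset.univ : Finset (Equiv.Perm (Fin k))),
          ‖Equiv.Perm.sign σ • f (v ∘ σ)‖ ≤ ‖f‖ * ∏ i, ‖v i‖ := by
        intro σ _
        have h1 : ‖Equiv.Perm.sign σ • f (v ∘ σ)‖ = ‖f (v ∘ σ)‖ := by
          rcases Int.units_eq_one_or (Equiv.Perm.sign σ) with h | h <;> simp [h]
        rw [h1]
        refine (f.le_opNorm _).trans_eq ?_
        congr 1
        exact Equiv.prod_comp σ fun i => ‖v i‖
      refine (Finset.sum_le_sum this).trans_eq ?_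
      simp [Fintype.card_perm]
    have hk : (0 : ℝ) < Nat.factorial k := by exact_mod_cast Nat.factorial_pos k
    rw [Real.norm_of_nonneg hk.le, inv_mul_le_iff₀ hk]
    exact h)

/-- All k! summands sign(σ) f(v ∘ σ) agree with f(v) when f is already alternating, and the factor
1/k! cancels their number. -/
theorem altRetraction_coe {k : ℕ} (f : E [⋀^Fin k]→L[ℝ] ℝ) :
    altRetraction E k f.toContinuousMultilinearMap = f := by
  have h2 := AlternatingMap.coe_alternatization f.toAlternatingMap
  have hk : (Nat.factorial k : ℝ) ≠ 0 := by exact_mod_cast (Nat.factorial_pos k).ne'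
  ext v
  have h3 := congrArg (fun g : E [⋀^Fin k]→ₗ[ℝ] ℝ => g v) h2
  simp only [MultilinearMap.alternatization_apply, AlternatingMap.smul_apply, nsmul_eq_mul,
    Fintype.card_fin] at h3
  change ((Nat.factorial k : ℝ)⁻¹) •
    (ContinuousMultilinearMap.alternatization f.toContinuousMultilinearMap v) = f v
  rw [ContinuousMultilinearMap.alternatization_apply_apply, smul_eq_mul, inv_mul_eq_iff_eq_mul₀ hk]
  exact h3

/-- The corresponding operation on multilinear maps is analytic. Alternating maps embed
isometrically into multilinear ones, and `altRetraction` brings the result back. -/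
theorem contDiff_compContinuousLinearMap {k : ℕ} :
    ContDiff ℝ ∞ fun p : (F [⋀^Fin k]→L[ℝ] ℝ) × (E →L[ℝ] F) =>
      p.1.compContinuousLinearMap p.2 := by
  have h1 : ContDiff ℝ ∞
      fun p : (Fin k → E →L[ℝ] F) × ContinuousMultilinearMap ℝ (fun _ : Fin k => F) ℝ =>
        p.2.compContinuousLinearMap p.1 := by
    rw [contDiff_iff_contDiffAt]
    intro q
    exact (ContinuousMultilinearMap.analyticAt_uncurry_compContinuousLinearMap
      (𝕜 := ℝ) (Fm := fun _ : Fin k => E) (Em := fun _ : Fin k => F) (G := ℝ) (q := q)).contDiffAt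
  have h2 : ContDiff ℝ ∞ fun p : (F [⋀^Fin k]→L[ℝ] ℝ) × (E →L[ℝ] F) =>
      ((fun _ : Fin k => p.2), p.1.toContinuousMultilinearMap) := by
    refine ContDiff.prodMk (contDiff_pi.2 fun _ => contDiff_snd) ?_
    exact (ContinuousAlternatingMap.toContinuousMultilinearMapLI (𝕜 := ℝ) (E := F) (ι := Fin k)
      (F := ℝ)).contDiff.comp contDiff_fst
  have h3 := (altRetraction E k).contDiff.comp (h1.comp h2)
  convert! h3 using 1
  funext p
  exact (altRetraction_coe (p.1.compContinuousLinearMap p.2)).symm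

end AlternatingMaps

theorem minSmoothness_two_le_infty : minSmoothness ℝ 2 ≤ (∞ : WithTop ℕ∞) := by
  rw [minSmoothness_of_isRCLikeNormedField]
  exact WithTop.coe_le_coe.2 (le_top : (2 : ℕ∞) ≤ ⊤)

/-! ### Pull-backs to subsets of vector spaces and naturality of the exterior derivative -/

section PullbackOn

variable {E H : Type*} [NormedAddCommGroup E] [NormedSpace ℝ E] [TopologicalSpace H]
  (I : ModelWithCorners ℝ E H) {M : Type*} [TopologicalSpace M] [ChartedSpace H M]
  {E' H' : Type*} [NormedAddCommGroup E'] [NormedSpace ℝ E'] [TopologicalSpace H']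
  (I' : ModelWithCorners ℝ E' H') {M' : Type*} [TopologicalSpace M'] [ChartedSpace H' M']
  {X : Type*} [NormedAddCommGroup X] [NormedSpace ℝ X]

/-- The pull-back of a form to a subset of a vector space. -/
def pullbackOn {k : ℕ} (g : X → M) (s : Set X) (η : DForm I M k) : X → X [⋀^Fin k]→L[ℝ] ℝ :=
  fun z => (η (g z)).compContinuousLinearMap (mfderivWithin 𝓘(ℝ, X) I g s z)

/-- The coordinate expression of a map from a vector space around the value at a point. -/
def coordMap (g : X → M) (z₀ : X) : X → E := fun z => extChartAt I (g z₀) (g z)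

variable {I} [IsManifold I ∞ M]

omit [IsManifold I ∞ M] in
theorem contDiffWithinAt_coordMap {g : X → M} {s : Set X} {z : X}
    (hg : ContMDiffWithinAt 𝓘(ℝ, X) I ∞ g s z) : ContDiffWithinAt ℝ ∞ (coordMap I g z) s z := by
  rw [← contMDiffWithinAt_iff_contDiffWithinAt]
  exact (contMDiffAt_extChartAt (I := I) (n := ∞) (x := g z)).comp_contMDiffWithinAt z hg

theorem mfderivWithin_coordMap {g : X → M} {s : Set X} {z₀ z : X}
    (hs : UniqueDiffWithinAt ℝ s z) (hg : MDifferentiableWithinAt 𝓘(ℝ, X) I g s z)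
    (hz : g z ∈ (extChartAt I (g z₀)).source) :
    fderivWithin ℝ (coordMap I g z₀) s z =
      (mfderiv I 𝓘(ℝ, E) (extChartAt I (g z₀)) (g z)).comp (mfderivWithin 𝓘(ℝ, X) I g s z) := by
  rw [← mfderivWithin_eq_fderivWithin]
  have h2 : MDifferentiableAt I 𝓘(ℝ, E) (extChartAt I (g z₀)) (g z) :=
    mdifferentiableAt_extChartAt (by simpa using hz)
  exact mfderiv_comp_mfderivWithin z h2 hg hs.uniqueMDiffWithinAt

theorem mfderivWithin_eq_comp_coordMap {g : X → M} {s : Set X} {z₀ z : X}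
    (hs : UniqueDiffWithinAt ℝ s z) (hg : MDifferentiableWithinAt 𝓘(ℝ, X) I g s z)
    (hz : g z ∈ (extChartAt I (g z₀)).source) :
    mfderivWithin 𝓘(ℝ, X) I g s z =
      (mfderivWithin 𝓘(ℝ, E) I (extChartAt I (g z₀)).symm (range I) (coordMap I g z₀ z)).comp
        (fderivWithin ℝ (coordMap I g z₀) s z) := by
  have h := mfderivWithin_extChartAt_symm_comp_mfderiv_extChartAt' (I := I) hz
  refine ContinuousLinearMap.ext fun v => ?_
  have h2 := congrArg (fun L => L (mfderivWithin 𝓘(ℝ, X) I g s z v)) h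
  have h3 := congrArg (fun L : X →L[ℝ] E => L v) (mfderivWithin_coordMap hs hg hz)
  exact (h2.symm).trans (congrArg (mfderivWithin 𝓘(ℝ, E) I (extChartAt I (g z₀)).symm (range I)
    (coordMap I g z₀ z)) h3.symm)

/-- Writing the map in one fixed chart around `g z₀` replaces the form by its coordinate expression
there. Smoothness and exterior derivatives of pull-backs thereby become questions about vector
spaces. -/
theorem pullbackOn_eq_comp_chartForm {k : ℕ} (η : DForm I M k) {g : X → M} {s : Set X} {z₀ z : X}
    (hs : UniqueDiffWithinAt ℝ s z) (hg : MDifferentiableWithinAt 𝓘(ℝ, X) I g s z)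
    (hz : g z ∈ (extChartAt I (g z₀)).source) :
    pullbackOn I g s η z = (chartForm I η (g z₀) (coordMap I g z₀ z)).compContinuousLinearMap
      (fderivWithin ℝ (coordMap I g z₀) s z) := by
  have hz' : (extChartAt I (g z₀)).symm (coordMap I g z₀ z) = g z :=
    (extChartAt I (g z₀)).left_inv hz
  have h := mfderivWithin_eq_comp_coordMap hs hg hz
  unfold pullbackOn chartForm
  ext v
  simp only [ContinuousAlternatingMap.compContinuousLinearMap_apply]
  rw [h]
  -- The type of `η y` depends on `y`, so the equality of the two points is used by substituting a
  -- free variable.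
  have key : ∀ (y : M) (hy : y = g z) (w : Fin k → E), (η (g z)) w = (η y) w := by
    rintro y rfl w; rfl
  exact key _ hz' _

theorem eventually_pullbackOn_eq {k : ℕ} (η : DForm I M k) {g : X → M} {s : Set X} {z₀ : X}
    (hs : UniqueDiffOn ℝ s) (hg : ContMDiffOn 𝓘(ℝ, X) I ∞ g s) (hz₀ : z₀ ∈ s) :
    pullbackOn I g s η =ᶠ[𝓝[s] z₀] fun z =>
      (chartForm I η (g z₀) (coordMap I g z₀ z)).compContinuousLinearMap
        (fderivWithin ℝ (coordMap I g z₀) s z) := by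
  have h1 : ∀ᶠ z in 𝓝[s] z₀, g z ∈ (extChartAt I (g z₀)).source :=
    (hg z₀ hz₀).continuousWithinAt (extChartAt_source_mem_nhds (I := I) (g z₀))
  filter_upwards [h1, self_mem_nhdsWithin] with z hz hzs
  exact pullbackOn_eq_comp_chartForm η (hs z hzs)
    ((hg z hzs).mdifferentiableWithinAt (by simp)) hz

theorem contDiffOn_pullbackOn {k : ℕ} {η : DForm I M k} (hη : IsSmoothForm I η) {g : X → M}
    {s : Set X} (hs : UniqueDiffOn ℝ s) (hg : ContMDiffOn 𝓘(ℝ, X) I ∞ g s) :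
    ContDiffOn ℝ ∞ (pullbackOn I g s η) s := by
  intro z₀ hz₀
  have hc := contDiffWithinAt_coordMap (hg z₀ hz₀)
  have h1 : ContDiffWithinAt ℝ ∞ (fun z => chartForm I η (g z₀) (coordMap I g z₀ z)) s z₀ := by
    refine ContDiffWithinAt.comp_of_preimage_mem_nhdsWithin z₀
      (hη (g z₀) (coordMap I g z₀ z₀) (mem_extChartAt_target (g z₀))) hc ?_
    have h1 : ∀ᶠ z in 𝓝[s] z₀, g z ∈ (extChartAt I (g z₀)).source :=
      (hg z₀ hz₀).continuousWithinAt (extChartAt_source_mem_nhds (I := I) (g z₀))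
    filter_upwards [h1] with z hz
    exact (extChartAt I (g z₀)).map_source hz
  have h2 : ContDiffWithinAt ℝ ∞ (fderivWithin ℝ (coordMap I g z₀) s) s z₀ :=
    hc.fderivWithin_right hs (by simp) hz₀
  have h3 := contDiff_compContinuousLinearMap.contDiffAt.comp_contDiffWithinAt z₀ (h1.prodMk h2)
  exact h3.congr_of_eventuallyEq_of_mem (eventually_pullbackOn_eq η hs hg hz₀) hz₀

/-- Near `z` the pull-back is that of a coordinate form under a map of vector spaces, where d
commutes with pull-back. The condition on the closure of the interior is what symmetry of second
derivatives within `s` requires. -/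
theorem extDerivWithin_pullbackOn {k : ℕ} {η : DForm I M k} (hη : IsSmoothForm I η) {g : X → M}
    {s : Set X} (hs : UniqueDiffOn ℝ s) (hg : ContMDiffOn 𝓘(ℝ, X) I ∞ g s) {z : X} (hz : z ∈ s)
    (hzc : z ∈ closure (interior s)) :
    extDerivWithin (pullbackOn I g s η) s z = pullbackOn I g s (extD I η) z := by
  rw [(eventually_pullbackOn_eq η hs hg hz).extDerivWithin_eq_of_mem hz]
  have hc := contDiffWithinAt_coordMap (hg z hz)
  have hdiff : DifferentiableWithinAt ℝ (chartForm I η (g z)) (range I) (coordMap I g z z) := by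
    have h1 := hη (g z) (coordMap I g z z) (mem_extChartAt_target (g z))
    exact (h1.differentiableWithinAt (by simp)).mono_of_mem_nhdsWithin
      (extChartAt_target_mem_nhdsWithin (g z))
  have hmaps : MapsTo (coordMap I g z) s (range I) := by
    intro y _
    simp [coordMap, extChartAt]
  rw [extDerivWithin_pullback (r := ∞) hdiff hc minSmoothness_two_le_infty hs hzc hz hmaps]
  -- With `z` itself as base point, the chart is the one in which `extD` is computed at `g z`, so
  -- the two sides match definitionally.
  have hd := mfderivWithin_coordMap (z₀ := z) (hs z hz)
    ((hg z hz).mdifferentiableWithinAt (by simp)) (mem_extChartAt_source (g z))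
  rw [hd]
  rfl

omit [IsManifold I ∞ M] in
theorem pullbackOn_congr_set {k : ℕ} (η : DForm I M k) (g : X → M) {s t : Set X} {z : X}
    (h : s =ᶠ[𝓝 z] t) : pullbackOn I g s η z = pullbackOn I g t η z := by
  unfold pullbackOn
  rw [mfderivWithin_congr_set h]

omit [IsManifold I ∞ M] in
theorem pullbackOn_pullback {k : ℕ} (η : DForm I' M' k) {f : M → M'} {g : X → M} {s : Set X} {z : X}
    (hs : UniqueDiffWithinAt ℝ s z) (hf : MDifferentiableAt I I' f (g z))
    (hg : MDifferentiableWithinAt 𝓘(ℝ, X) I g s z) :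
    pullbackOn I g s (pullback I I' f η) z = pullbackOn I' (f ∘ g) s η z := by
  unfold pullbackOn pullback
  rw [mfderiv_comp_mfderivWithin z hf hg hs.uniqueMDiffWithinAt]
  rfl

omit [IsManifold I ∞ M] in
theorem pullback_pullback {E₂ H₂ : Type*} [NormedAddCommGroup E₂] [NormedSpace ℝ E₂]
    [TopologicalSpace H₂] {I₂ : ModelWithCorners ℝ E₂ H₂} {M₂ : Type*} [TopologicalSpace M₂]
    [ChartedSpace H₂ M₂] {k : ℕ} (η : DForm I₂ M₂ k) {f : M → M'} {g : M' → M₂} {x : M}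
    (hg : MDifferentiableAt I' I₂ g (f x)) (hf : MDifferentiableAt I I' f x) :
    pullback I I' f (pullback I' I₂ g η) x = pullback I I₂ (g ∘ f) η x := by
  unfold pullback
  rw [mfderiv_comp x hg hf]
  rfl

omit [IsManifold I ∞ M] in
theorem extChartAt_target_eventuallyEq_range {x₀ : M} {y : E} (hy : y ∈ (extChartAt I x₀).target) :
    (extChartAt I x₀).target =ᶠ[𝓝 y] range I := by
  have h := extChartAt_target_mem_nhdsWithin_of_mem hy
  rw [mem_nhdsWithin_iff_eventually] at h
  filter_upwards [h] with z hz
  exact propext ⟨fun h => extChartAt_target_subset_range x₀ h, hz⟩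

/-- The coordinate expression of the pull-back is the pull-back along `f` composed with an inverse
chart. Derivatives within the chart target and within the range of the model agree, since these sets
coincide near points of the target. -/
theorem isSmoothForm_pullback {k : ℕ} {η : DForm I' M' k} [IsManifold I' ∞ M']
    (hη : IsSmoothForm I' η) {f : M → M'} (hf : ContMDiff I I' ∞ f) :
    IsSmoothForm I (pullback I I' f η) := by
  intro x₀
  have hs : UniqueDiffOn ℝ (extChartAt I x₀).target := uniqueDiffOn_extChartAt_target x₀
  have hsymm : ContMDiffOn 𝓘(ℝ, E) I ∞ (extChartAt I x₀).symm (extChartAt I x₀).target :=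
    contMDiffOn_extChartAt_symm x₀
  refine (contDiffOn_pullbackOn hη hs (hf.comp_contMDiffOn hsymm)).congr fun y hy => ?_
  rw [← pullbackOn_pullback I' η (hs y hy) ((hf _).mdifferentiableAt (by simp))
    ((hsymm y hy).mdifferentiableWithinAt (by simp))]
  exact (pullbackOn_congr_set _ _ (extChartAt_target_eventuallyEq_range hy)).symm

end PullbackOn

/-! ## Stokes' theorem for smooth singular 3-simplices -/

theorem convex_simplex (k : ℕ) : Convex ℝ (Simplex k) := by
  intro x hx y hy a b ha hb hab
  refine ⟨fun i => ?_, ?_⟩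
  · have := hx.1 i; have := hy.1 i
    simp only [Pi.add_apply, Pi.smul_apply, smul_eq_mul]
    positivity
  · simp only [Pi.add_apply, Pi.smul_apply, smul_eq_mul, Finset.sum_add_distrib, ← Finset.mul_sum]
    nlinarith [hx.2, hy.2]

theorem isClosed_simplex (k : ℕ) : IsClosed (Simplex k) := by
  have : Simplex k = (⋂ i, {t | 0 ≤ t i}) ∩ {t | ∑ i, t i ≤ 1} := by
    ext t; simp [Simplex]
  rw [this]
  exact (isClosed_iInter fun i => isClosed_le continuous_const (continuous_apply i)).inter
    (isClosed_le (by fun_prop) continuous_const)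

theorem isCompact_simplex (k : ℕ) : IsCompact (Simplex k) := by
  refine (isCompact_univ_pi fun _ : Fin k => isCompact_Icc (a := (0 : ℝ)) (b := 1)).of_isClosed_subset
    (isClosed_simplex k) fun t ht i _ => ⟨ht.1 i, ?_⟩
  exact (Finset.single_le_sum (fun j _ => ht.1 j) (Finset.mem_univ i)).trans ht.2

theorem nonempty_interior_simplex (k : ℕ) : (interior (Simplex k)).Nonempty := by
  refine ⟨fun _ => 1 / (k + 1 : ℝ), mem_interior.2 ⟨(⋂ i, {t : Fin k → ℝ | 0 < t i}) ∩ {t | ∑ i, t i < 1},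
    ?_, ?_, ?_⟩⟩
  · rintro t ⟨h1, h2⟩
    simp only [mem_iInter, mem_ofPred_eq] at h1 h2
    exact ⟨fun i => (h1 i).le, h2.le⟩
  · exact (isOpen_iInter_of_finite fun i => isOpen_lt continuous_const (continuous_apply i)).inter
      (isOpen_lt (by fun_prop) continuous_const)
  · have hk : (0 : ℝ) < k + 1 := by positivity
    refine ⟨?_, ?_⟩
    · simp only [mem_iInter, mem_ofPred_eq]
      intro i; positivity
    · simp only [mem_ofPred_eq, Finset.sum_const, Finset.card_univ, Fintype.card_fin, nsmul_eq_mul]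
      rw [mul_one_div, div_lt_one hk]
      linarith

theorem uniqueDiffOn_simplex (k : ℕ) : UniqueDiffOn ℝ (Simplex k) :=
  uniqueDiffOn_convex (convex_simplex k) (nonempty_interior_simplex k)

theorem simplex_subset_closure_interior (k : ℕ) : Simplex k ⊆ closure (interior (Simplex k)) := by
  rw [(convex_simplex k).closure_interior_eq_closure_of_nonempty_interior
    (nonempty_interior_simplex k)]
  exact subset_closure

/-- This describes the simplex as a family of intervals over its `i`-th coordinate face, as needed
for Fubini's theorem. -/
theorem insertNth_mem_simplex {k : ℕ} (i : Fin (k + 1)) (r : ℝ) (s : Fin k → ℝ) :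
    (i.insertNth r s : Fin (k + 1) → ℝ) ∈ Simplex (k + 1) ↔
      s ∈ Simplex k ∧ r ∈ Icc 0 (1 - ∑ j, s j) := by
  simp only [Simplex, mem_ofPred_eq, Fin.forall_iff_succAbove i, Fin.sum_univ_succAbove _ i,
    Fin.insertNth_apply_same, Fin.insertNth_apply_succAbove, mem_Icc]
  constructor
  · rintro ⟨⟨h0, h1⟩, h2⟩
    exact ⟨⟨h1, by linarith⟩, h0, by linarith⟩
  · rintro ⟨⟨h1, h2⟩, h0, h3⟩
    exact ⟨⟨h0, h1⟩, by linarith⟩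

/-- Integration of a partial derivative over the standard simplex. -/
theorem integral_simplex_partial {k : ℕ} {g : (Fin (k + 1) → ℝ) → ℝ}
    (hg : ContDiffOn ℝ 1 g (Simplex (k + 1))) (i : Fin (k + 1)) :
    ∫ t in Simplex (k + 1), fderivWithin ℝ g (Simplex (k + 1)) t (Pi.single i 1) =
      ∫ s in Simplex k, (g (i.insertNth (1 - ∑ j, s j) s) - g (i.insertNth 0 s)) := by
  set h : (Fin (k + 1) → ℝ) → ℝ := fun t => fderivWithin ℝ g (Simplex (k + 1)) t (Pi.single i 1)
    with hh
  have hcont : ContinuousOn h (Simplex (k + 1)) :=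
    (hg.continuousOn_fderivWithin (uniqueDiffOn_simplex _) le_rfl).clm_apply continuousOn_const
  have hint : IntegrableOn h (Simplex (k + 1)) :=
    hcont.integrableOn_compact (isCompact_simplex _)
  have hmeas := (isClosed_simplex (k + 1)).measurableSet
  have hmeas' := (isClosed_simplex k).measurableSet
  let e := (MeasurableEquiv.piFinSuccAbove (fun _ : Fin (k + 1) => ℝ) i).symm
  have hcoe : ∀ p : ℝ × (Fin k → ℝ), e p = i.insertNth p.1 p.2 := fun p => rfl
  -- Splitting off the `i`-th coordinate preserves volume; in the iterated integral this coordinate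
  -- becomes the inner variable, to which the fundamental theorem of calculus applies.
  have he : MeasurePreserving e :=
    (volume_preserving_piFinSuccAbove (fun _ : Fin (k + 1) => ℝ) i).symm
  rw [← integral_indicator hmeas, ← integral_indicator hmeas',
    ← he.integral_comp e.measurableEmbedding]
  have hint2 : Integrable (fun p => (Simplex (k + 1)).indicator h (e p)) (volume.prod volume) :=
    (he.integrable_comp_emb e.measurableEmbedding).2 ((integrable_indicator_iff hmeas).2 hint)
  rw [Measure.volume_eq_prod, integral_prod_symm _ hint2]
  congr 1
  funext s
  by_cases hs : s ∈ Simplex k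
  · rw [indicator_of_mem hs]
    have h1 : (fun r : ℝ => (Simplex (k + 1)).indicator h (e (r, s))) =
        (Icc 0 (1 - ∑ j, s j)).indicator fun r => h (i.insertNth r s) := by
      funext r
      by_cases hr : r ∈ Icc 0 (1 - ∑ j, s j)
      · rw [indicator_of_mem hr, indicator_of_mem, hcoe]
        exact (insertNth_mem_simplex i r s).2 ⟨hs, hr⟩
      · rw [indicator_of_notMem hr, indicator_of_notMem]
        exact fun hmem => hr ((insertNth_mem_simplex i r s).1 hmem).2
    have hle : 0 ≤ 1 - ∑ j, s j := by linarith [hs.2]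
    have hins : ∀ r : ℝ, HasDerivAt (fun r : ℝ => (i.insertNth r s : Fin (k + 1) → ℝ))
        (Pi.single i 1) r := by
      intro r
      rw [hasDerivAt_pi]
      intro j
      refine Fin.succAboveCases i ?_ (fun m => ?_) j
      · simpa using hasDerivAt_id' r
      · simpa using hasDerivAt_const r (s m)
    have hinsc : Continuous fun r : ℝ => (i.insertNth r s : Fin (k + 1) → ℝ) :=
      continuous_iff_continuousAt.2 fun r => (hins r).continuousAt
    have hmaps : MapsTo (fun r : ℝ => (i.insertNth r s : Fin (k + 1) → ℝ)) (Icc 0 (1 - ∑ j, s j))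
        (Simplex (k + 1)) := fun r hr => (insertNth_mem_simplex i r s).2 ⟨hs, hr⟩
    rw [h1, integral_indicator measurableSet_Icc, integral_Icc_eq_integral_Ioc,
      ← intervalIntegral.integral_of_le hle]
    -- The two-sided derivative exists only at interior points of the fibre; at the endpoints
    -- continuity suffices.
    refine intervalIntegral.integral_eq_sub_of_hasDerivAt_of_le hle
      (f := fun r => g (i.insertNth r s)) (hg.continuousOn.comp hinsc.continuousOn hmaps) ?_ ?_
    · intro r hr
      have hr' := hmaps (Ioo_subset_Icc_self hr)
      have h2 : HasDerivWithinAt (fun r : ℝ => g (i.insertNth r s)) (h (i.insertNth r s))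
          (Icc 0 (1 - ∑ j, s j)) r :=
        ((hg.differentiableOn one_ne_zero _ hr').hasFDerivWithinAt.comp_hasDerivWithinAt r
          (hins r).hasDerivWithinAt hmaps)
      exact h2.hasDerivAt (Icc_mem_nhds hr.1 hr.2)
    · exact (hcont.comp hinsc.continuousOn hmaps).intervalIntegrable_of_Icc hle
  · rw [indicator_of_notMem hs]
    have : (fun r : ℝ => (Simplex (k + 1)).indicator h (e (r, s))) = fun _ => 0 := by
      funext r
      rw [indicator_of_notMem]
      exact fun hmem => hs ((insertNth_mem_simplex i r s).1 hmem).1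
    simp [this]

/-- The integral over the standard 2-simplex is invariant under volume preserving affine maps. -/
theorem integral_simplex_two_comp_affine (A : Matrix (Fin 2) (Fin 2) ℝ) (hA : |A.det| = 1)
    (b : Fin 2 → ℝ) (hmem : ∀ s, A.mulVec s + b ∈ Simplex 2 ↔ s ∈ Simplex 2)
    (G : (Fin 2 → ℝ) → ℝ) :
    ∫ s in Simplex 2, G (A.mulVec s + b) = ∫ s in Simplex 2, G s := by
  have hdet : A.det ≠ 0 := by
    intro h; rw [h] at hA; simp at hA
  have h1 : MeasurePreserving (Matrix.toLin' A) := by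
    refine ⟨(Matrix.toLin' A).continuous_of_finiteDimensional.measurable, ?_⟩
    rw [Real.map_matrix_volume_pi_eq_smul_volume_pi hdet, abs_inv, hA]
    simp
  have h2 : MeasurePreserving (fun s : Fin 2 → ℝ => A.mulVec s + b) :=
    (measurePreserving_add_right volume b).comp h1
  have hinj : Function.Injective (fun s : Fin 2 → ℝ => A.mulVec s + b) := by
    intro s t hst
    have hu : IsUnit A := (Matrix.isUnit_iff_isUnit_det A).2 (isUnit_iff_ne_zero.2 hdet)
    exact Matrix.mulVec_injective_iff_isUnit.2 hu (add_right_cancel hst)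
  have hc : Continuous (fun s : Fin 2 → ℝ => A.mulVec s + b) :=
    ((Matrix.toLin' A).continuous_of_finiteDimensional).add continuous_const
  have h3 := h2.setIntegral_preimage_emb (hc.measurableEmbedding hinj) G (Simplex 2)
  rwa [show (fun s : Fin 2 → ℝ => A.mulVec s + b) ⁻¹' Simplex 2 = Simplex 2 from
    Set.ext hmem] at h3

theorem faceMap_zero_two (s : Fin 2 → ℝ) : faceMap 0 s = ![1 - (s 0 + s 1), s 0, s 1] := by
  funext l
  fin_cases l
  · simp [faceMap, Fin.sum_univ_two]
  · rfl
  · rfl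

/-- All coordinate projections parametrize the slanted face with the same volume. -/
theorem integral_slanted_face (G : (Fin 3 → ℝ) → ℝ) (i : Fin 3) :
    ∫ s in Simplex 2, G (i.insertNth (1 - ∑ j, s j) s) =
      ∫ s in Simplex 2, G (faceMap 0 s) := by
  have hS : ∀ s : Fin 2 → ℝ, s ∈ Simplex 2 ↔ (0 ≤ s 0 ∧ 0 ≤ s 1) ∧ s 0 + s 1 ≤ 1 := by
    intro s
    simp [Simplex, Fin.forall_fin_two, Fin.sum_univ_two]
  fin_cases i
  · refine integral_congr_ae (Filter.Eventually.of_forall fun s => ?_)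
    simp only [faceMap_zero_two, Fin.sum_univ_two]
    congr 1
    funext l
    fin_cases l <;> rfl
  · have hA : ∀ s : Fin 2 → ℝ, (!![-1, -1; 0, 1] : Matrix (Fin 2) (Fin 2) ℝ).mulVec s + ![1, 0] =
        ![1 - s 0 - s 1, s 1] := by
      intro s
      funext l
      fin_cases l
      · simp [dotProduct, Fin.sum_univ_two]; ring
      · simp [dotProduct, Fin.sum_univ_two]
    rw [← integral_simplex_two_comp_affine !![-1, -1; 0, 1] (by simp [Matrix.det_fin_two]) ![1, 0]]
    · refine integral_congr_ae (Filter.Eventually.of_forall fun s => ?_)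
      simp only [hA, faceMap_zero_two, Fin.sum_univ_two]
      congr 1
      refine Fin.insertNth_eq_iff.2 ⟨?_, ?_⟩
      · change 1 - (1 - s 0 - s 1 + s 1) = s 0
        ring
      · funext l
        fin_cases l
        · exact sub_sub _ _ _
        · rfl
    · intro s
      rw [hS, hS, hA]
      simp only [Matrix.cons_val_zero, Matrix.cons_val_one]
      constructor <;> rintro ⟨⟨h1, h2⟩, h3⟩ <;> refine ⟨⟨?_, ?_⟩, ?_⟩ <;> linarith
  · have hA : ∀ s : Fin 2 → ℝ, (!![-1, -1; 1, 0] : Matrix (Fin 2) (Fin 2) ℝ).mulVec s + ![1, 0] =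
        ![1 - s 0 - s 1, s 0] := by
      intro s
      funext l
      fin_cases l
      · simp [dotProduct, Fin.sum_univ_two]; ring
      · simp [dotProduct, Fin.sum_univ_two]
    rw [← integral_simplex_two_comp_affine !![-1, -1; 1, 0] (by simp [Matrix.det_fin_two]) ![1, 0]]
    · refine integral_congr_ae (Filter.Eventually.of_forall fun s => ?_)
      simp only [hA, faceMap_zero_two, Fin.sum_univ_two]
      congr 1
      refine Fin.insertNth_eq_iff.2 ⟨?_, ?_⟩
      · change 1 - (1 - s 0 - s 1 + s 0) = s 1
        ring
      · funext l
        fin_cases l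
        · exact sub_sub _ _ _
        · rfl
    · intro s
      rw [hS, hS, hA]
      simp only [Matrix.cons_val_zero, Matrix.cons_val_one]
      constructor <;> rintro ⟨⟨h1, h2⟩, h3⟩ <;> refine ⟨⟨?_, ?_⟩, ?_⟩ <;> linarith

theorem fderiv_faceMap_succ {k : ℕ} (i : Fin (k + 1)) (s v : Fin k → ℝ) :
    fderiv ℝ (faceMap i.succ : (Fin k → ℝ) → Fin (k + 1) → ℝ) s v = i.insertNth 0 v := by
  have h : HasFDerivAt (faceMap i.succ : (Fin k → ℝ) → Fin (k + 1) → ℝ)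
      (ContinuousLinearMap.pi fun l : Fin (k + 1) =>
        (Fin.insertNth (α := fun _ => (Fin k → ℝ) →L[ℝ] ℝ) i 0
          (fun m : Fin k => ContinuousLinearMap.proj m) l)) s := by
    rw [hasFDerivAt_pi]
    intro l
    refine Fin.succAboveCases i ?_ (fun m => ?_) l
    · simpa [faceMap] using hasFDerivAt_const (0 : ℝ) s
    · simpa [faceMap] using hasFDerivAt_apply m s
  rw [h.fderiv]
  funext l
  refine Fin.succAboveCases i ?_ (fun m => ?_) l <;> simp

theorem fderiv_faceMap_zero {k : ℕ} (s v : Fin k → ℝ) :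
    fderiv ℝ (faceMap 0 : (Fin k → ℝ) → Fin (k + 1) → ℝ) s v = Fin.cons (-∑ j, v j) v := by
  have h : HasFDerivAt (faceMap 0 : (Fin k → ℝ) → Fin (k + 1) → ℝ)
      (ContinuousLinearMap.pi fun l : Fin (k + 1) =>
        (Fin.cons (α := fun _ => (Fin k → ℝ) →L[ℝ] ℝ) (-∑ j, ContinuousLinearMap.proj j)
          (fun m : Fin k => ContinuousLinearMap.proj m) l)) s := by
    rw [hasFDerivAt_pi]
    intro l
    refine Fin.cases ?_ (fun m => ?_) l
    · simp only [faceMap, Fin.cases_zero, Fin.cons_zero]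
      exact (HasFDerivAt.fun_sum fun j _ => hasFDerivAt_apply j s).const_sub 1
    · simpa [faceMap] using hasFDerivAt_apply m s
  rw [h.fderiv]
  funext l
  refine Fin.cases ?_ (fun m => ?_) l <;> simp

/-- The arguments on the left are the images of the two coordinate directions under the differential
of `faceMap 0`. Bilinear expansion produces the components of `θ` with exactly the signs of the
exterior derivative. -/
theorem alternating_two_slanted (θ : (Fin 3 → ℝ) [⋀^Fin 2]→L[ℝ] ℝ) :
    θ ![Pi.single 1 1 - Pi.single 0 1, Pi.single 2 1 - Pi.single 0 1] =
      θ ![Pi.single 1 1, Pi.single 2 1] - θ ![Pi.single 0 1, Pi.single 2 1] +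
        θ ![Pi.single 0 1, Pi.single 1 1] := by
  have hsub0 : ∀ a b c, θ ![a - b, c] = θ ![a, c] - θ ![b, c] := fun a b c => by
    have h := θ.toAlternatingMap.map_update_sub ![a, c] 0 a b
    have hu : ∀ d, Function.update ![a, c] 0 d = ![d, c] := fun d => by
      funext j; fin_cases j <;> rfl
    rw [hu, hu, hu] at h
    exact h
  have hsub1 : ∀ a b c, θ ![c, a - b] = θ ![c, a] - θ ![c, b] := fun a b c => by
    have h := θ.toAlternatingMap.map_update_sub ![c, a] 1 a b
    have hu : ∀ d, Function.update ![c, a] 1 d = ![c, d] := fun d => by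
      funext j; fin_cases j <;> rfl
    rw [hu, hu, hu] at h
    exact h
  have hself : ∀ a, θ ![a, a] = 0 := fun a => θ.map_eq_zero_of_eq _ (i := 0) (j := 1) rfl (by simp)
  have hswap : ∀ a b, θ ![a, b] = - θ ![b, a] := fun a b => by
    have := hself (a - b)
    rw [hsub0, hsub1, hsub1, hself, hself] at this
    linarith
  rw [hsub0, hsub1, hsub1, hself, hswap (Pi.single 1 1) (Pi.single 0 1)]
  ring

/-- Stokes' theorem on the standard 3-simplex for closed 2-forms. -/
theorem sum_integral_faces_eq_zero {θ : (Fin 3 → ℝ) → (Fin 3 → ℝ) [⋀^Fin 2]→L[ℝ] ℝ}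
    (hθ : ContDiffOn ℝ 1 θ (Simplex 3))
    (hclosed : ∀ t ∈ Simplex 3, extDerivWithin θ (Simplex 3) t = 0) :
    ∑ i : Fin 4, (-1 : ℝ) ^ (i : ℕ) * ∫ s in Simplex 2, θ (faceMap i s)
      ![fderiv ℝ (faceMap i) s (Pi.single 0 1), fderiv ℝ (faceMap i) s (Pi.single 1 1)] = 0 := by
  let e : Fin 3 → Fin 3 → ℝ := fun i => Pi.single i 1
  -- `G i` is the component of `θ` omitting the `i`-th coordinate; dθ is the alternating sum of the
  -- partial derivatives ∂ᵢ `G i`.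
  let G : Fin 3 → (Fin 3 → ℝ) → ℝ := fun i t => θ t (i.removeNth e)
  have hG : ∀ i, ContDiffOn ℝ 1 (G i) (Simplex 3) := fun i =>
    (ContinuousAlternatingMap.apply ℝ (Fin 3 → ℝ) ℝ (i.removeNth e)).contDiff.comp_contDiffOn hθ
  have hmeas3 := (isClosed_simplex 3).measurableSet
  have hmeas2 := (isClosed_simplex 2).measurableSet
  have hfaceint : ∀ (i : Fin 3) (j : Fin 4), IntegrableOn (fun s => G i (faceMap j s)) (Simplex 2) :=
    fun i j => ((hG i).continuousOn.comp (contDiff_faceMap j).continuous.continuousOn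
      fun s hs => faceMap_mem j hs).integrableOn_compact (isCompact_simplex 2)
  have hdint : ∀ i, IntegrableOn (fun t => fderivWithin ℝ (G i) (Simplex 3) t (e i)) (Simplex 3) :=
    fun i => (((hG i).continuousOn_fderivWithin (uniqueDiffOn_simplex _) le_rfl).clm_apply
      continuousOn_const).integrableOn_compact (isCompact_simplex 3)
  have hpart : ∀ i, ∫ t in Simplex 3, fderivWithin ℝ (G i) (Simplex 3) t (e i) =
      (∫ s in Simplex 2, G i (faceMap 0 s)) - ∫ s in Simplex 2, G i (faceMap i.succ s) := by
    intro i
    rw [integral_simplex_partial (hG i) i, integral_sub, integral_slanted_face (G i) i]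
    · rfl
    · have hc : Continuous fun s : Fin 2 → ℝ => (i.insertNth (1 - ∑ j, s j) s : Fin 3 → ℝ) := by
        rw [continuous_pi_iff]
        intro l
        refine Fin.succAboveCases i ?_ (fun m => ?_) l
        · simp only [Fin.insertNth_apply_same]; fun_prop
        · simp only [Fin.insertNth_apply_succAbove]; fun_prop
      refine ((hG i).continuousOn.comp hc.continuousOn fun s hs => ?_).integrableOn_compact
        (isCompact_simplex 2)
      refine (insertNth_mem_simplex i _ s).2 ⟨hs, ?_, le_rfl⟩
      linarith [hs.2]
    · exact hfaceint i i.succ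
  have hsum : ∑ i : Fin 3, (-1 : ℝ) ^ (i : ℕ) *
      ∫ t in Simplex 3, fderivWithin ℝ (G i) (Simplex 3) t (e i) = 0 := by
    simp_rw [← integral_const_mul]
    rw [← integral_finsetSum _ fun i _ => (hdint i).const_mul _]
    refine setIntegral_eq_zero_of_forall_eq_zero fun t ht => ?_
    have h : extDerivWithin θ (Simplex 3) t e = ∑ i : Fin 3, (-1 : ℝ) ^ (i : ℕ) *
        fderivWithin ℝ (G i) (Simplex 3) t (e i) := by
      rw [extDerivWithin_apply (hθ.differentiableOn one_ne_zero t ht)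
        (uniqueDiffOn_simplex 3 t ht) e]
      refine Finset.sum_congr rfl fun i _ => ?_
      simp [G]
    rw [hclosed t ht] at h
    exact h.symm
  -- The slanted face collects the upper boundary terms of all three coordinate integrations.
  have hzero : ∫ s in Simplex 2, θ (faceMap 0 s)
      ![fderiv ℝ (faceMap 0) s (Pi.single 0 1), fderiv ℝ (faceMap 0) s (Pi.single 1 1)] =
      ∑ i : Fin 3, (-1 : ℝ) ^ (i : ℕ) * ∫ s in Simplex 2, G i (faceMap 0 s) := by
    simp_rw [← integral_const_mul]
    rw [← integral_finsetSum _ fun i _ => (hfaceint i 0).const_mul _]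
    refine integral_congr_ae (Filter.Eventually.of_forall fun s => ?_)
    simp only
    have h0 : fderiv ℝ (faceMap 0 : (Fin 2 → ℝ) → Fin 3 → ℝ) s (Pi.single 0 1) =
        Pi.single 1 1 - Pi.single 0 1 := by
      rw [fderiv_faceMap_zero]
      funext l
      refine Fin.cases ?_ (fun m => ?_) l
      · simp
      · rw [Fin.cons_succ, Pi.sub_apply]
        fin_cases m <;> simp
    have h1 : fderiv ℝ (faceMap 0 : (Fin 2 → ℝ) → Fin 3 → ℝ) s (Pi.single 1 1) =
        Pi.single 2 1 - Pi.single 0 1 := by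
      rw [fderiv_faceMap_zero]
      funext l
      refine Fin.cases ?_ (fun m => ?_) l
      · simp
      · rw [Fin.cons_succ, Pi.sub_apply]
        fin_cases m <;> simp
    have e0 : (0 : Fin 3).removeNth e = ![Pi.single 1 1, Pi.single 2 1] := by
      funext j; fin_cases j <;> rfl
    have e1 : (1 : Fin 3).removeNth e = ![Pi.single 0 1, Pi.single 2 1] := by
      funext j; fin_cases j <;> rfl
    have e2 : (2 : Fin 3).removeNth e = ![Pi.single 0 1, Pi.single 1 1] := by
      funext j; fin_cases j <;> rfl
    rw [h0, h1, alternating_two_slanted]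
    simp only [G, Fin.sum_univ_three, e0, e1, e2]
    simp
    ring
  have hsucc : ∀ i : Fin 3, ∫ s in Simplex 2, θ (faceMap i.succ s)
      ![fderiv ℝ (faceMap i.succ) s (Pi.single 0 1), fderiv ℝ (faceMap i.succ) s (Pi.single 1 1)] =
      ∫ s in Simplex 2, G i (faceMap i.succ s) := by
    intro i
    refine integral_congr_ae (Filter.Eventually.of_forall fun s => ?_)
    simp only [G]
    congr 1
    have key : ∀ j : Fin 2, (i.insertNth 0 (Pi.single j 1 : Fin 2 → ℝ) : Fin 3 → ℝ) =
        e (i.succAbove j) := by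
      intro j
      funext l
      refine Fin.succAboveCases i ?_ (fun m => ?_) l
      · simp [e, (Fin.succAbove_ne i j).symm]
      · simp [e, Pi.single_apply]
    funext j
    fin_cases j
    · exact (fderiv_faceMap_succ i s _).trans (key 0)
    · exact (fderiv_faceMap_succ i s _).trans (key 1)
  -- The face opposite to vertex `i + 1` is the coordinate face `tᵢ = 0`. The index shift supplies
  -- the minus sign of the lower boundary term.
  rw [Fin.sum_univ_succ, hzero]
  simp_rw [hsucc]
  simp_rw [hpart, mul_sub] at hsum
  rw [Finset.sum_sub_distrib] at hsum
  simp only [Fin.val_zero, pow_zero, one_mul, Fin.val_succ, pow_succ, mul_neg, mul_one, neg_mul,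
    Finset.sum_neg_distrib]
  linarith

/-! ## Integration of forms over chains -/

section Chains

variable {E H : Type*} [NormedAddCommGroup E] [NormedSpace ℝ E] [TopologicalSpace H]
  (I : ModelWithCorners ℝ E H) {M : Type*} [TopologicalSpace M] [ChartedSpace H M]
  {E' H' : Type*} [NormedAddCommGroup E'] [NormedSpace ℝ E'] [TopologicalSpace H']
  (I' : ModelWithCorners ℝ E' H') {M' : Type*} [TopologicalSpace M'] [ChartedSpace H' M']
  {X Y : Type*} [NormedAddCommGroup X] [NormedSpace ℝ X] [NormedAddCommGroup Y] [NormedSpace ℝ Y]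

theorem pullbackOn_congr {k : ℕ} (η : DForm I M k) {g g' : X → M} {s : Set X} (h : EqOn g g' s)
    {z : X} (hz : z ∈ s) : pullbackOn I g s η z = pullbackOn I g' s η z := by
  have h1 := mfderivWithin_congr (I := 𝓘(ℝ, X)) (I' := I) h (h hz)
  have key : ∀ (y : M) (_ : g z = y) (w : Fin k → E), (η (g z)) w = (η y) w := by
    rintro y rfl w; rfl
  unfold pullbackOn
  ext v
  refine (key _ (h hz) _).trans (congrArg (η (g' z)) ?_)
  funext j
  exact congrArg (fun L : X →L[ℝ] E => L (v j)) h1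

theorem pullbackOn_comp {k : ℕ} (η : DForm I M k) {g : X → M} {f : Y → X} {s : Set X} {t : Set Y}
    {z : Y} (hg : MDifferentiableWithinAt 𝓘(ℝ, X) I g s (f z))
    (hf : DifferentiableWithinAt ℝ f t z) (hft : MapsTo f t s) (ht : UniqueDiffWithinAt ℝ t z) :
    pullbackOn I (g ∘ f) t η z =
      (pullbackOn I g s η (f z)).compContinuousLinearMap (fderivWithin ℝ f t z) := by
  unfold pullbackOn
  rw [mfderivWithin_comp z hg hf.mdifferentiableWithinAt hft ht.uniqueMDiffWithinAt,
    mfderivWithin_eq_fderivWithin]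
  rfl

/-- On the simplex a face is `σ` composed with `faceMap i`, so this is the chain rule. The values
prescribed outside the simplex do not affect derivatives within it. -/
theorem simplexIntegral_face (η : DForm I M 2) (σ : SmoothSimplex I M 3) (i : Fin 4) :
    simplexIntegral I η (σ.face I i) = ∫ s in Simplex 2, pullbackOn I σ.1 (Simplex 3) η
      (faceMap i s) ![fderiv ℝ (faceMap i) s (Pi.single 0 1),
        fderiv ℝ (faceMap i) s (Pi.single 1 1)] := by
  refine setIntegral_congr_fun (isClosed_simplex 2).measurableSet fun t ht => ?_
  have hu := uniqueDiffOn_simplex 2 t ht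
  have hd : DifferentiableAt ℝ (faceMap i : (Fin 2 → ℝ) → Fin 3 → ℝ) t :=
    (contDiff_faceMap i).differentiable (by simp) t
  have h1 : pullbackOn I (σ.face I i).1 (Simplex 2) η t =
      pullbackOn I (σ.1 ∘ faceMap i) (Simplex 2) η t := by
    refine pullbackOn_congr I η (fun s hs => ?_) ht
    simp [SmoothSimplex.face, hs]
  have h2 := pullbackOn_comp I η (s := Simplex 3)
    ((σ.2.1 _ (faceMap_mem i ht)).mdifferentiableWithinAt (by simp)) hd.differentiableWithinAt
    (fun s hs => faceMap_mem i hs) hu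
  rw [hd.fderivWithin hu] at h2
  have h3 := congrArg (fun θ : (Fin 2 → ℝ) [⋀^Fin 2]→L[ℝ] ℝ => θ ![Pi.single 0 1, Pi.single 1 1])
    (h1.trans h2)
  refine Eq.trans h3 ?_
  simp only [ContinuousAlternatingMap.compContinuousLinearMap_apply]
  congr 1
  funext j
  fin_cases j <;> rfl

variable [IsManifold I ∞ M]

/-- Stokes' theorem for closed 2-forms on smooth singular 3-simplices. -/
theorem sum_simplexIntegral_face {η : DForm I M 2} (hη : IsSmoothForm I η)
    (hclosed : ∀ x, extD I η x = 0) (σ : SmoothSimplex I M 3) :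
    ∑ i : Fin 4, (-1 : ℝ) ^ (i : ℕ) * simplexIntegral I η (σ.face I i) = 0 := by
  simp_rw [simplexIntegral_face]
  refine sum_integral_faces_eq_zero
    ((contDiffOn_pullbackOn hη (uniqueDiffOn_simplex 3) σ.2.1).of_le (by simp)) fun t ht => ?_
  rw [extDerivWithin_pullbackOn hη (uniqueDiffOn_simplex 3) σ.2.1 ht
    (simplex_subset_closure_interior 3 ht)]
  unfold pullbackOn
  rw [hclosed]
  rfl

theorem integrableOn_simplexIntegral {η : DForm I M 2} (hη : IsSmoothForm I η)
    (σ : SmoothSimplex I M 2) :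
    IntegrableOn (fun t => pullbackOn I σ.1 (Simplex 2) η t ![Pi.single 0 1, Pi.single 1 1])
      (Simplex 2) := by
  refine ContinuousOn.integrableOn_compact (isCompact_simplex 2) ?_
  exact ((ContinuousAlternatingMap.apply ℝ (Fin 2 → ℝ) ℝ
    ![Pi.single 0 1, Pi.single 1 1]).continuous).comp_continuousOn
    (contDiffOn_pullbackOn hη (uniqueDiffOn_simplex 2) σ.2.1).continuousOn

theorem simplexIntegral_add {η₁ η₂ : DForm I M 2} (h₁ : IsSmoothForm I η₁)
    (h₂ : IsSmoothForm I η₂) (σ : SmoothSimplex I M 2) :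
    simplexIntegral I (η₁ + η₂) σ = simplexIntegral I η₁ σ + simplexIntegral I η₂ σ :=
  integral_add (integrableOn_simplexIntegral I h₁ σ) (integrableOn_simplexIntegral I h₂ σ)

omit [IsManifold I ∞ M] in
theorem simplexIntegral_smul (r : ℝ) (η : DForm I M 2) (σ : SmoothSimplex I M 2) :
    simplexIntegral I (r • η) σ = r * simplexIntegral I η σ :=
  integral_const_mul r _

omit [IsManifold I ∞ M] in
theorem simplexIntegral_map {f : C^∞⟮I, M; I', M'⟯} (η : DForm I' M' 2)
    (σ : SmoothSimplex I M 2) :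
    simplexIntegral I' η (σ.map I I' f) = simplexIntegral I (pullback I I' f η) σ := by
  refine setIntegral_congr_fun (isClosed_simplex 2).measurableSet fun t ht => ?_
  have h := pullbackOn_pullback (I := I) I' η (f := f) (g := σ.1) (uniqueDiffOn_simplex 2 t ht)
    ((f.contMDiff _).mdifferentiableAt (by simp)) ((σ.2.1 t ht).mdifferentiableWithinAt (by simp))
  exact (congrArg (fun θ : (Fin 2 → ℝ) [⋀^Fin 2]→L[ℝ] ℝ => θ ![Pi.single 0 1, Pi.single 1 1])
    h).symm

/-! ### Linearity of integration and its invariance under homology -/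

section Linear

variable {R : Type*} [CommRing R] [Algebra R ℝ]

/-- Integration over chains as an additive map. -/
def chainIntegralHom (R : Type*) [CommRing R] [Algebra R ℝ] (η : DForm I M 2) :
    Chain I M R 2 →+ ℝ :=
  Finsupp.liftAddHom fun σ =>
    (AddMonoidHom.mulRight (simplexIntegral I η σ)).comp (algebraMap R ℝ : R →+* ℝ).toAddMonoidHom

omit [IsManifold I ∞ M] in
theorem chainIntegralHom_apply (η : DForm I M 2) (c : Chain I M R 2) :
    chainIntegralHom I R η c = chainIntegral I η c := rfl

omit [IsManifold I ∞ M] in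
theorem chainIntegral_single (η : DForm I M 2) (σ : SmoothSimplex I M 2) (a : R) :
    chainIntegral I η (Finsupp.single σ a) = algebraMap R ℝ a * simplexIntegral I η σ := by
  simp [chainIntegral]

theorem chainIntegral_add_form {η₁ η₂ : DForm I M 2} (h₁ : IsSmoothForm I η₁)
    (h₂ : IsSmoothForm I η₂) (c : Chain I M R 2) :
    chainIntegral I (η₁ + η₂) c = chainIntegral I η₁ c + chainIntegral I η₂ c := by
  unfold chainIntegral
  simp_rw [simplexIntegral_add I h₁ h₂, mul_add]
  exact Finsupp.sum_add

omit [IsManifold I ∞ M] in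
theorem chainIntegral_smul_form (r : ℝ) (η : DForm I M 2) (c : Chain I M R 2) :
    chainIntegral I (r • η) c = r * chainIntegral I η c := by
  unfold chainIntegral
  simp_rw [simplexIntegral_smul, Finsupp.mul_sum]
  refine Finsupp.sum_congr fun σ _ => by ring

omit [IsManifold I ∞ M] in
theorem chainIntegral_pushforward {f : C^∞⟮I, M; I', M'⟯} (η : DForm I' M' 2)
    (c : Chain I M R 2) :
    chainIntegral I' η (pushforward I I' f c) = chainIntegral I (pullback I I' f η) c := by
  unfold chainIntegral pushforward
  rw [Finsupp.sum_mapDomain_index (by simp) (by intros; rw [map_add, add_mul])]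
  simp_rw [simplexIntegral_map]

/-- The boundary operator as an additive map. -/
def boundaryHom (R : Type*) [CommRing R] (k : ℕ) : Chain I M R (k + 1) →+ Chain I M R k :=
  Finsupp.liftAddHom fun σ => ∑ i : Fin (k + 2), (Finsupp.singleAddHom (σ.face I i)).comp
    (AddMonoidHom.mulLeft ((-1) ^ (i : ℕ)))

omit [IsManifold I ∞ M] [Algebra R ℝ] in
theorem boundaryHom_apply {k : ℕ} (c : Chain I M R (k + 1)) :
    boundaryHom I R k c = boundary I c := by
  refine Finsupp.sum_congr fun σ _ => ?_
  rw [AddMonoidHom.finsetSum_apply]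
  rfl

/-- By linearity in the chain this reduces to Stokes' theorem on one 3-simplex. It makes areas of
closed forms depend only on homology classes. -/
theorem chainIntegral_boundary {η : DForm I M 2} (hη : IsSmoothForm I η)
    (hclosed : ∀ x, extD I η x = 0) (b : Chain I M R 3) :
    chainIntegral I η (boundary I b) = 0 := by
  rw [← boundaryHom_apply, ← chainIntegralHom_apply]
  induction b using Finsupp.induction_linear with
  | zero => simp
  | add f g hf hg => rw [map_add, map_add, hf, hg, add_zero]
  | single σ a =>
    rw [boundaryHom_apply]
    unfold boundary
    rw [Finsupp.sum_single_index (by simp), map_sum]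
    simp_rw [chainIntegralHom_apply, chainIntegral_single]
    have h := congrArg (fun x => algebraMap R ℝ a * x) (sum_simplexIntegral_face I hη hclosed σ)
    simp only [Finset.mul_sum, mul_zero] at h
    rw [← h]
    refine Finset.sum_congr rfl fun i _ => ?_
    simp only [map_mul, map_pow, map_neg, map_one]
    ring

omit [IsManifold I ∞ M] in
theorem SmoothSimplex.face_map {k : ℕ} (f : C^∞⟮I, M; I', M'⟯) (σ : SmoothSimplex I M (k + 1))
    (i : Fin (k + 2)) : (σ.map I I' f).face I' i = (σ.face I i).map I I' f := by
  refine Subtype.ext (funext fun t => ?_)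
  simp only [SmoothSimplex.face, SmoothSimplex.map]
  split_ifs <;> rfl

omit [IsManifold I ∞ M] [Algebra R ℝ] in
-- Taking faces commutes with composition by `f`. This turns the fundamental cycles of the
-- components into cycles in `Q` and in `CP1`.
theorem boundary_pushforward {k : ℕ} (f : C^∞⟮I, M; I', M'⟯) (c : Chain I M R (k + 1)) :
    boundary I' (pushforward I I' f c) = pushforward I I' f (boundary I c) := by
  have hp : ∀ {j : ℕ} (c : Chain I M R j), pushforward I I' f c =
      Finsupp.mapDomain.addMonoidHom (SmoothSimplex.map I I' f) c := fun _ => rfl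
  simp_rw [hp, ← boundaryHom_apply]
  induction c using Finsupp.induction_linear with
  | zero => simp
  | add c d hc hd => simp only [map_add, hc, hd]
  | single σ a =>
    simp only [boundaryHom_apply, Finsupp.mapDomain.addMonoidHom_apply, Finsupp.mapDomain_single]
    unfold boundary
    rw [Finsupp.sum_single_index (by simp), Finsupp.sum_single_index (by simp),
      Finsupp.mapDomain_finsetSum]
    simp_rw [Finsupp.mapDomain_single, SmoothSimplex.face_map]

/-- The rational chain given by an integral chain. -/
def rationalChain {k : ℕ} : Chain I M ℤ k →+ Chain I M ℚ k :=
  Finsupp.mapRange.addMonoidHom (Int.castAddHom ℚ)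

omit [IsManifold I ∞ M] in
theorem boundary_rationalChain {k : ℕ} (c : Chain I M ℤ (k + 1)) :
    boundary I (rationalChain I c) = rationalChain I (boundary I c) := by
  simp_rw [← boundaryHom_apply]
  induction c using Finsupp.induction_linear with
  | zero => simp
  | add c d hc hd => simp only [map_add, hc, hd]
  | single σ a =>
    simp only [boundaryHom_apply]
    have h : ∀ {j : ℕ} (τ : SmoothSimplex I M j) (a : ℤ), rationalChain I (Finsupp.single τ a) =
        Finsupp.single τ (a : ℚ) := fun τ a => by simp [rationalChain]
    rw [h]
    unfold boundary
    rw [Finsupp.sum_single_index (by simp), Finsupp.sum_single_index (by simp), map_sum]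
    simp_rw [h]
    push_cast
    rfl

omit [IsManifold I ∞ M] in
theorem chainIntegral_rationalChain (η : DForm I M 2) (c : Chain I M ℤ 2) :
    chainIntegral I η (rationalChain I c) = chainIntegral I η c := by
  simp_rw [← chainIntegralHom_apply]
  induction c using Finsupp.induction_linear with
  | zero => simp
  | add c d hc hd => simp only [map_add, hc, hd]
  | single σ a =>
    simp only [chainIntegralHom_apply, rationalChain, Finsupp.mapRange.addMonoidHom_apply,
      Finsupp.mapRange_single, chainIntegral_single]
    simp

omit [IsManifold I ∞ M] in
theorem boundary_smul_rat {k : ℕ} (q : ℚ) (c : Chain I M ℚ (k + 1)) :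
    boundary I (q • c) = q • boundary I c := by
  simp_rw [← boundaryHom_apply]
  exact map_rat_smul (boundaryHom I ℚ k) q c

omit [IsManifold I ∞ M] in
theorem chainIntegral_smul_rat (η : DForm I M 2) (q : ℚ) (c : Chain I M ℚ 2) :
    chainIntegral I η (q • c) = q * chainIntegral I η c := by
  simp_rw [← chainIntegralHom_apply]
  rw [map_rat_smul (chainIntegralHom I ℚ η) q c, Rat.smul_def]

end Linear

end Chains

/-! ## Riemann surfaces as real surfaces -/

section RealComplex

variable {C C' : Type*} [TopologicalSpace C] [ChartedSpace ℂ C] [TopologicalSpace C']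
  [ChartedSpace ℂ C']

theorem mdifferentiableAt_real_of_complex {f : C → C'} {x : C}
    (h : MDifferentiableAt 𝓘(ℂ) 𝓘(ℂ) f x) : MDifferentiableAt 𝓘(ℝ, ℂ) 𝓘(ℝ, ℂ) f x := by
  rw [mdifferentiableAt_iff] at h ⊢
  exact ⟨h.1, h.2.restrictScalars ℝ⟩

/-- The real derivative of a map between Riemann surfaces, in the charts at the two points. -/
def realDeriv (f : C → C') (x : C) : ℂ →L[ℝ] ℂ := mfderiv 𝓘(ℝ, ℂ) 𝓘(ℝ, ℂ) f x

theorem realDeriv_eq {f : C → C'} {x : C} (h : MDifferentiableAt 𝓘(ℝ, ℂ) 𝓘(ℝ, ℂ) f x) :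
    realDeriv f x = fderiv ℝ (writtenInExtChartAt 𝓘(ℂ) 𝓘(ℂ) x f) (extChartAt 𝓘(ℂ) x x) := by
  have h1 : realDeriv f x = fderivWithin ℝ (writtenInExtChartAt 𝓘(ℂ) 𝓘(ℂ) x f) (range 𝓘(ℝ, ℂ))
    (extChartAt 𝓘(ℂ) x x) := if_pos h
  rwa [ModelWithCorners.range_eq_univ, fderivWithin_univ] at h1

theorem realDeriv_I_smul {f : C → C'} {x : C} (h : MDifferentiableAt 𝓘(ℂ) 𝓘(ℂ) f x) (v : ℂ) :
    realDeriv f x (Complex.I * v) = Complex.I * realDeriv f x v := by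
  have hd : DifferentiableAt ℂ (writtenInExtChartAt 𝓘(ℂ) 𝓘(ℂ) x f) (extChartAt 𝓘(ℂ) x x) := by
    have := (mdifferentiableAt_iff f x).1 h
    simpa [differentiableWithinAt_univ] using this.2
  rw [realDeriv_eq (mdifferentiableAt_real_of_complex h), hd.fderiv_restrictScalars ℝ]
  exact ContinuousLinearMap.map_smul _ Complex.I v

/-- In charts this is the Cauchy–Riemann criterion; complex linearity of the real derivative need
only be tested on the vector 1. -/
theorem mdifferentiableAt_complex_of_real {f : C → C'} {x : C}
    (h : MDifferentiableAt 𝓘(ℝ, ℂ) 𝓘(ℝ, ℂ) f x)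
    (hJ : ∀ v : ℂ, realDeriv f x (Complex.I * v) = Complex.I * realDeriv f x v) :
    MDifferentiableAt 𝓘(ℂ) 𝓘(ℂ) f x := by
  have h0 := (mdifferentiableAt_iff f x).1 h
  rw [mdifferentiableAt_iff]
  refine ⟨h0.1, ?_⟩
  have hd : DifferentiableAt ℝ (writtenInExtChartAt 𝓘(ℂ) 𝓘(ℂ) x f) (extChartAt 𝓘(ℂ) x x) := by
    have h1 := h0.2
    rw [ModelWithCorners.range_eq_univ, differentiableWithinAt_univ] at h1
    exact h1
  rw [ModelWithCorners.range_eq_univ, differentiableWithinAt_univ,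
    differentiableAt_complex_iff_differentiableAt_real]
  refine ⟨hd, ?_⟩
  rw [← realDeriv_eq h]
  simpa using hJ 1

variable (C) in
theorem isManifold_real_of_complex [IsManifold 𝓘(ℂ) ∞ C] : IsManifold 𝓘(ℝ, ℂ) ∞ C := by
  refine isManifold_of_contDiffOn 𝓘(ℝ, ℂ) ∞ C fun e e' he he' => ?_
  have h := (contDiffGroupoid ∞ 𝓘(ℂ)).compatible he he'
  rw [contDiffGroupoid, mem_groupoid_of_pregroupoid] at h
  have h1 : ContDiffOn ℂ ∞ (𝓘(ℂ) ∘ (e.symm ≫ₕ e') ∘ 𝓘(ℂ).symm)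
    (𝓘(ℂ).symm ⁻¹' (e.symm ≫ₕ e').source ∩ range 𝓘(ℂ)) := h.1
  exact h1.restrict_scalars ℝ

/-- The derivative of the inverse of a chart. -/
def chartSymmDeriv (x₀ : C) (z : ℂ) : ℂ →L[ℝ] ℂ := realDeriv (chartAt ℂ x₀).symm z

/-- A tangent vector at a point is expressed in the preferred chart there, which may differ from the
chart at `x₀`. The factor `chartSymmDeriv` records this change of chart. -/
theorem chartForm_apply (η : DForm 𝓘(ℝ, ℂ) C 2) (x₀ : C) (z v w : ℂ) :
    chartForm 𝓘(ℝ, ℂ) η x₀ z ![v, w] =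
      η ((chartAt ℂ x₀).symm z) ![chartSymmDeriv x₀ z v, chartSymmDeriv x₀ z w] := by
  unfold chartForm
  rw [ModelWithCorners.range_eq_univ, mfderivWithin_univ]
  refine congrArg (η ((chartAt ℂ x₀).symm z)) (funext fun j => ?_)
  fin_cases j <;> rfl

theorem chartSymmDeriv_I [IsManifold 𝓘(ℂ) ∞ C] (x₀ : C) {z : ℂ}
    (hz : z ∈ (chartAt ℂ x₀).target) :
    chartSymmDeriv x₀ z Complex.I = Complex.I * chartSymmDeriv x₀ z 1 := by
  have h := mdifferentiableAt_atlas_symm (I := 𝓘(ℂ)) (ChartedSpace.chart_mem_atlas (H := ℂ) x₀) hz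
  have h2 := realDeriv_I_smul h 1
  rwa [mul_one] at h2

theorem chartSymmDeriv_ne_zero [IsManifold 𝓘(ℂ) ∞ C] (x₀ : C) {z : ℂ}
    (hz : z ∈ (chartAt ℂ x₀).target) {v : ℂ} (hv : v ≠ 0) : chartSymmDeriv x₀ z v ≠ 0 := by
  have := isManifold_real_of_complex C
  have h := isInvertible_mfderivWithin_extChartAt_symm (I := 𝓘(ℝ, ℂ)) (x := x₀) (y := z)
    (by simpa using hz)
  rw [ModelWithCorners.range_eq_univ, mfderivWithin_univ] at h
  obtain ⟨L, hL⟩ := h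
  have h1 : ∀ w : ℂ, chartSymmDeriv x₀ z w = L w := fun w =>
    (congrArg (fun L : ℂ →L[ℝ] ℂ => L w) hL).symm
  rw [h1]
  exact fun h0 => hv ((map_eq_zero_iff L L.injective).1 h0)

end RealComplex

/-! ### Operations on smooth forms and partitions of unity -/

section SmoothForms

variable {E H : Type*} [NormedAddCommGroup E] [NormedSpace ℝ E] [TopologicalSpace H]
  {I : ModelWithCorners ℝ E H} {M : Type*} [TopologicalSpace M] [ChartedSpace H M]

theorem isSmoothForm_add {k : ℕ} {η₁ η₂ : DForm I M k} (h₁ : IsSmoothForm I η₁)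
    (h₂ : IsSmoothForm I η₂) : IsSmoothForm I (η₁ + η₂) := fun x₀ => (h₁ x₀).add (h₂ x₀)

theorem isSmoothForm_zero {k : ℕ} : IsSmoothForm I (0 : DForm I M k) := fun _ =>
  contDiffOn_const (c := (0 : E [⋀^Fin k]→L[ℝ] ℝ))

theorem isSmoothForm_smul {k : ℕ} [IsManifold I ∞ M] {η : DForm I M k} {f : M → ℝ}
    (hf : ContMDiff I 𝓘(ℝ) ∞ f) (h : IsSmoothForm I η) :
    IsSmoothForm I (fun x => f x • η x) := by
  intro x₀
  have h1 : ContDiffOn ℝ ∞ (fun y => f ((extChartAt I x₀).symm y)) (extChartAt I x₀).target := by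
    rw [← contMDiffOn_iff_contDiffOn]
    exact hf.comp_contMDiffOn (contMDiffOn_extChartAt_symm x₀)
  exact h1.smul (h x₀)

theorem closure_support_smul_subset {k : ℕ} (f : M → ℝ) (η : DForm I M k) :
    closure {x | f x • η x ≠ 0} ⊆ tsupport f := by
  refine closure_mono fun x hx h0 => ?_
  rw [mem_ofPred_eq, h0, zero_smul] at hx
  exact hx rfl

theorem isSmoothForm_const_smul {k : ℕ} {η : DForm I M k} (r : ℝ) (h : IsSmoothForm I η) :
    IsSmoothForm I (r • η) := fun x₀ => (h x₀).const_smul r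

theorem isSmoothForm_sum {k : ℕ} {ι : Type*} (s : Finset ι) {η : ι → DForm I M k}
    (h : ∀ i ∈ s, IsSmoothForm I (η i)) : IsSmoothForm I (∑ i ∈ s, η i) := by
  classical
  induction s using Finset.induction_on with
  | empty => simpa using isSmoothForm_zero
  | insert a s ha ih =>
    rw [Finset.sum_insert ha]
    exact isSmoothForm_add (h a (by simp)) (ih fun i hi => h i (by simp [hi]))

theorem chainIntegral_sum_form [IsManifold I ∞ M] {R : Type*} [CommRing R] [Algebra R ℝ]
    {ι : Type*} (s : Finset ι) {η : ι → DForm I M 2} (h : ∀ i ∈ s, IsSmoothForm I (η i))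
    (c : Chain I M R 2) :
    chainIntegral I (∑ i ∈ s, η i) c = ∑ i ∈ s, chainIntegral I (η i) c := by
  classical
  induction s using Finset.induction_on with
  | empty => simpa using chainIntegral_smul_form I 0 (0 : DForm I M 2) c
  | insert a s ha ih =>
    rw [Finset.sum_insert ha, Finset.sum_insert ha, chainIntegral_add_form I (h a (by simp))
      (isSmoothForm_sum s fun i hi => h i (by simp [hi])), ih fun i hi => h i (by simp [hi])]

/-- A finite smooth partition of unity subordinate to the charts of a closed manifold. -/
theorem exists_finite_partition_of_unity [FiniteDimensional ℝ E] (I : ModelWithCorners ℝ E H)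
    (M : Type*) [TopologicalSpace M] [ChartedSpace H M] [IsManifold I ∞ M] [CompactSpace M]
    [T2Space M] : ∃ (s : Finset M) (ρ : M → M → ℝ), (∀ i, ContMDiff I 𝓘(ℝ) ∞ (ρ i)) ∧
      (∀ i x, 0 ≤ ρ i x) ∧ (∀ x, ∑ i ∈ s, ρ i x = 1) ∧
      ∀ i, tsupport (ρ i) ⊆ (chartAt H i).source := by
  obtain ⟨f, hf⟩ := SmoothPartitionOfUnity.exists_isSubordinate I (isClosed_univ (X := M))
    (fun x : M => (chartAt H x).source) (fun x => (chartAt H x).open_source)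
    (fun x _ => mem_iUnion.2 ⟨x, mem_chart_source H x⟩)
  have hfin := f.locallyFinite.finite_nonempty_of_compact
  refine ⟨hfin.toFinset, fun i => f i, fun i => (f i).contMDiff, f.nonneg, fun x => ?_, hf⟩
  rw [← f.sum_eq_one (mem_univ x)]
  symm
  refine finsum_eq_sum_of_support_subset _ fun i hi => ?_
  simp only [Finite.coe_toFinset]
  exact ⟨x, hi⟩

end SmoothForms

/-! ### Alternating 2-forms on the complex line -/

section AreaForms

theorem alternating_eq_smul_areaForm (θ : ℂ [⋀^Fin 2]→L[ℝ] ℝ) :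
    θ = θ ![1, Complex.I] • (CP1.areaForm : ℂ [⋀^Fin 2]→L[ℝ] ℝ) := by
  have hadd0 : ∀ a b c : ℂ, θ ![a + b, c] = θ ![a, c] + θ ![b, c] := fun a b c => by
    have h := θ.toAlternatingMap.map_update_add ![a, c] 0 a b
    have hu : ∀ d, Function.update ![a, c] 0 d = ![d, c] := fun d => by
      funext j; fin_cases j <;> rfl
    rw [hu, hu, hu] at h
    exact h
  have hadd1 : ∀ a b c : ℂ, θ ![c, a + b] = θ ![c, a] + θ ![c, b] := fun a b c => by
    have h := θ.toAlternatingMap.map_update_add ![c, a] 1 a b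
    have hu : ∀ d, Function.update ![c, a] 1 d = ![c, d] := fun d => by
      funext j; fin_cases j <;> rfl
    rw [hu, hu, hu] at h
    exact h
  have hsmul0 : ∀ (r : ℝ) (a c : ℂ), θ ![r • a, c] = r * θ ![a, c] := fun r a c => by
    have h := θ.toAlternatingMap.map_update_smul ![a, c] 0 r a
    have hu : ∀ d, Function.update ![a, c] 0 d = ![d, c] := fun d => by
      funext j; fin_cases j <;> rfl
    rw [hu, hu] at h
    exact h
  have hsmul1 : ∀ (r : ℝ) (a c : ℂ), θ ![c, r • a] = r * θ ![c, a] := fun r a c => by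
    have h := θ.toAlternatingMap.map_update_smul ![c, a] 1 r a
    have hu : ∀ d, Function.update ![c, a] 1 d = ![c, d] := fun d => by
      funext j; fin_cases j <;> rfl
    rw [hu, hu] at h
    exact h
  have hself : ∀ a : ℂ, θ ![a, a] = 0 := fun a =>
    θ.map_eq_zero_of_eq _ (i := 0) (j := 1) rfl (by simp)
  have hswap : θ ![Complex.I, 1] = - θ ![1, Complex.I] := by
    have := hself (Complex.I + 1)
    rw [hadd0, hadd1, hadd1, hself, hself] at this
    linarith
  have hdec : ∀ a : ℂ, a = a.re • (1 : ℂ) + a.im • Complex.I := fun a => by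
    simp [Complex.re_add_im]
  ext v
  have hv : v = ![v 0, v 1] := by funext j; fin_cases j <;> rfl
  change θ v = θ ![1, Complex.I] * ((v 0).re * (v 1).im - (v 0).im * (v 1).re)
  rw [hv]
  simp only [Matrix.cons_val_zero, Matrix.cons_val_one]
  conv_lhs => rw [hdec (v 0), hdec (v 1)]
  rw [hadd0, hadd1, hadd1, hsmul0, hsmul0, hsmul0, hsmul0, hsmul1, hsmul1, hsmul1, hsmul1, hself,
    hself, hswap]
  ring

theorem areaForm_self_I_mul (u : ℂ) : CP1.areaForm ![u, Complex.I * u] = ‖u‖ ^ 2 := by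
  change u.re * (Complex.I * u).im - u.im * (Complex.I * u).re = ‖u‖ ^ 2
  rw [← Complex.normSq_eq_norm_sq, Complex.normSq_apply]
  simp

/-- Every alternating 2-form on ℂ is a multiple of the area form, and multiplication by `u` scales
area by ‖u‖². This factor is the Jacobian of holomorphic changes of coordinates. -/
theorem alternating_self_I_mul (θ : ℂ [⋀^Fin 2]→L[ℝ] ℝ) (u : ℂ) :
    θ ![u, Complex.I * u] = ‖u‖ ^ 2 * θ ![1, Complex.I] := by
  have h : θ ![u, Complex.I * u] = θ ![1, Complex.I] * CP1.areaForm ![u, Complex.I * u] :=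
    congrArg (fun t : ℂ [⋀^Fin 2]→L[ℝ] ℝ => t ![u, Complex.I * u]) (alternating_eq_smul_areaForm θ)
  rw [h, areaForm_self_I_mul, mul_comm]

theorem alternating_eq_zero {θ : ℂ [⋀^Fin 2]→L[ℝ] ℝ} {u : ℂ} (hu : u ≠ 0)
    (h : θ ![u, Complex.I * u] = 0) : θ = 0 := by
  rw [alternating_self_I_mul] at h
  rw [alternating_eq_smul_areaForm θ,
    (mul_eq_zero.1 h).resolve_left (pow_ne_zero 2 (norm_ne_zero_iff.2 hu)), zero_smul]

end AreaForms

/-! ### Non-negative 2-forms integrated over a fundamental cycle -/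

section Positivity

variable {C : Type*} [TopologicalSpace C] [ChartedSpace ℂ C]

/-- A 2-form on a Riemann surface is non-negative if it is so on complex lines. -/
def IsNonnegForm (η : DForm 𝓘(ℝ, ℂ) C 2) : Prop :=
  ∀ (x : C) (v : TangentSpace 𝓘(ℝ, ℂ) x), 0 ≤ η x ![v, complexJ C x v]

variable [IsManifold 𝓘(ℂ) ∞ C]

theorem chartForm_one_I (η : DForm 𝓘(ℝ, ℂ) C 2) (x₀ : C) {z : ℂ}
    (hz : z ∈ (chartAt ℂ x₀).target) :
    chartForm 𝓘(ℝ, ℂ) η x₀ z ![1, Complex.I] = η ((chartAt ℂ x₀).symm z)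
      ![chartSymmDeriv x₀ z 1, complexJ C _ (chartSymmDeriv x₀ z 1)] := by
  rw [chartForm_apply, chartSymmDeriv_I x₀ hz]
  rfl

theorem chartForm_nonneg {η : DForm 𝓘(ℝ, ℂ) C 2} (hη : IsNonnegForm η) (x₀ : C) {z : ℂ}
    (hz : z ∈ (chartAt ℂ x₀).target) : 0 ≤ chartForm 𝓘(ℝ, ℂ) η x₀ z ![1, Complex.I] := by
  rw [chartForm_one_I η x₀ hz]
  exact hη _ _

variable [CompactSpace C] [T2Space C] {c : Chain 𝓘(ℝ, ℂ) C ℤ 2}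

/-- A fundamental cycle computes surface integrals only for forms supported in a chart, so the form
is cut up by a partition of unity. Each piece has a non-negative density because charts are
holomorphic. -/
theorem chainIntegral_nonneg (hc : IsFundamentalCycle c) {η : DForm 𝓘(ℝ, ℂ) C 2}
    (hs : IsSmoothForm 𝓘(ℝ, ℂ) η) (hη : IsNonnegForm η) :
    0 ≤ chainIntegral 𝓘(ℝ, ℂ) η c := by
  have := isManifold_real_of_complex C
  obtain ⟨s, ρ, hρ, hρ0, hρ1, hρs⟩ := exists_finite_partition_of_unity 𝓘(ℝ, ℂ) C
  have hsum : η = ∑ i ∈ s, fun x => ρ i x • η x := by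
    funext x
    rw [Finset.sum_apply, ← Finset.sum_smul, hρ1, one_smul]
  rw [hsum, chainIntegral_sum_form s fun i _ => isSmoothForm_smul (hρ i) hs]
  refine Finset.sum_nonneg fun i _ => ?_
  rw [hc.integral_eq i _ (isSmoothForm_smul (hρ i) hs)]
  · refine setIntegral_nonneg (chartAt ℂ i).open_target.measurableSet fun z hz => ?_
    exact chartForm_nonneg (fun x v => mul_nonneg (hρ0 i x) (hη x v)) i hz
  · exact (closure_support_smul_subset _ _).trans (hρs i)

omit [IsManifold 𝓘(ℂ) ∞ C] [CompactSpace C] [T2Space C] in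
theorem continuousOn_chartForm_apply {η : DForm 𝓘(ℝ, ℂ) C 2} (hs : IsSmoothForm 𝓘(ℝ, ℂ) η)
    (x₀ : C) : ContinuousOn (fun z => chartForm 𝓘(ℝ, ℂ) η x₀ z ![1, Complex.I])
      (chartAt ℂ x₀).target := by
  have h := (hs x₀).continuousOn
  simp only [extChartAt_target, modelWithCornersSelf_coe_symm, preimage_id_eq, id_eq,
    modelWithCornersSelf_coe, range_id, inter_univ] at h
  exact ((ContinuousAlternatingMap.apply ℝ ℂ ℝ ![1, Complex.I]).continuous).comp_continuousOn h

omit [IsManifold 𝓘(ℂ) ∞ C] [T2Space C] in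
/-- The coordinate integral of a form supported in a chart is over an integrable function. -/
theorem integrableOn_chartForm {η : DForm 𝓘(ℝ, ℂ) C 2} (hs : IsSmoothForm 𝓘(ℝ, ℂ) η) (x₀ : C)
    (hsupp : closure {x | η x ≠ 0} ⊆ (chartAt ℂ x₀).source) :
    IntegrableOn (fun z => chartForm 𝓘(ℝ, ℂ) η x₀ z ![1, Complex.I]) (chartAt ℂ x₀).target := by
  have hK : IsCompact (chartAt ℂ x₀ '' closure {x | η x ≠ 0}) :=
    isClosed_closure.isCompact.image_of_continuousOn ((chartAt ℂ x₀).continuousOn.mono hsupp)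
  have hKt : chartAt ℂ x₀ '' closure {x | η x ≠ 0} ⊆ (chartAt ℂ x₀).target := by
    rintro _ ⟨x, hx, rfl⟩
    exact (chartAt ℂ x₀).map_source (hsupp hx)
  have hcont := continuousOn_chartForm_apply hs x₀
  refine ((hcont.mono hKt).integrableOn_compact hK).of_forall_sdiff_eq_zero
    (chartAt ℂ x₀).open_target.measurableSet fun z hz => ?_
  have h0 : η ((chartAt ℂ x₀).symm z) = 0 := by
    by_contra hne
    exact hz.2 ⟨_, subset_closure hne, (chartAt ℂ x₀).right_inv hz.1⟩
  rw [chartForm_apply, h0]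
  rfl

/-- All pieces of a partition of unity have non-negative integrals, so each integral vanishes. A
continuous non-negative density with vanishing integral is identically zero, and a 2-form on a
complex line is determined by its density. -/
theorem eq_zero_of_chainIntegral_eq_zero (hc : IsFundamentalCycle c) {η : DForm 𝓘(ℝ, ℂ) C 2}
    (hs : IsSmoothForm 𝓘(ℝ, ℂ) η) (hη : IsNonnegForm η)
    (h0 : chainIntegral 𝓘(ℝ, ℂ) η c = 0) (x : C) : η x = 0 := by
  have := isManifold_real_of_complex C
  obtain ⟨s, ρ, hρ, hρ0, hρ1, hρs⟩ := exists_finite_partition_of_unity 𝓘(ℝ, ℂ) C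
  have hsm : ∀ i, IsSmoothForm 𝓘(ℝ, ℂ) fun x => ρ i x • η x := fun i => isSmoothForm_smul (hρ i) hs
  have hnn : ∀ i, IsNonnegForm fun x => ρ i x • η x := fun i x v => mul_nonneg (hρ0 i x) (hη x v)
  have hsupp : ∀ i, closure {x | ρ i x • η x ≠ 0} ⊆ (chartAt ℂ i).source := fun i =>
    (closure_support_smul_subset _ _).trans (hρs i)
  have hsum : η = ∑ i ∈ s, fun x => ρ i x • η x := by
    funext x
    rw [Finset.sum_apply, ← Finset.sum_smul, hρ1, one_smul]
  have hall : ∀ i ∈ s, chainIntegral 𝓘(ℝ, ℂ) (fun x => ρ i x • η x) c = 0 := by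
    rw [← Finset.sum_eq_zero_iff_of_nonneg fun i _ => chainIntegral_nonneg hc (hsm i) (hnn i),
      ← chainIntegral_sum_form s fun i _ => hsm i, ← hsum, h0]
  rw [hsum, Finset.sum_apply]
  have hterm : ∀ i ∈ s, ρ i x • η x = 0 := by
    intro i hi
    by_cases hx : x ∈ (chartAt ℂ i).source
    swap
    · have : ρ i x = 0 := by
        by_contra hne
        exact hx (hρs i (subset_closure hne))
      rw [this, zero_smul]
    -- Integrability is essential: the integral of a non-integrable function is 0 by convention, so
    -- its vanishing alone would say nothing.
    have hint := integrableOn_chartForm (hsm i) i (hsupp i)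
    have h1 := hall i hi
    rw [hc.integral_eq i _ (hsm i) (hsupp i)] at h1
    have hcont : ContinuousOn (fun z => chartForm 𝓘(ℝ, ℂ) (fun x => ρ i x • η x) i z
        ![1, Complex.I]) (chartAt ℂ i).target := continuousOn_chartForm_apply (hsm i) i
    have hz := (chartAt ℂ i).map_source hx
    have h2 := (setIntegral_eq_zero_iff_of_nonneg_ae (ae_restrict_of_forall_mem
      (chartAt ℂ i).open_target.measurableSet fun z hz => chartForm_nonneg (hnn i) i hz) hint).1 h1
    have h3 : EqOn (fun z => chartForm 𝓘(ℝ, ℂ) (fun x => ρ i x • η x) i z ![1, Complex.I])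
        (fun _ => 0) (chartAt ℂ i).target :=
      Measure.eqOn_open_of_ae_eq h2 (chartAt ℂ i).open_target hcont continuousOn_const
    have h4 : chartForm 𝓘(ℝ, ℂ) (fun x => ρ i x • η x) i (chartAt ℂ i x) ![1, Complex.I] = 0 :=
      h3 hz
    rw [chartForm_apply, chartSymmDeriv_I i hz, (chartAt ℂ i).left_inv hx] at h4
    exact alternating_eq_zero (chartSymmDeriv_ne_zero i hz one_ne_zero) h4
  exact Finset.sum_eq_zero hterm

end Positivity

/-! ## The complex projective line as a Riemann surface -/

namespace CP1

theorem affineChart_source : affineChart.source = {p | p ≠ infty} := by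
  ext p
  refine ⟨fun h => ?_, mem_affineChart_source⟩
  have h1 : p ∈ ((OnePoint.isOpenEmbedding_coe (X := ℂ)).toOpenPartialHomeomorph _).target := h
  rw [IsOpenEmbedding.toOpenPartialHomeomorph_target] at h1
  exact OnePoint.ne_infty_iff_exists.2 h1

theorem affineChart_target : affineChart.target = univ := rfl

theorem affineChart_symm (z : ℂ) : affineChart.symm z = coe z := rfl

theorem affineChart_coe (z : ℂ) : affineChart (coe z) = z :=
  affineChart.right_inv (mem_univ z)

theorem inftyChart_apply (p : CP1) : inftyChart p = affineChart (inv p) := rfl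

theorem inftyChart_target : inftyChart.target = univ := by
  simp [inftyChart, affineChart_target]

theorem inftyChart_symm (z : ℂ) : inftyChart.symm z = inv (coe z) := rfl

theorem inv_eq_infty_iff {p : CP1} : inv p = infty ↔ p = coe 0 := by
  constructor
  · intro h
    rw [← inv_inv p, h, inv_infty]
  · rintro rfl
    exact inv_zero

theorem inftyChart_source : inftyChart.source = {p | p ≠ coe 0} := by
  ext p
  have h : p ∈ inftyChart.source ↔ inv p ∈ affineChart.source := by
    simp [inftyChart, invHomeo]
  rw [h, affineChart_source, mem_ofPred_eq, mem_ofPred_eq, ne_eq, inv_eq_infty_iff]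

theorem coe_ne_infty (z : ℂ) : coe z ≠ infty := OnePoint.coe_ne_infty z

theorem affineChart_inv_coe {z : ℂ} (hz : z ≠ 0) : affineChart (inv (coe z)) = z⁻¹ := by
  rw [inv_coe hz, affineChart_coe]

theorem chartAt_infty : chartAt ℂ infty = inftyChart := if_pos rfl

theorem chartAt_of_ne {p : CP1} (hp : p ≠ infty) : chartAt ℂ p = affineChart := if_neg hp

theorem chartAt_coe (z : ℂ) : chartAt ℂ (coe z) = affineChart := chartAt_of_ne (coe_ne_infty z)

theorem mem_atlas_iff {e : OpenPartialHomeomorph CP1 ℂ} :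
    e ∈ atlas ℂ CP1 ↔ e = affineChart ∨ e = inftyChart := Iff.rfl

instance : IsManifold 𝓘(ℂ) ∞ CP1 := by
  refine isManifold_of_contDiffOn 𝓘(ℂ) ∞ CP1 fun e e' he he' => ?_
  have key : ∀ f : ℂ → ℂ, (∀ z ∈ (e.symm ≫ₕ e').source, f z = e' (e.symm z)) →
      ContDiffOn ℂ ∞ f (e.symm ≫ₕ e').source →
      ContDiffOn ℂ ∞ (𝓘(ℂ) ∘ (e.symm ≫ₕ e') ∘ 𝓘(ℂ).symm)
        (𝓘(ℂ).symm ⁻¹' (e.symm ≫ₕ e').source ∩ range 𝓘(ℂ)) := by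
    intro f hf hfc
    simp only [modelWithCornersSelf_coe_symm, modelWithCornersSelf_coe, preimage_id_eq, id_eq,
      range_id, inter_univ, Function.comp_id, Function.id_comp]
    exact hfc.congr fun z hz => (hf z hz).symm
  rcases mem_atlas_iff.1 he with rfl | rfl <;> rcases mem_atlas_iff.1 he' with rfl | rfl
  · exact key id (fun z _ => (affineChart_coe z).symm) contDiffOn_id
  · have hne : ∀ z ∈ (affineChart.symm ≫ₕ inftyChart).source, z ≠ 0 := by
      rintro z hz rfl
      have h1 : coe 0 ∈ inftyChart.source := hz.2
      rw [inftyChart_source] at h1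
      exact h1 rfl
    refine key (fun z => z⁻¹) (fun z hz => (affineChart_inv_coe (hne z hz)).symm) ?_
    exact contDiffOn_inv ℂ |>.mono hne
  · have hne : ∀ z ∈ (inftyChart.symm ≫ₕ affineChart).source, z ≠ 0 := by
      rintro z hz rfl
      have h1 : inv (coe 0) ∈ affineChart.source := hz.2
      rw [affineChart_source] at h1
      exact h1 inv_zero
    refine key (fun z => z⁻¹) (fun z hz => (affineChart_inv_coe (hne z hz)).symm) ?_
    exact contDiffOn_inv ℂ |>.mono hne
  · refine key id (fun z _ => ?_) contDiffOn_id
    rw [inftyChart_apply, inftyChart_symm, inv_inv, affineChart_coe, id]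

instance : IsManifold 𝓘(ℝ, ℂ) ∞ CP1 := isManifold_real_of_complex CP1

end CP1

theorem chartSymmDeriv_eq {C : Type*} [TopologicalSpace C] [ChartedSpace ℂ C]
    [IsManifold 𝓘(ℂ) ∞ C] (x₀ : C) {z : ℂ} (hz : z ∈ (chartAt ℂ x₀).target) :
    chartSymmDeriv x₀ z = fderiv ℝ (fun w => chartAt ℂ ((chartAt ℂ x₀).symm z)
      ((chartAt ℂ x₀).symm w)) z :=
  realDeriv_eq (mdifferentiableAt_real_of_complex
    (mdifferentiableAt_atlas_symm (I := 𝓘(ℂ)) (ChartedSpace.chart_mem_atlas (H := ℂ) x₀) hz))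

namespace CP1

/-- The density of the Fubini–Study form in either of the two charts. -/
def density (z : ℂ) : ℝ := ((1 + ‖z‖ ^ 2) ^ 2)⁻¹

theorem density_pos (z : ℂ) : 0 < density z := by unfold density; positivity

theorem density_inv {z : ℂ} (hz : z ≠ 0) : (‖z‖ ^ 2)⁻¹ ^ 2 * density z⁻¹ = density z := by
  unfold density
  have h : ‖z‖ ≠ 0 := norm_ne_zero_iff.2 hz
  rw [norm_inv]
  field_simp
  ring

theorem contDiff_density : ContDiff ℝ ∞ density := by
  unfold density
  refine ContDiff.inv (((contDiff_const.add (contDiff_norm_sq ℝ)).pow 2)) fun z => ?_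
  positivity

theorem fubiniStudy_apply (p : CP1) (v w : ℂ) :
    fubiniStudy p ![v, w] = density (chartAt ℂ p p) * areaForm ![v, w] := rfl

theorem chartAt_target (p : CP1) : (chartAt ℂ p).target = univ := by
  by_cases hp : p = infty
  · rw [hp, chartAt_infty, inftyChart_target]
  · rw [chartAt_of_ne hp, affineChart_target]

/-- The form is defined in the preferred chart at each point, which is the affine one away from
infinity. In the chart at infinity the transition map 1/z contributes ‖z‖⁻⁴, and `density_inv`
absorbs this factor. -/
theorem chartForm_fubiniStudy (x₀ : CP1) (z : ℂ) :
    chartForm 𝓘(ℝ, ℂ) fubiniStudy x₀ z =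
      density z • (areaForm : ℂ [⋀^Fin 2]→L[ℝ] ℝ) := by
  rw [alternating_eq_smul_areaForm (chartForm 𝓘(ℝ, ℂ) fubiniStudy x₀ z)]
  congr 1
  have hz : z ∈ (chartAt ℂ x₀).target := by rw [chartAt_target]; trivial
  rw [chartForm_apply, chartSymmDeriv_I x₀ hz, fubiniStudy_apply, areaForm_self_I_mul,
    chartSymmDeriv_eq x₀ hz]
  by_cases hx : x₀ = infty
  · subst hx
    rw [chartAt_infty, inftyChart_symm]
    -- The coordinate 0 is the point at infinity, the only one whose preferred chart is the chart at
    -- infinity itself.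
    by_cases h0 : z = 0
    · subst h0
      have h1 : (fun w => chartAt ℂ (inv (coe 0)) (inftyChart.symm w)) = id := by
        funext w
        rw [inv_zero, chartAt_infty, inftyChart_apply, inftyChart_symm, inv_inv, affineChart_coe]
        rfl
      rw [h1, fderiv_id, inv_zero, chartAt_infty, inftyChart_apply, inv_infty, affineChart_coe]
      simp
    · have h1 : chartAt ℂ (inv (coe z)) = affineChart := by rw [inv_coe h0, chartAt_coe]
      have h2 : (fun w => affineChart (inftyChart.symm w)) =ᶠ[𝓝 z] fun w => w⁻¹ := by
        filter_upwards [isOpen_ne.mem_nhds h0] with w hw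
        exact affineChart_inv_coe hw
      rw [h1, affineChart_inv_coe h0, h2.fderiv_eq,
        ((hasDerivAt_inv h0).hasFDerivAt.restrictScalars ℝ).fderiv]
      rw [← density_inv h0]
      simp
      ring
  · rw [chartAt_of_ne hx, affineChart_symm, chartAt_coe, affineChart_coe]
    have h1 : (fun w => affineChart (affineChart.symm w)) = id := by
      funext w
      exact affineChart_coe w
    rw [h1, fderiv_id]
    simp

theorem isSmoothForm_fubiniStudy : IsSmoothForm 𝓘(ℝ, ℂ) fubiniStudy := by
  intro x₀
  refine ContDiff.contDiffOn ?_
  have h : chartForm 𝓘(ℝ, ℂ) fubiniStudy x₀ =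
      fun z => density z • (areaForm : ℂ [⋀^Fin 2]→L[ℝ] ℝ) :=
    funext fun z => chartForm_fubiniStudy x₀ z
  rw [h]
  exact contDiff_density.smul contDiff_const

theorem isNonnegForm_fubiniStudy : IsNonnegForm fubiniStudy := by
  have h : ∀ v : ℂ, 0 ≤ areaForm ![v, Complex.I * v] := fun v => by
    rw [areaForm_self_I_mul]
    positivity
  exact fun p v => mul_nonneg (density_pos _).le (h v)

end CP1

/-- A change of variables formula for injective holomorphic functions. -/
theorem integral_image_holomorphic {h h' : ℂ → ℂ} {s : Set ℂ} (hs : MeasurableSet s)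
    (hd : ∀ z ∈ s, HasDerivAt h (h' z) z) (hinj : InjOn h s) (g : ℂ → ℝ) :
    ∫ w in h '' s, g w = ∫ z in s, ‖h' z‖ ^ 2 * g (h z) := by
  have hd' : ∀ z ∈ s, HasFDerivWithinAt h
      ((ContinuousLinearMap.toSpanSingleton ℂ (h' z)).restrictScalars ℝ) s z :=
    fun z hz => ((hd z hz).hasFDerivAt.restrictScalars ℝ).hasFDerivWithinAt
  rw [integral_image_eq_integral_abs_det_fderiv_smul volume hs hd' hinj]
  refine setIntegral_congr_fun hs fun z _ => ?_
  -- The real determinant of multiplication by a complex number is its algebra norm over ℝ, the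
  -- squared modulus.
  have hdet : ((ContinuousLinearMap.toSpanSingleton ℂ (h' z)).restrictScalars ℝ).det =
      ‖h' z‖ ^ 2 := by
    rw [← Complex.normSq_eq_norm_sq, ← Algebra.norm_complex_apply, Algebra.norm_apply]
    unfold ContinuousLinearMap.det
    congr 1
    ext w
    exact mul_comm _ _
  simp only [hdet, smul_eq_mul, abs_of_nonneg (sq_nonneg ‖h' z‖)]

namespace CP1

theorem integrable_density : Integrable density := by
  have h := integrable_rpow_neg_one_add_norm_sq (E := ℂ) (μ := volume) (r := 4)
    (by rw [Complex.finrank_real_complex]; norm_num)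
  refine h.congr (Filter.Eventually.of_forall fun z => ?_)
  simp only [density]
  rw [show (-4 : ℝ) / 2 = -(2 : ℕ) by norm_num, Real.rpow_neg (by positivity), Real.rpow_natCast]

theorem integral_density : ∫ z, density z = Real.pi := by
  have h := integral_fun_norm_addHaar (volume : Measure ℂ) fun r : ℝ => ((1 + r ^ 2) ^ 2)⁻¹
  rw [Complex.finrank_real_complex] at h
  have h1 : ∫ r in Ioi (0 : ℝ), r ^ (2 - 1) • ((1 + r ^ 2) ^ 2)⁻¹ = 1 / 2 := by
    -- The radial integrand r(1 + r²)⁻² has the primitive -(1/2)(1 + r²)⁻¹. The radial integral 1/2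
    -- is then multiplied by the dimension 2 and the area π of the unit disc.
    have hd : ∀ r ∈ Ioi (0 : ℝ), HasDerivAt (fun r : ℝ => -(1 / 2) * (1 + r ^ 2)⁻¹)
        (r ^ (2 - 1) • ((1 + r ^ 2) ^ 2)⁻¹) r := by
      intro r _
      have hne : (1 + r ^ 2 : ℝ) ≠ 0 := by positivity
      have := ((((hasDerivAt_id' r).fun_pow 2).const_add 1).inv hne).const_mul (-(1 / 2) : ℝ)
      convert! this using 1
      simp
      field_simp
    have ht : Filter.Tendsto (fun r : ℝ => -(1 / 2) * (1 + r ^ 2)⁻¹) Filter.atTop (𝓝 0) := by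
      have h2 : Filter.Tendsto (fun r : ℝ => 1 + r ^ 2) Filter.atTop Filter.atTop :=
        Filter.tendsto_atTop_add_const_left _ _ (Filter.tendsto_pow_atTop two_ne_zero)
      simpa using h2.inv_tendsto_atTop.const_mul (-(1 / 2) : ℝ)
    have hc : ContinuousWithinAt (fun r : ℝ => -(1 / 2) * (1 + r ^ 2)⁻¹) (Ici 0) 0 := by
      refine Continuous.continuousWithinAt ?_
      refine continuous_const.mul (Continuous.inv₀ (by fun_prop) fun r => by positivity)
    have := integral_Ioi_of_hasDerivAt_of_nonneg hc hd (fun r hr => ?_) ht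
    · rw [this]; norm_num
    · have : (0 : ℝ) < r := hr
      positivity
  rw [h1] at h
  have h2 : volume.real (Metric.ball (0 : ℂ) 1) = Real.pi := by
    simp [Measure.real, Complex.volume_ball]
  rw [h2] at h
  refine h.trans ?_
  rw [nsmul_eq_mul, smul_eq_mul]
  push_cast
  ring

/-- A bump function at 0 splits the form into one part supported in the affine chart and one in the
chart at infinity. The substitution z ↦ 1/z moves the second integral to the affine plane, where the
two weights add up to 1. -/
theorem chainIntegral_fubiniStudy {e : Chain 𝓘(ℝ, ℂ) CP1 ℤ 2} (he : IsFundamentalCycle e) :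
    chainIntegral 𝓘(ℝ, ℂ) fubiniStudy e = Real.pi := by
  obtain ⟨χ⟩ : Nonempty (SmoothBumpFunction 𝓘(ℝ, ℂ) (coe 0)) := inferInstance
  have hχ : ContMDiff 𝓘(ℝ, ℂ) 𝓘(ℝ) ∞ χ := χ.contMDiff
  have hχ' : ContMDiff 𝓘(ℝ, ℂ) 𝓘(ℝ) ∞ fun p => 1 - χ p := contMDiff_const.sub hχ
  have hs₁ := isSmoothForm_smul hχ isSmoothForm_fubiniStudy
  have hs₂ := isSmoothForm_smul hχ' isSmoothForm_fubiniStudy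
  have hsum : fubiniStudy = (fun p => χ p • fubiniStudy p) + fun p => (1 - χ p) • fubiniStudy p := by
    funext p
    change fubiniStudy p = χ p • fubiniStudy p + (1 - χ p) • fubiniStudy p
    rw [← add_smul, add_sub_cancel, one_smul]
  have hform : ∀ (f : CP1 → ℝ) (x₀ : CP1) (z : ℂ),
      chartForm 𝓘(ℝ, ℂ) (fun p => f p • fubiniStudy p) x₀ z ![1, Complex.I] =
        f ((chartAt ℂ x₀).symm z) * density z := by
    intro f x₀ z
    have h : chartForm 𝓘(ℝ, ℂ) (fun p => f p • fubiniStudy p) x₀ z =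
        f ((chartAt ℂ x₀).symm z) • chartForm 𝓘(ℝ, ℂ) fubiniStudy x₀ z := rfl
    have h1 : areaForm ![1, Complex.I] = 1 := by simpa using areaForm_self_I_mul 1
    have h2 : chartForm 𝓘(ℝ, ℂ) (fun p => f p • fubiniStudy p) x₀ z ![1, Complex.I] =
        f ((chartAt ℂ x₀).symm z) * (density z * areaForm ![1, Complex.I]) := by
      rw [h, chartForm_fubiniStudy]
      rfl
    rw [h2, h1, mul_one]
  have hd₁ : closure {p | χ p • fubiniStudy p ≠ 0} ⊆ (chartAt ℂ (coe 0)).source :=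
    (closure_support_smul_subset _ _).trans χ.tsupport_subset_chartAt_source
  have hd₂ : closure {p | (1 - χ p) • fubiniStudy p ≠ 0} ⊆ (chartAt ℂ infty).source := by
    refine (closure_support_smul_subset (fun p => 1 - χ p) _).trans fun p hp => ?_
    rw [chartAt_infty, inftyChart_source]
    rintro rfl
    refine (notMem_tsupport_iff_eventuallyEq.2 ?_) hp
    filter_upwards [χ.eventuallyEq_one] with p hp
    simp [hp]
  rw [hsum, chainIntegral_add_form _ hs₁ hs₂, he.integral_eq (coe 0) _ hs₁ hd₁,
    he.integral_eq infty _ hs₂ hd₂]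
  simp only [hform]
  rw [chartAt_target, chartAt_target, chartAt_coe, chartAt_infty]
  simp only [affineChart_symm, inftyChart_symm]
  have hcont : ∀ f : CP1 → ℝ, (∀ p, ‖f p‖ ≤ 1) → Continuous f →
      Integrable fun z => f (coe z) * density z := fun f hf hfc =>
    integrable_density.bdd_mul (hfc.comp continuous_coe).aestronglyMeasurable
      (Filter.Eventually.of_forall fun z => hf _)
  have h0 : ({0}ᶜ : Set ℂ) =ᵐ[volume] univ := by
    rw [Filter.eventuallyEq_univ]
    exact compl_mem_ae_iff.2 (measure_singleton 0)
  have himg : (fun z : ℂ => z⁻¹) '' {0}ᶜ = {0}ᶜ := by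
    ext z
    constructor
    · rintro ⟨w, hw, rfl⟩
      exact inv_ne_zero hw
    · exact fun hz => ⟨z⁻¹, inv_ne_zero hz, _root_.inv_inv z⟩
  have h2 : ∫ z in univ, (1 - χ (inv (coe z))) * density z =
      ∫ z in univ, (1 - χ (coe z)) * density z := by
    rw [← setIntegral_congr_set h0, ← setIntegral_congr_set h0]
    conv_lhs => rw [← himg]
    rw [integral_image_holomorphic (measurableSet_singleton 0).compl
      (fun z hz => hasDerivAt_inv hz) inv_injective.injOn]
    refine setIntegral_congr_fun (measurableSet_singleton 0).compl fun z hz => ?_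
    have hz' : z ≠ 0 := hz
    rw [← inv_coe hz', inv_inv, ← density_inv hz', norm_neg, norm_inv, norm_pow]
    ring
  rw [h2, setIntegral_univ, setIntegral_univ, ← integral_add, ← integral_density]
  · congr 1
    funext z
    ring
  · refine hcont χ (fun p => ?_) χ.continuous
    rw [Real.norm_of_nonneg χ.nonneg]
    exact χ.le_one
  · refine hcont (fun p => 1 - χ p) (fun p => ?_) (continuous_const.sub χ.continuous)
    rw [Real.norm_of_nonneg (sub_nonneg.2 χ.le_one)]
    exact sub_le_self _ χ.nonneg

end CP1

/-- Every form of degree three on a Riemann surface vanishes. -/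
theorem extD_two_form_eq_zero {C : Type*} [TopologicalSpace C] [ChartedSpace ℂ C]
    (η : DForm 𝓘(ℝ, ℂ) C 2) (x : C) : extD 𝓘(ℝ, ℂ) η x = 0 := by
  have h : ∀ θ : ℂ [⋀^Fin 3]→L[ℝ] ℝ, θ = 0 := by
    intro θ
    ext v
    refine θ.toAlternatingMap.map_linearDependent v fun hv => ?_
    have := hv.fintype_card_le_finrank
    rw [Complex.finrank_real_complex] at this
    simp at this
  exact h _

/-! ## Lifting smooth maps through embeddings of codimension zero -/

/-- If `A` is smooth with invertible derivative and `A ∘ g` is smooth, then the continuous map `g`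
is smooth. -/
theorem contDiffOn_of_comp {X Y Z : Type*} [NormedAddCommGroup X] [NormedSpace ℝ X]
    [NormedAddCommGroup Y] [NormedSpace ℝ Y] [CompleteSpace Y] [NormedAddCommGroup Z]
    [NormedSpace ℝ Z] {A : Y → Z} {t : Set Y} (ht : UniqueDiffOn ℝ t) (hA : ContDiffOn ℝ ∞ A t)
    (hinv : ∀ y ∈ t, (fderivWithin ℝ A t y).IsInvertible) {g : X → Y} {s : Set X}
    (hs : UniqueDiffOn ℝ s) (hg : ContinuousOn g s) (hgt : MapsTo g s t)
    (h : ContDiffOn ℝ ∞ (A ∘ g) s) : ContDiffOn ℝ ∞ g s := by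
  have hA1 : DifferentiableOn ℝ A t := hA.differentiableOn (by simp)
  have h1 : DifferentiableOn ℝ (A ∘ g) s := h.differentiableOn (by simp)
  -- Differentiating `A ∘ g` and inverting the derivative of `A` gives a formula for the derivative
  -- of `g`, from continuity of `g` alone.
  have hd : ∀ x ∈ s, HasFDerivWithinAt g
      ((fderivWithin ℝ A t (g x)).inverse ∘L fderivWithin ℝ (A ∘ g) s x) s x := by
    intro x hx
    refine HasFDerivWithinAt.of_comp_of_leftInverse
      ((hg x hx).tendsto_nhdsWithin hgt) (hA1 _ (hgt hx)).hasFDerivWithinAt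
      (h1 x hx).hasFDerivWithinAt Filter.EventuallyEq.rfl ?_ hx
    intro v
    exact congrArg (fun L : Y →L[ℝ] Y => L v) (hinv _ (hgt hx)).inverse_comp_self
  have hfd : ∀ x ∈ s, fderivWithin ℝ g s x =
      (fderivWithin ℝ A t (g x)).inverse ∘L fderivWithin ℝ (A ∘ g) s x :=
    fun x hx => (hd x hx).fderivWithin (hs x hx)
  have hA2 : ContDiffOn ℝ ∞ (fderivWithin ℝ A t) t := hA.fderivWithin ht (by simp)
  have h2 : ContDiffOn ℝ ∞ (fderivWithin ℝ (A ∘ g) s) s := h.fderivWithin hs (by simp)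
  -- Bootstrapping: if `g` is Cⁿ, the formula shows that its derivative is Cⁿ, so `g` is Cⁿ⁺¹.
  refine contDiffOn_infty.2 fun n => ?_
  induction n with
  | zero => exact contDiffOn_zero.2 hg
  | succ n ih =>
    refine contDiffOn_succ_of_fderivWithin (fun x hx => (hd x hx).differentiableWithinAt)
      (fun h => absurd h (WithTop.natCast_ne_top (α := ℕ∞) n)) (ContDiffOn.congr ?_ hfd)
    refine ContDiffOn.clm_comp (fun x hx => ?_) (h2.of_le (by exact_mod_cast le_top))
    exact (hinv _ (hgt hx)).contDiffAt_map_inverse.comp_contDiffWithinAt x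
      (((hA2.of_le (by exact_mod_cast le_top)).comp ih hgt) x hx)

theorem isInvertible_of_bijective {E E' : Type*} [NormedAddCommGroup E] [NormedSpace ℝ E]
    [NormedAddCommGroup E'] [NormedSpace ℝ E'] [CompleteSpace E] [CompleteSpace E']
    {L : E →L[ℝ] E'} (hL : Function.Bijective L) : L.IsInvertible :=
  ⟨ContinuousLinearEquiv.ofBijective L (LinearMap.ker_eq_bot.2 hL.1)
    (LinearMap.range_eq_top.2 hL.2), ContinuousLinearMap.ext fun _ => rfl⟩

section Lift

variable {E H : Type*} [NormedAddCommGroup E] [NormedSpace ℝ E] [TopologicalSpace H]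
  {I : ModelWithCorners ℝ E H} {P : Type*} [TopologicalSpace P] [ChartedSpace H P]
  {E' H' : Type*} [NormedAddCommGroup E'] [NormedSpace ℝ E'] [TopologicalSpace H']
  {I' : ModelWithCorners ℝ E' H'} {W : Type*} [TopologicalSpace W] [ChartedSpace H' W]
  [IsManifold I ∞ P] [IsManifold I' ∞ W]

variable [CompleteSpace E] [CompleteSpace E'] {X M : Type*} [NormedAddCommGroup X] [NormedSpace ℝ X]
  [TopologicalSpace M] [ChartedSpace X M] [IsManifold 𝓘(ℝ, X) ∞ M]

/-- In charts this is `contDiffOn_of_comp`. Only derivatives within the chart targets enter, so the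
map `g` may touch the boundary of `P`, where the usual inverse function theorem is not available. -/
theorem contMDiffOn_of_comp {F : P → W} (hF : ContMDiff I I' ∞ F)
    (hb : ∀ p, Function.Bijective (mfderiv I I' F p)) {g : M → P} {s : Set M} (hs : IsOpen s)
    (hg : ContinuousOn g s) (h : ContMDiffOn 𝓘(ℝ, X) I' ∞ (F ∘ g) s) :
    ContMDiffOn 𝓘(ℝ, X) I ∞ g s := by
  intro x hx
  set y := g x with hy
  set φ := extChartAt I y with hφ
  set ψ := extChartAt I' (F y) with hψ
  set c := extChartAt 𝓘(ℝ, X) x with hc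
  -- The chart target at `y` is cut down by an open set `u` to the part that `F` maps into the chart
  -- domain around `F y`.
  obtain ⟨u, hu, hut⟩ := (continuousOn_iff'.1 (hF.continuous.comp_continuousOn
    (continuousOn_extChartAt_symm (I := I) y))) ψ.source (isOpen_extChartAt_source _)
  set t : Set E := φ.target ∩ u with ht
  have htm : ∀ z ∈ t, z ∈ φ.target ∧ F (φ.symm z) ∈ ψ.source := fun z hz => by
    have : z ∈ u ∩ φ.target := ⟨hz.2, hz.1⟩
    rw [← hut] at this
    exact ⟨hz.1, this.1⟩
  have htu : UniqueDiffOn ℝ t := (uniqueDiffOn_extChartAt_target y).inter hu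
  have hsymm : ContMDiffOn 𝓘(ℝ, E) I ∞ φ.symm φ.target := contMDiffOn_extChartAt_symm y
  have hG : ContMDiffOn 𝓘(ℝ, E) I' ∞ (F ∘ φ.symm) t :=
    hF.comp_contMDiffOn (hsymm.mono inter_subset_left)
  have hy' : φ.symm (φ y) = y := extChartAt_to_inv y
  have hbase : (F ∘ φ.symm) (φ y) = F y := congrArg F hy'
  have hcoord : coordMap I' (F ∘ φ.symm) (φ y) = ψ ∘ F ∘ φ.symm := by
    unfold coordMap
    rw [hbase]
    rfl
  have hA : ContDiffOn ℝ ∞ (ψ ∘ F ∘ φ.symm) t := by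
    rw [← contMDiffOn_iff_contDiffOn]
    exact (contMDiffOn_extChartAt (x := F y)).comp hG fun z hz => by
      simpa [hψ] using (htm z hz).2
  have hinv : ∀ z ∈ t, (fderivWithin ℝ (ψ ∘ F ∘ φ.symm) t z).IsInvertible := by
    intro z hz
    have hmd : MDifferentiableWithinAt 𝓘(ℝ, E) I' (F ∘ φ.symm) t z :=
      (hG z hz).mdifferentiableWithinAt (by simp)
    have hmem : (F ∘ φ.symm) z ∈ (extChartAt I' ((F ∘ φ.symm) (φ y))).source := by
      rw [hbase]; exact (htm z hz).2
    have h1 := mfderivWithin_coordMap (htu z hz) hmd hmem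
    rw [hcoord] at h1
    rw [h1]
    have hset : t =ᶠ[𝓝 z] range I := by
      have h2 := extChartAt_target_eventuallyEq_range (I := I) (htm z hz).1
      filter_upwards [h2, hu.mem_nhds hz.2] with w hw hwu
      exact (propext (and_iff_left hwu)).trans hw
    have h3 : mfderivWithin 𝓘(ℝ, E) I' (F ∘ φ.symm) t z =
        (mfderiv I I' F (φ.symm z)).comp (mfderivWithin 𝓘(ℝ, E) I φ.symm t z) :=
      mfderiv_comp_mfderivWithin z (hF.mdifferentiableAt (by simp))
        (((hsymm.mono inter_subset_left) z hz).mdifferentiableWithinAt (by simp))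
        (htu z hz).uniqueMDiffWithinAt
    have h4 : mfderivWithin 𝓘(ℝ, E) I φ.symm t z = mfderivWithin 𝓘(ℝ, E) I φ.symm (range I) z :=
      mfderivWithin_congr_set hset
    rw [h3, h4]
    refine (isInvertible_mfderiv_extChartAt ?_).comp ((isInvertible_of_bijective (E := E) (E' := E') (hb _)).comp
      (isInvertible_mfderivWithin_extChartAt_symm (htm z hz).1))
    exact hmem
  set s' : Set X := c.target ∩ c.symm ⁻¹' (s ∩ g ⁻¹' (φ.source ∩ F ⁻¹' ψ.source)) with hs'
  have hopen : IsOpen (s ∩ g ⁻¹' (φ.source ∩ F ⁻¹' ψ.source)) :=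
    hg.isOpen_inter_preimage hs ((isOpen_extChartAt_source _).inter
      ((isOpen_extChartAt_source _).preimage hF.continuous))
  have hs'o : IsOpen s' := (continuousOn_extChartAt_symm x).isOpen_inter_preimage
    (isOpen_extChartAt_target x) hopen
  have hcs : ContMDiffOn 𝓘(ℝ, X) 𝓘(ℝ, X) ∞ c.symm c.target := contMDiffOn_extChartAt_symm x
  have hxs : c x ∈ s' := by
    refine ⟨mem_extChartAt_target x, ?_⟩
    rw [mem_preimage, extChartAt_to_inv x]
    exact ⟨hx, mem_extChartAt_source y, mem_extChartAt_source (F y)⟩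
  have hgs : ContDiffOn ℝ ∞ (φ ∘ g ∘ c.symm) s' := by
    refine contDiffOn_of_comp htu hA hinv hs'o.uniqueDiffOn ?_ ?_ ?_
    · refine (continuousOn_extChartAt y).comp (hg.comp ((continuousOn_extChartAt_symm x).mono
        inter_subset_left) fun z hz => hz.2.1) fun z hz => hz.2.2.1
    · intro z hz
      refine ⟨φ.map_source hz.2.2.1, ?_⟩
      have : φ (g (c.symm z)) ∈ (F ∘ φ.symm) ⁻¹' ψ.source ∩ φ.target := by
        refine ⟨?_, φ.map_source hz.2.2.1⟩
        change F (φ.symm (φ (g (c.symm z)))) ∈ ψ.source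
        rw [φ.left_inv hz.2.2.1]
        exact hz.2.2.2
      rw [hut] at this
      exact this.1
    · have h1 : ContDiffOn ℝ ∞ (ψ ∘ (F ∘ g) ∘ c.symm) s' := by
        rw [← contMDiffOn_iff_contDiffOn]
        refine (contMDiffOn_extChartAt (x := F y)).comp (h.comp (hcs.mono inter_subset_left)
          fun z hz => hz.2.1) fun z hz => ?_
        simpa [hψ] using hz.2.2.2
      refine h1.congr fun z hz => ?_
      change ψ (F (φ.symm (φ (g (c.symm z))))) = ψ (F (g (c.symm z)))
      rw [φ.left_inv hz.2.2.1]
  refine ContMDiffAt.contMDiffWithinAt ?_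
  rw [contMDiffAt_iff]
  refine ⟨hg.continuousAt (hs.mem_nhds hx), ?_⟩
  exact ((hgs (c x) hxs).contDiffAt (hs'o.mem_nhds hxs)).contDiffWithinAt

end Lift

/-! ## Invariance of domain for embeddings that respect the boundary -/

section Interior

variable {E H : Type*} [NormedAddCommGroup E] [NormedSpace ℝ E] [TopologicalSpace H]
  (I : ModelWithCorners ℝ E H) {M : Type*} [TopologicalSpace M] [ChartedSpace H M]
  [IsManifold I ∞ M]

/-- A small coordinate ball serves as `T`. The range of the model is convex, so the ball meets its
interior in a convex, hence connected set, which is dense in the ball's part of the range. -/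
theorem exists_isOpen_isPreconnected_inter_interior (x : M) {s : Set M} (hs : s ∈ 𝓝 x) :
    ∃ T ⊆ s, IsOpen T ∧ x ∈ T ∧ IsPreconnected (T ∩ I.interior M) ∧
      T ⊆ closure (T ∩ I.interior M) := by
  set φ := extChartAt I x with hφ
  have h1 : φ.target ∩ φ.symm ⁻¹' s ∈ 𝓝[range I] φ x :=
    Filter.inter_mem (extChartAt_target_mem_nhdsWithin x)
      (mem_nhdsWithin_of_mem_nhds (extChartAt_preimage_mem_nhds hs))
  obtain ⟨r, hr, hrs⟩ := Metric.mem_nhdsWithin_iff.1 h1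
  set b := Metric.ball (φ x) r with hb
  have hT : ∀ y ∈ φ.source, φ y ∈ b → y ∈ s := fun y hy hyb => by
    have h2 : y ∈ φ.source := hy
    have := (hrs ⟨hyb, extChartAt_target_subset_range x (φ.map_source hy)⟩).2
    rwa [mem_preimage, φ.left_inv hy] at this
  have himg : (φ.source ∩ φ ⁻¹' b) ∩ I.interior M = φ.symm '' (b ∩ interior (range I)) := by
    have key : ∀ y ∈ φ.source, (y ∈ I.interior M ↔ φ y ∈ interior (range I)) := by
      intro y hy
      rw [hφ, extChartAt_source] at hy
      refine (I.isInteriorPoint_iff_of_mem_atlas (n := ∞) (by simp) (chart_mem_atlas H x) hy).trans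
        ⟨fun h => interior_mono (extChartAt_target_subset_range x) h,
          (chartAt H x).mem_interior_extend_target ?_⟩
      exact (chartAt H x).map_source hy
    ext y
    constructor
    · rintro ⟨⟨hy, hyb⟩, hyi⟩
      exact ⟨φ y, ⟨hyb, (key y hy).1 hyi⟩, φ.left_inv hy⟩
    · rintro ⟨z, ⟨hzb, hzi⟩, rfl⟩
      have hz : z ∈ φ.target := (hrs ⟨hzb, interior_subset hzi⟩).1
      have hsrc := φ.map_target hz
      refine ⟨⟨hsrc, ?_⟩, (key _ hsrc).2 ?_⟩
      · rwa [mem_preimage, φ.right_inv hz]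
      · rwa [φ.right_inv hz]
  have hsub : b ∩ interior (range I) ⊆ φ.target := fun z hz =>
    (hrs ⟨hz.1, interior_subset hz.2⟩).1
  refine ⟨φ.source ∩ φ ⁻¹' b, fun y hy => hT y hy.1 hy.2,
    isOpen_extChartAt_preimage' x Metric.isOpen_ball,
    ⟨mem_extChartAt_source x, Metric.mem_ball_self hr⟩, ?_, ?_⟩
  · rw [himg]
    exact ((convex_ball _ _).inter I.convex_range.interior).isPreconnected.image _
      ((continuousOn_extChartAt_symm x).mono hsub)
  · rw [himg]
    intro y hy
    have hyr : φ y ∈ range I := extChartAt_target_subset_range x (φ.map_source hy.1)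
    have hcl : range I ⊆ closure (interior (range I)) := by
      rw [I.convex_range.closure_interior_eq_closure_of_nonempty_interior I.nonempty_interior]
      exact subset_closure
    have h2 : φ y ∈ closure (b ∩ interior (range I)) :=
      Metric.isOpen_ball.inter_closure ⟨hy.2, hcl hyr⟩
    have h3 : ContinuousWithinAt φ.symm (b ∩ interior (range I)) (φ y) :=
      ((continuousOn_extChartAt_symm x) _ (φ.map_source hy.1)).mono hsub
    have h4 := h3.mem_closure_image h2
    rwa [φ.left_inv hy.1] at h4

end Interior

section Domain

variable {E H : Type*} [NormedAddCommGroup E] [NormedSpace ℝ E] [TopologicalSpace H]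
  {I : ModelWithCorners ℝ E H} {P : Type*} [TopologicalSpace P] [ChartedSpace H P]
  {E' H' : Type*} [NormedAddCommGroup E'] [NormedSpace ℝ E'] [TopologicalSpace H']
  {I' : ModelWithCorners ℝ E' H'} {W : Type*} [TopologicalSpace W] [ChartedSpace H' W]
  [CompleteSpace E] [CompleteSpace E']

/-- A surjective derivative sends interior points to interior points, and there the ordinary inverse
function theorem applies in charts. -/
theorem map_nhds_eq_of_isInteriorPoint {F : P → W} (hF : ContMDiff I I' ∞ F) {p : P}
    (hb : Function.Bijective (mfderiv I I' F p)) (hp : I.IsInteriorPoint p) :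
    Filter.map F (𝓝 p) = 𝓝 (F p) := by
  have hmd : MDifferentiableAt I I' F p := hF.mdifferentiableAt (by simp)
  have hFp : I'.IsInteriorPoint (F p) := hmd.isInteriorPoint_of_surjective_mfderiv hb.2 hp
  have hr : range I ∈ 𝓝 (extChartAt I p p) := range_mem_nhds_isInteriorPoint hp
  have hr' : range I' ∈ 𝓝 (extChartAt I' (F p) (F p)) := range_mem_nhds_isInteriorPoint hFp
  have hc : ContDiffAt ℝ ∞ (writtenInExtChartAt I I' p F) (extChartAt I p p) :=
    ((contMDiffAt_iff.1 hF.contMDiffAt).2).contDiffAt hr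
  have hs := hc.hasStrictFDerivAt (by simp)
  have hd : mfderiv I I' F p = fderiv ℝ (writtenInExtChartAt I I' p F) (extChartAt I p p) := by
    rw [hmd.mfderiv, fderivWithin_of_mem_nhds hr]
  obtain ⟨e, he⟩ := isInvertible_of_bijective (E := E) (E' := E') hb
  have hs' : HasStrictFDerivAt (writtenInExtChartAt I I' p F) (e : E →L[ℝ] E')
      (extChartAt I p p) := by
    have h1 : (e : E →L[ℝ] E') = fderiv ℝ (writtenInExtChartAt I I' p F) (extChartAt I p p) :=
      he.trans hd
    rw [h1]
    exact hs
  have hmap := hs'.map_nhds_eq_of_equiv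
  have hval : writtenInExtChartAt I I' p F (extChartAt I p p) = extChartAt I' (F p) (F p) := by
    simp [writtenInExtChartAt]
  have h1 : Filter.map (extChartAt I p).symm (𝓝 (extChartAt I p p)) = 𝓝 p := by
    have := map_extChartAt_symm_nhdsWithin_range (I := I) p
    rwa [nhdsWithin_eq_nhds.2 hr] at this
  have h2 : Filter.map (extChartAt I' (F p)).symm (𝓝 (extChartAt I' (F p) (F p))) = 𝓝 (F p) := by
    have := map_extChartAt_symm_nhdsWithin_range (I := I') (F p)
    rwa [nhdsWithin_eq_nhds.2 hr'] at this
  rw [← h1, ← h2, ← hval, ← hmap, Filter.map_map, Filter.map_map]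
  refine Filter.map_congr ?_
  have hsrc : ∀ᶠ q in 𝓝 p, F q ∈ (extChartAt I' (F p)).source :=
    hF.continuous.continuousAt (extChartAt_source_mem_nhds (F p))
  rw [← h1, Filter.eventually_map] at hsrc
  filter_upwards [hsrc] with z hz
  exact ((extChartAt I' (F p)).left_inv hz).symm

/-- At a boundary point a connectedness argument is used. Let `K` be a compact neighbourhood of `p`,
and `T` a neighbourhood of `F p` that avoids the image of the frontier of `K`. The connected
interior part of `T` is covered by the disjoint open sets F(int K ∩ int P) and the complement of
F(K). It meets the first, so it lies in F(K), and then so does `T`, because F(K) is closed. -/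
theorem isOpen_range_of_boundary [IsManifold I ∞ P] [IsManifold I' ∞ W] [LocallyCompactSpace P] [T2Space W] {F : P → W}
    (hF : ContMDiff I I' ∞ F) (hb : ∀ p, Function.Bijective (mfderiv I I' F p))
    (hinj : Function.Injective F) (hbd : F '' I.boundary P = I'.boundary W) :
    IsOpen (range F) := by
  have hint : ∀ p, F p ∈ I'.interior W → p ∈ I.interior P := by
    intro p hp
    rw [← I.compl_boundary]
    intro hpb
    rw [← I'.compl_boundary, ← hbd] at hp
    exact hp ⟨p, hpb, rfl⟩
  have hint' : ∀ p ∈ I.interior P, F p ∈ I'.interior W := by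
    intro p hp
    rw [← I'.compl_boundary, ← hbd]
    rintro ⟨q, hq, hqp⟩
    rw [hinj hqp] at hq
    rw [← I.compl_boundary] at hp
    exact hp hq
  refine isOpen_iff_mem_nhds.2 ?_
  rintro _ ⟨p, rfl⟩
  obtain ⟨K, hK, hKp⟩ := exists_compact_mem_nhds p
  have hFK : IsClosed (F '' K) := (hK.image hF.continuous).isClosed
  have : T2Space P := T2Space.of_injective_continuous hinj hF.continuous
  have hfr : IsClosed (F '' frontier K) :=
    ((hK.of_isClosed_subset isClosed_frontier hK.isClosed.frontier_subset).image
      hF.continuous).isClosed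
  have hpi : p ∈ interior K := mem_interior_iff_mem_nhds.2 hKp
  have hpn : (F '' frontier K)ᶜ ∈ 𝓝 (F p) := by
    refine hfr.isOpen_compl.mem_nhds ?_
    rintro ⟨q, hq, hqp⟩
    rw [hinj hqp] at hq
    exact hq.2 hpi
  obtain ⟨T, hTs, hTo, hpT, hTc, hTcl⟩ := exists_isOpen_isPreconnected_inter_interior I' (F p) hpn
  have hsub : T ∩ I'.interior W ⊆ F '' K := by
    have hcover : T ∩ I'.interior W ⊆ F '' (interior K ∩ I.interior P) ∪ (F '' K)ᶜ := by
      rintro y ⟨hyT, hyi⟩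
      by_cases hy : y ∈ F '' K
      · obtain ⟨q, hq, rfl⟩ := hy
        refine Or.inl ⟨q, ⟨?_, hint q hyi⟩, rfl⟩
        by_contra hqi
        exact hTs hyT ⟨q, ⟨subset_closure hq, hqi⟩, rfl⟩
      · exact Or.inr hy
    have hopen : IsOpen (F '' (interior K ∩ I.interior P)) := by
      refine isOpen_iff_mem_nhds.2 ?_
      rintro _ ⟨q, hq, rfl⟩
      rw [← map_nhds_eq_of_isInteriorPoint hF (hb q) hq.2]
      exact Filter.image_mem_map ((isOpen_interior.inter
        (I.isOpen_interior (n := ∞) (by simp))).mem_nhds hq)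
    -- Interior points of `P` accumulate at `p`, even when `p` lies on the boundary.
    have hne : ((T ∩ I'.interior W) ∩ F '' (interior K ∩ I.interior P)).Nonempty := by
      obtain ⟨S, hS, -, hpS, -, hScl⟩ := exists_isOpen_isPreconnected_inter_interior I p
        (Filter.inter_mem (isOpen_interior.mem_nhds hpi)
          (hF.continuous.continuousAt (hTo.mem_nhds hpT)))
      obtain ⟨q, hqS, hqi⟩ := (closure_nonempty_iff.1 ⟨p, hScl hpS⟩)
      exact ⟨F q, ⟨(hS hqS).2, hint' q hqi⟩, q, ⟨(hS hqS).1, hqi⟩, rfl⟩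
    have hdis : Disjoint (F '' (interior K ∩ I.interior P)) (F '' K)ᶜ :=
      disjoint_compl_right.mono_left
        (image_mono (inter_subset_left.trans interior_subset))
    exact (hTc.subset_left_of_subset_union hopen hFK.isOpen_compl hdis hcover hne).trans
      (image_mono (inter_subset_left.trans interior_subset))
  refine Filter.mem_of_superset (hTo.mem_nhds hpT) ?_
  exact hTcl.trans ((closure_minimal hsub hFK).trans (image_subset_range F K))

end Domain

/-! ## The strong maximum principle in exponential polar coordinates -/

section MaximumPrinciple

theorem isOpen_re_lt (c : ℝ) : IsOpen {w : ℂ | w.re < c} :=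
  isOpen_lt Complex.continuous_re continuous_const

/-- Differentiation of the integral over vertical segments. -/
theorem hasDerivAt_verticalIntegral {K : ℂ → ℝ} {c : ℝ}
    (hK : ContDiffOn ℝ ∞ K {w | w.re < c}) (L : ℝ) {ρ : ℝ} (hρ : ρ < c) :
    HasDerivAt (fun r : ℝ => ∫ t in (0 : ℝ)..L, K (r + t * Complex.I))
      (∫ t in (0 : ℝ)..L, fderiv ℝ K (ρ + t * Complex.I) 1) ρ := by
  have hd : ∀ w : ℂ, w.re < c → DifferentiableAt ℝ K w := fun w hw =>
    (hK.differentiableOn (by simp)).differentiableAt ((isOpen_re_lt c).mem_nhds hw)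
  have hK' : ContinuousOn (fun w => fderiv ℝ K w 1) {w | w.re < c} :=
    (hK.continuousOn_fderiv_of_isOpen (isOpen_re_lt c) (by simp)).clm_apply continuousOn_const
  have hcont : ∀ {G : ℂ → ℝ}, ContinuousOn G {w | w.re < c} → ∀ r : ℝ, r < c →
      Continuous fun t : ℝ => G (r + t * Complex.I) := by
    intro G hG r hr
    refine hG.comp_continuous (by fun_prop) fun t => ?_
    simpa using hr
  obtain ⟨δ, hδ, hδc⟩ : ∃ δ > 0, ρ + δ < c := ⟨(c - ρ) / 2, by linarith, by linarith⟩
  have hcomp : IsCompact ((fun p : ℝ × ℝ => (p.1 : ℂ) + p.2 * Complex.I) ''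
      (Icc (ρ - δ) (ρ + δ) ×ˢ uIcc 0 L)) :=
    (isCompact_Icc.prod isCompact_uIcc).image (by fun_prop)
  obtain ⟨b, hb⟩ := hcomp.exists_bound_of_continuousOn (f := fun w => fderiv ℝ K w 1)
    (hK'.mono (by
      rintro _ ⟨⟨r, t⟩, ⟨hr, -⟩, rfl⟩
      have := hr.2
      simp only [mem_ofPred_eq, Complex.add_re, Complex.ofReal_re, Complex.mul_re, Complex.I_re,
        Complex.I_im, Complex.ofReal_im]
      simp only at this
      linarith))
  refine (intervalIntegral.hasDerivAt_integral_of_dominated_loc_of_deriv_le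
    (F := fun (r t : ℝ) => K (r + t * Complex.I))
    (F' := fun (r t : ℝ) => fderiv ℝ K (r + t * Complex.I) 1) (bound := fun _ => b)
    (Icc_mem_nhds (a := ρ - δ) (b := ρ + δ) (by linarith) (by linarith))
    ?_ ?_ ?_ ?_ intervalIntegrable_const ?_).2
  · filter_upwards [Iio_mem_nhds hρ] with r hr
    exact (hcont hK.continuousOn r hr).aestronglyMeasurable
  · exact (hcont hK.continuousOn ρ hρ).intervalIntegrable _ _
  · exact (hcont hK' ρ hρ).aestronglyMeasurable
  · exact Filter.Eventually.of_forall fun t ht r hr =>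
      hb _ ⟨(r, t), ⟨hr, uIoc_subset_uIcc ht⟩, rfl⟩
  · refine Filter.Eventually.of_forall fun t _ r hr => ?_
    have h1 : HasDerivAt (fun r : ℝ => (r : ℂ) + t * Complex.I) 1 r :=
      (Complex.ofRealCLM.hasDerivAt (x := r)).add_const _
    exact (hd _ (by simpa using hr.2.trans_lt hδc)).hasFDerivAt.comp_hasDerivAt r h1

/-- A convex function on a half-line `(-∞, c)` that is bounded above by its limit at `-∞` is
bounded below by it, too. -/
theorem ge_of_convexOn_Iio {G : ℝ → ℝ} {c L : ℝ} (hG : ConvexOn ℝ (Iio c) G)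
    (hle : ∀ ρ < c, G ρ ≤ L) (hlim : ∀ δ > 0, ∃ ρ₀, ∀ ρ < ρ₀, L - δ ≤ G ρ) {ρ : ℝ} (hρ : ρ < c) :
    L ≤ G ρ := by
  by_contra! hlt
  obtain ⟨ρ₀, hρ₀⟩ := hlim ((L - G ρ) / 2) (by linarith)
  set s := min ρ₀ ρ - 1 with hs
  have hs1 : s < ρ₀ := by have := min_le_left ρ₀ ρ; linarith
  have hs2 : s < ρ := by have := min_le_right ρ₀ ρ; linarith
  have h1 := hρ₀ s hs1
  -- With δ = (L - G ρ)/2, `G` drops by at least δ between `s` and `ρ`. Going left by twice that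
  -- distance, convexity forces G t ≥ G s + 2δ ≥ L + δ, against the upper bound.
  set t := s - 2 * (ρ - s) with ht
  have hts : t < s := by linarith
  have h2 := hG.slope_mono_adjacent (x := t) (y := s) (z := ρ) (by simp; linarith) hρ hts hs2
  rw [div_le_div_iff₀ (by linarith) (by linarith)] at h2
  have h3 := hle t (by linarith)
  nlinarith

/-- The strong maximum principle for functions on a punctured disc that are subharmonic in
exponential polar coordinates and attain the maximum at the centre. -/
theorem eq_of_laplacian_nonneg {h : ℂ → ℝ} {c M : ℝ} (hh : ContDiffOn ℝ ∞ h {w | w.re < c})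
    (hper : ∀ w, h (w + 2 * Real.pi * Complex.I) = h w)
    (hlap : ∀ w : ℂ, w.re < c → 0 ≤ fderiv ℝ (fun y => fderiv ℝ h y 1) w 1 +
      fderiv ℝ (fun y => fderiv ℝ h y Complex.I) w Complex.I)
    (hle : ∀ w : ℂ, w.re < c → h w ≤ M)
    (hlim : ∀ δ > 0, ∃ ρ₀ : ℝ, ∀ w : ℂ, w.re < ρ₀ → M - δ ≤ h w) (w : ℂ) (hw : w.re < c) :
    h w = M := by
  set T : ℝ := 2 * Real.pi with hT
  have hT0 : 0 < T := Real.two_pi_pos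
  have hD : ∀ v : ℂ, ContDiffOn ℝ ∞ (fun y => fderiv ℝ h y v) {w | w.re < c} := fun v =>
    ((hh.fderiv_of_isOpen (isOpen_re_lt c) (m := ∞) (by simp))).clm_apply contDiffOn_const
  have hcont : ∀ {G : ℂ → ℝ}, ContinuousOn G {w | w.re < c} → ∀ r : ℝ, r < c →
      Continuous fun t : ℝ => G (r + t * Complex.I) := by
    intro G hG r hr
    refine hG.comp_continuous (by fun_prop) fun t => ?_
    simpa using hr
  have hDD : ∀ u v : ℂ, ContinuousOn (fun w => fderiv ℝ (fun y => fderiv ℝ h y u) w v)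
      {w | w.re < c} := fun u v =>
    ((hD u).continuousOn_fderiv_of_isOpen (isOpen_re_lt c) (by simp)).clm_apply continuousOn_const
  -- `G r` is 2π times the mean of the function over the circle of radius exp r. It is convex in the
  -- logarithmic radius, bounded above by its limit 2πM at -∞, hence equal to it.
  set G : ℝ → ℝ := fun r => ∫ t in (0 : ℝ)..T, h (r + t * Complex.I) with hG
  have hG1 : ∀ r < c, HasDerivAt G (∫ t in (0 : ℝ)..T, fderiv ℝ h (r + t * Complex.I) 1) r :=
    fun r hr => hasDerivAt_verticalIntegral hh T hr
  have hG2 : ∀ r < c, HasDerivAt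
      (fun r : ℝ => ∫ t in (0 : ℝ)..T, fderiv ℝ h (r + t * Complex.I) 1)
      (∫ t in (0 : ℝ)..T, fderiv ℝ (fun y => fderiv ℝ h y 1) (r + t * Complex.I) 1) r :=
    fun r hr => hasDerivAt_verticalIntegral (hD 1) T hr
  have hperD : ∀ w, fderiv ℝ h (w + T * Complex.I) = fderiv ℝ h w := by
    intro w
    have h1 : (fun y => h (y + T * Complex.I)) = h := by
      funext y
      rw [hT]
      push_cast
      exact hper y
    rw [← fderiv_comp_add_right, h1]
  have hpos : ∀ r < c,
      0 ≤ ∫ t in (0 : ℝ)..T, fderiv ℝ (fun y => fderiv ℝ h y 1) (r + t * Complex.I) 1 := by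
    intro r hr
    -- The second derivative in the angular direction integrates to zero by periodicity, so the
    -- second derivative of `G` is the integral of the whole Laplacian.
    have h1 : ∫ t in (0 : ℝ)..T, fderiv ℝ (fun y => fderiv ℝ h y Complex.I)
        (r + t * Complex.I) Complex.I = 0 := by
      rw [intervalIntegral.integral_eq_sub_of_hasDerivAt
        (f := fun t : ℝ => fderiv ℝ h (r + t * Complex.I) Complex.I)]
      · have := hperD r
        simp [this]
      · intro t _
        have h2 : HasDerivAt (fun t : ℝ => (r : ℂ) + t * Complex.I) Complex.I t := by
          simpa using ((Complex.ofRealCLM.hasDerivAt (x := t)).mul_const Complex.I).const_add (r : ℂ)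
        refine HasFDerivAt.comp_hasDerivAt (l := fun y => fderiv ℝ h y Complex.I) t ?_ h2
        refine (((hD Complex.I).differentiableOn (by simp)).differentiableAt
          ((isOpen_re_lt c).mem_nhds ?_)).hasFDerivAt
        simpa using hr
      · exact (hcont (hDD _ _) r hr).intervalIntegrable _ _
    have h2 := intervalIntegral.integral_nonneg (μ := volume) hT0.le fun t _ =>
      hlap (r + t * Complex.I) (by simpa using hr)
    rwa [intervalIntegral.integral_add ((hcont (hDD _ _) r hr).intervalIntegrable _ _)
      ((hcont (hDD _ _) r hr).intervalIntegrable _ _), h1, add_zero] at h2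
  have hconv : ConvexOn ℝ (Iio c) G := by
    refine convexOn_of_hasDerivWithinAt2_nonneg (convex_Iio c)
      (f' := fun r => ∫ t in (0 : ℝ)..T, fderiv ℝ h (r + t * Complex.I) 1)
      (f'' := fun r => ∫ t in (0 : ℝ)..T, fderiv ℝ (fun y => fderiv ℝ h y 1) (r + t * Complex.I) 1)
      (fun r hr => (hG1 r hr).continuousAt.continuousWithinAt) ?_ ?_ ?_
    · exact fun r hr => (hG1 r (by simpa using hr)).hasDerivWithinAt
    · exact fun r hr => (hG2 r (by simpa using hr)).hasDerivWithinAt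
    · exact fun r hr => hpos r (by simpa using hr)
  have hint : ∀ r < c, IntervalIntegrable (fun t : ℝ => h (r + t * Complex.I)) volume 0 T :=
    fun r hr => (hcont hh.continuousOn r hr).intervalIntegrable _ _
  have hGle : ∀ r < c, G r ≤ T * M := by
    intro r hr
    have := intervalIntegral.integral_mono_on hT0.le (hint r hr) intervalIntegrable_const
      (fun t _ => hle (r + t * Complex.I) (by simpa using hr))
    simpa using this
  have hGlim : ∀ δ > 0, ∃ ρ₀, ∀ ρ < ρ₀, T * M - δ ≤ G ρ := by
    intro δ hδ
    obtain ⟨ρ₀, hρ₀⟩ := hlim (δ / T) (by positivity)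
    refine ⟨min ρ₀ c, fun r hr => ?_⟩
    have := intervalIntegral.integral_mono_on hT0.le intervalIntegrable_const
      (hint r (hr.trans_le (min_le_right _ _)))
      (fun t _ => hρ₀ (r + t * Complex.I) (by simpa using hr.trans_le (min_le_left _ _)))
    rw [intervalIntegral.integral_const, sub_zero, smul_eq_mul, mul_sub,
      mul_div_cancel₀ _ hT0.ne'] at this
    exact this
  have hcore : ∀ w : ℂ, w.re < c → w.im ∈ Icc 0 T → h w = M := by
    intro w hw hwi
    by_contra hne
    have hlt : h w < M := lt_of_le_of_ne (hle w hw) hne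
    -- A single value below `M` would make the circular mean strictly smaller than `M`, by
    -- continuity.
    have h1 := intervalIntegral.integral_pos (f := fun t : ℝ => M - h (w.re + t * Complex.I)) hT0
      (continuous_const.sub (hcont hh.continuousOn w.re hw)).continuousOn
      (fun t _ => sub_nonneg.2 (hle _ (by simpa using hw)))
      ⟨w.im, hwi, by rw [Complex.re_add_im]; exact sub_pos.2 hlt⟩
    rw [intervalIntegral.integral_sub intervalIntegrable_const (hint _ hw),
      intervalIntegral.integral_const, sub_zero, smul_eq_mul] at h1
    have h2 := ge_of_convexOn_Iio hconv hGle hGlim hw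
    have h3 : G w.re = ∫ t in (0 : ℝ)..T, h (w.re + t * Complex.I) := rfl
    linarith
  have hperZ : Function.Periodic (fun t : ℝ => h (w.re + t * Complex.I)) T := by
    intro t
    have := hper (w.re + t * Complex.I)
    simp only
    rw [← this, hT]
    congr 1
    push_cast
    ring
  obtain ⟨y, hy, hye⟩ := hperZ.exists_mem_Ico₀ hT0 w.im
  simp only [Complex.re_add_im] at hye
  rw [hye]
  exact hcore _ (by simpa using hw) (by simpa using ⟨hy.1, hy.2.le⟩)

end MaximumPrinciple

/-! ## Holomorphic curves in the collar of a contact manifold -/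

/-- The pointwise linear algebra of an almost complex structure compatible with a contact form. -/
theorem contact_linear {E : Type*} [NormedAddCommGroup E] [NormedSpace ℝ E]
    {J : ℝ × E →L[ℝ] ℝ × E} (hsq : ∀ v, J (J v) = -v) {A : E [⋀^Fin 1]→L[ℝ] ℝ}
    {B : E [⋀^Fin 2]→L[ℝ] ℝ} {R : E} (hR : A ![R] = 1) (hRB : ∀ v, B ![R, v] = 0)
    (hJR : J (1, 0) = (0, R))
    (hJc : ∀ v, A ![v] = 0 → ∃ w, A ![w] = 0 ∧ J (0, v) = (0, w) ∧ (v ≠ 0 → 0 < B ![v, w]))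
    {r r' : ℝ} {ξ ξ' : E} (h : J (r, ξ) = (r', ξ')) :
    r' = -A ![ξ] ∧ A ![ξ'] = r ∧ 0 ≤ B ![ξ, ξ'] ∧ (B ![ξ, ξ'] = 0 → A ![ξ] = 0 → ξ = 0) := by
  have hA : ∀ (c : ℝ) (u v : E), A ![c • u + v] = c * A ![u] + A ![v] := fun c u v =>
    (A.toAlternatingMap.map_vecCons_add _ _ _).trans
      (congrArg (· + A ![v]) (A.toAlternatingMap.map_vecCons_smul _ _ _))
  have hB0 : ∀ (c : ℝ) (u v w : E), B ![c • u + v, w] = c * B ![u, w] + B ![v, w] := fun c u v w =>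
    (B.toAlternatingMap.map_vecCons_add _ _ _).trans
      (congrArg (· + B ![v, w]) (B.toAlternatingMap.map_vecCons_smul _ _ _))
  have hBs : ∀ u v : E, B ![u, v] = -B ![v, u] := by
    intro u v
    have h1 : (![u, v] : Fin 2 → E) = ![v, u] ∘ Equiv.swap (0 : Fin 2) 1 := by
      ext i
      fin_cases i <;> rfl
    rw [h1]
    exact B.toAlternatingMap.map_swap ![v, u] (by simp)
  have hB1 : ∀ (c : ℝ) (u v w : E), B ![w, c • u + v] = c * B ![w, u] + B ![w, v] := by
    intro c u v w
    rw [hBs, hB0, hBs u, hBs v]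
    ring
  -- Splitting off the Reeb component leaves a contact vector `v`. The plane spanned by ∂ₐ and `R`
  -- is preserved by `J`, and `R` does not contribute to dα.
  set v : E := ξ - A ![ξ] • R with hv
  have hξ : ξ = A ![ξ] • R + v := by rw [hv]; abel
  have hAv : A ![v] = 0 := by
    have := hA (A ![ξ]) R v
    rw [← hξ, hR] at this
    linarith
  obtain ⟨w, hw, hJv, hpos⟩ := hJc v hAv
  have hJR' : J (0, R) = (-1, 0) := by
    rw [← hJR, hsq]
    simp
  have hdec : ((r, ξ) : ℝ × E) = r • (1, 0) + A ![ξ] • (0, R) + (0, v) := by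
    ext
    · simp
    · simpa using hξ
  rw [hdec, map_add, map_add, map_smul, map_smul, hJR, hJR', hJv] at h
  have hr' : r' = -A ![ξ] := by
    have := congrArg Prod.fst h
    simp at this
    exact this.symm
  have hξ' : ξ' = r • R + w := by
    have := congrArg Prod.snd h
    simp at this
    exact this.symm
  have hBval : B ![ξ, ξ'] = B ![v, w] := by
    rw [hξ, hB0, hRB, hξ', hB1, hBs v R, hRB]
    simp
  refine ⟨hr', ?_, ?_, fun h0 hα => ?_⟩
  · rw [hξ', hA, hR, hw]
    simp
  · rw [hBval]
    by_cases hv0 : v = 0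
    · rw [hv0]
      exact (B.map_coord_zero (m := ![0, w]) 0 rfl).ge
    · exact (hpos hv0).le
  · rw [hBval] at h0
    by_contra hne
    refine (hpos fun hv0 => hne ?_).ne' h0
    rw [hξ, hα, hv0]
    simp

/-! ## Maps with vanishing derivative -/

section Constant

variable {C : Type*} [TopologicalSpace C] [ChartedSpace ℂ C]
  {E H : Type*} [NormedAddCommGroup E] [NormedSpace ℝ E] [TopologicalSpace H]
  {I : ModelWithCorners ℝ E H} {M : Type*} [TopologicalSpace M] [ChartedSpace H M]

theorem eventually_eq_of_mfderiv_eq_zero [IsManifold 𝓘(ℝ, ℂ) ∞ C] [IsManifold I ∞ M] {f : C → M}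
    (hf : ContMDiff 𝓘(ℝ, ℂ) I ∞ f) (h0 : ∀ p, mfderiv 𝓘(ℝ, ℂ) I f p = 0) (p : C) :
    ∀ᶠ q in 𝓝 p, f q = f p := by
  set c := extChartAt 𝓘(ℝ, ℂ) p with hc
  set ψ := extChartAt I (f p) with hψ
  have hopen : IsOpen (c.target ∩ c.symm ⁻¹' (f ⁻¹' ψ.source)) :=
    (continuousOn_extChartAt_symm p).isOpen_inter_preimage (isOpen_extChartAt_target p)
      ((isOpen_extChartAt_source _).preimage hf.continuous)
  have hmem : c p ∈ c.target ∩ c.symm ⁻¹' (f ⁻¹' ψ.source) := by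
    refine ⟨mem_extChartAt_target p, ?_⟩
    rw [mem_preimage, extChartAt_to_inv]
    exact mem_extChartAt_source (f p)
  obtain ⟨r, hr, hrs⟩ := Metric.isOpen_iff.1 hopen _ hmem
  have hder : ∀ z ∈ Metric.ball (c p) r,
      HasFDerivWithinAt (ψ ∘ f ∘ c.symm) (0 : ℂ →L[ℝ] E) (Metric.ball (c p) r) z := by
    intro z hz
    have h1 : MDifferentiableAt 𝓘(ℝ, ℂ) 𝓘(ℝ, ℂ) c.symm z :=
      ((contMDiffOn_extChartAt_symm (n := ∞) p).contMDiffAt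
        ((isOpen_extChartAt_target p).mem_nhds (hrs hz).1)).mdifferentiableAt (by simp)
    have h2 : MDifferentiableAt 𝓘(ℝ, ℂ) I f (c.symm z) := hf.mdifferentiableAt (by simp)
    have h3 : MDifferentiableAt I 𝓘(ℝ, E) ψ (f (c.symm z)) :=
      mdifferentiableAt_extChartAt (by simpa [hψ] using (hrs hz).2)
    have h4 := (h3.hasMFDerivAt.comp _ h2.hasMFDerivAt).comp z h1.hasMFDerivAt
    have h5 := h4.hasFDerivAt
    have h6 : ((mfderiv I 𝓘(ℝ, E) ψ (f (c.symm z))).comp (mfderiv 𝓘(ℝ, ℂ) I f (c.symm z))).comp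
        (mfderiv 𝓘(ℝ, ℂ) 𝓘(ℝ, ℂ) c.symm z) = (0 : ℂ →L[ℝ] E) := by
      refine ContinuousLinearMap.ext fun v => ?_
      refine (congrArg (fun L : ℂ →L[ℝ] E => mfderiv I 𝓘(ℝ, E) ψ (f (c.symm z))
        (L (mfderiv 𝓘(ℝ, ℂ) 𝓘(ℝ, ℂ) c.symm z v))) (h0 (c.symm z))).trans ?_
      exact map_zero (mfderiv I 𝓘(ℝ, E) ψ (f (c.symm z)))
    have h7 : HasFDerivAt (ψ ∘ f ∘ c.symm) (0 : ℂ →L[ℝ] E) z := by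
      rw [← h6]
      exact h5
    exact h7.hasFDerivWithinAt
  have hconst : ∀ z ∈ Metric.ball (c p) r, ψ (f (c.symm z)) = ψ (f p) := by
    intro z hz
    have := (convex_ball (c p) r).is_const_of_fderivWithin_eq_zero (𝕜 := ℝ) (f := ψ ∘ f ∘ c.symm)
      (fun z hz => (hder z hz).differentiableWithinAt)
      (fun z hz => (hder z hz).fderivWithin (Metric.isOpen_ball.uniqueDiffWithinAt hz))
      hz (Metric.mem_ball_self hr)
    simpa [hc] using this
  filter_upwards [extChartAt_source_mem_nhds (I := 𝓘(ℝ, ℂ)) p,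
    (continuousAt_extChartAt (I := 𝓘(ℝ, ℂ)) p).preimage_mem_nhds (Metric.ball_mem_nhds _ hr)]
    with q hq hqb
  have h1 := hconst _ hqb
  have h2 := (hrs hqb).2
  rw [mem_preimage] at h2
  rw [c.left_inv hq] at h1 h2
  exact ψ.injOn h2 (mem_extChartAt_source (f p)) h1

theorem eq_of_mfderiv_eq_zero [IsManifold 𝓘(ℝ, ℂ) ∞ C] [IsManifold I ∞ M] [PreconnectedSpace C]
    {f : C → M} (hf : ContMDiff 𝓘(ℝ, ℂ) I ∞ f) (h0 : ∀ p, mfderiv 𝓘(ℝ, ℂ) I f p = 0) (p q : C) :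
    f p = f q :=
  ((IsLocallyConstant.iff_eventually_eq f).2
    (eventually_eq_of_mfderiv_eq_zero hf h0)).apply_eq_of_isPreconnected isPreconnected_univ
    (mem_univ p) (mem_univ q)

/-- Holomorphic reparametrizations have complex linear derivatives. This is applied to charts and to
exponential polar coordinates. -/
theorem mfderiv_comp_holomorphic {C' : Type*} [TopologicalSpace C'] [ChartedSpace ℂ C']
    {J : EndoField I M} {v : C → M} {e : C' → C} {w : C'} (he : MDifferentiableAt 𝓘(ℂ) 𝓘(ℂ) e w)
    (hv : MDifferentiableAt 𝓘(ℝ, ℂ) I v (e w))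
    (hJ : ∀ ξ : TangentSpace 𝓘(ℝ, ℂ) (e w), mfderiv 𝓘(ℝ, ℂ) I v (e w) (complexJ C (e w) ξ) =
      J (v (e w)) (mfderiv 𝓘(ℝ, ℂ) I v (e w) ξ)) (ξ : TangentSpace 𝓘(ℝ, ℂ) w) :
    mfderiv 𝓘(ℝ, ℂ) I (v ∘ e) w (complexJ C' w ξ) =
      J (v (e w)) (mfderiv 𝓘(ℝ, ℂ) I (v ∘ e) w ξ) := by
  have h1 : ∀ ξ, mfderiv 𝓘(ℝ, ℂ) I (v ∘ e) w ξ = mfderiv 𝓘(ℝ, ℂ) I v (e w) (realDeriv e w ξ) :=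
    fun ξ => congrArg (fun L : ℂ →L[ℝ] E => L ξ)
      (mfderiv_comp w hv (mdifferentiableAt_real_of_complex he))
  refine (h1 _).trans ?_
  refine Eq.trans ?_ (congrArg (J (v (e w))) (h1 ξ)).symm
  refine Eq.trans ?_ (hJ (realDeriv e w ξ))
  exact congrArg (mfderiv 𝓘(ℝ, ℂ) I v (e w)) (realDeriv_I_smul he ξ)

end Constant

/-! ## Holomorphic curves in the collar, continued -/

section Collar

variable {ε : ℝ} {E H : Type*} [NormedAddCommGroup E] [NormedSpace ℝ E] [TopologicalSpace H]
  {I : ModelWithCorners ℝ E H} {N : Type*} [TopologicalSpace N] [ChartedSpace H N]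

theorem contMDiff_collar_coe : ContMDiff halfLine 𝓘(ℝ) ∞ fun c : Collar ε => (c.1.1 : ℝ) :=
  halfLine.contMDiff.comp contMDiff_subtype_val

/-- In the chart the inclusion is the identity, though at the boundary only within the half-line;
unique differentiability there determines the derivative. -/
theorem mfderiv_collar_coe (c : Collar ε) :
    mfderiv halfLine 𝓘(ℝ) (fun c : Collar ε => (c.1.1 : ℝ)) c = ContinuousLinearMap.id ℝ ℝ := by
  have h : MDifferentiableAt halfLine 𝓘(ℝ) (fun c : Collar ε => (c.1.1 : ℝ)) c :=
    contMDiff_collar_coe.mdifferentiableAt (by simp)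
  refine h.mfderiv.trans ?_
  have h1 : ∀ y ∈ (extChartAt halfLine c).target,
      writtenInExtChartAt halfLine 𝓘(ℝ) c (fun c : Collar ε => (c.1.1 : ℝ)) y = y := fun y hy =>
    (extChartAt halfLine c).right_inv hy
  have h2 : writtenInExtChartAt halfLine 𝓘(ℝ) c (fun c : Collar ε => (c.1.1 : ℝ))
      =ᶠ[𝓝[range halfLine] (extChartAt halfLine c c)] id := by
    filter_upwards [extChartAt_target_mem_nhdsWithin (I := halfLine) c] with y hy
    exact h1 y hy
  rw [h2.fderivWithin_eq (h1 _ (mem_extChartAt_target c)), fderivWithin_id]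
  exact halfLine.uniqueDiffOn _ (mem_range_self _)

theorem mfderiv_collar_apply {g : ℂ → Collar ε × N} {z : ℂ}
    (hg : MDifferentiableAt 𝓘(ℝ, ℂ) (halfLine.prod I) g z) (w : ℂ) :
    mfderiv 𝓘(ℝ, ℂ) (halfLine.prod I) g z w =
      ((fderiv ℝ (fun y => ((g y).1.1.1 : ℝ)) z w,
        mfderiv 𝓘(ℝ, ℂ) I (fun y => (g y).2) z w) : ℝ × E) := by
  have h1 : MDifferentiableAt 𝓘(ℝ, ℂ) halfLine (fun y => (g y).1) z := hg.fst
  have h2 : MDifferentiableAt 𝓘(ℝ, ℂ) I (fun y => (g y).2) z := hg.snd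
  have h3 := (h1.hasMFDerivAt.prodMk h2.hasMFDerivAt).mfderiv
  refine (congrArg (fun L : ℂ →L[ℝ] ℝ × E => L w) h3).trans ?_
  refine Prod.ext ?_ rfl
  have h4 : MDifferentiableAt halfLine 𝓘(ℝ) (fun c : Collar ε => (c.1.1 : ℝ)) (g z).1 :=
    contMDiff_collar_coe.mdifferentiableAt (by simp)
  have h5 : fderiv ℝ (fun y => ((g y).1.1.1 : ℝ)) z =
      (mfderiv halfLine 𝓘(ℝ) (fun c : Collar ε => (c.1.1 : ℝ)) (g z).1).comp
        (mfderiv 𝓘(ℝ, ℂ) halfLine (fun y => (g y).1) z) :=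
    HasFDerivAt.fderiv (hasMFDerivAt_iff_hasFDerivAt.1 (HasMFDerivAt.comp
      (g := fun c : Collar ε => (c.1.1 : ℝ)) (f := fun y => (g y).1) z h4.hasMFDerivAt
      h1.hasMFDerivAt))
  refine Eq.trans ?_ (congrArg (fun L : ℂ →L[ℝ] ℝ => L w) h5).symm
  exact (congrArg (fun L : ℝ →L[ℝ] ℝ => L (mfderiv 𝓘(ℝ, ℂ) halfLine (fun y => (g y).1) z w))
    (mfderiv_collar_coe (g z).1)).symm

/-- The Cauchy–Riemann equation of a holomorphic curve in the collar and the positivity of the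
`dα`-area, at a point. -/
theorem contact_cauchyRiemann {α : DForm I N 1} {J : EndoField (halfLine.prod I) (Collar ε × N)}
    (hJ : IsContactCompatible ε α J) {g : ℂ → Collar ε × N} {z : ℂ}
    (hg : MDifferentiableAt 𝓘(ℝ, ℂ) (halfLine.prod I) g z)
    (hJg : ∀ w : ℂ, mfderiv 𝓘(ℝ, ℂ) (halfLine.prod I) g z (Complex.I * w) =
      J (g z) (mfderiv 𝓘(ℝ, ℂ) (halfLine.prod I) g z w)) (w : ℂ) :
    fderiv ℝ (fun y => ((g y).1.1.1 : ℝ)) z (Complex.I * w) =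
        -α (g z).2 ![mfderiv 𝓘(ℝ, ℂ) I (fun y => (g y).2) z w] ∧
      0 ≤ extD I α (g z).2 ![mfderiv 𝓘(ℝ, ℂ) I (fun y => (g y).2) z w,
        mfderiv 𝓘(ℝ, ℂ) I (fun y => (g y).2) z (Complex.I * w)] ∧
      (extD I α (g z).2 ![mfderiv 𝓘(ℝ, ℂ) I (fun y => (g y).2) z w,
        mfderiv 𝓘(ℝ, ℂ) I (fun y => (g y).2) z (Complex.I * w)] = 0 →
        fderiv ℝ (fun y => ((g y).1.1.1 : ℝ)) z = 0 →
        mfderiv 𝓘(ℝ, ℂ) (halfLine.prod I) g z w = 0) := by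
  obtain ⟨R, hR, hJR⟩ := hJ.map_liouville (g z).1 (g z).2
  have h := contact_linear (E := E) (J := J (g z)) (hJ.almostComplex.sq (g z)) (A := α (g z).2)
    (B := extD I α (g z).2) (R := R) hR.1 hR.2 hJR (hJ.map_contact (g z).1 (g z).2)
    (r := fderiv ℝ (fun y => ((g y).1.1.1 : ℝ)) z w)
    (ξ := mfderiv 𝓘(ℝ, ℂ) I (fun y => (g y).2) z w)
    (r' := fderiv ℝ (fun y => ((g y).1.1.1 : ℝ)) z (Complex.I * w))
    (ξ' := mfderiv 𝓘(ℝ, ℂ) I (fun y => (g y).2) z (Complex.I * w))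
    ((congrArg (J (g z)) (mfderiv_collar_apply hg w).symm).trans
      ((hJg w).symm.trans (mfderiv_collar_apply hg _)))
  refine ⟨h.1, h.2.2.1, fun h0 hd => ?_⟩
  have hr : fderiv ℝ (fun y => ((g y).1.1.1 : ℝ)) z w = 0 := by rw [hd]; rfl
  have hr' : fderiv ℝ (fun y => ((g y).1.1.1 : ℝ)) z (Complex.I * w) = 0 := by rw [hd]; rfl
  have hξ := h.2.2.2 h0 (neg_eq_zero.1 (h.1.symm.trans hr'))
  exact (mfderiv_collar_apply hg w).trans (Prod.ext hr hξ)

/-- The Cauchy–Riemann equation says that the pull-back of α is -da ∘ i. Its exterior derivative is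
the Laplacian of `a` times dx ∧ dy on one side and the pull-back of dα on the other. -/
theorem laplacian_collar [IsManifold I ∞ N] {α : DForm I N 1} (hα : IsSmoothForm I α)
    {J : EndoField (halfLine.prod I) (Collar ε × N)}
    (hJ : IsContactCompatible ε α J) {g : ℂ → Collar ε × N} {s : Set ℂ} (hs : IsOpen s)
    (hg : ContMDiffOn 𝓘(ℝ, ℂ) (halfLine.prod I) ∞ g s)
    (hJg : ∀ z ∈ s, ∀ w : ℂ, mfderiv 𝓘(ℝ, ℂ) (halfLine.prod I) g z (Complex.I * w) =
      J (g z) (mfderiv 𝓘(ℝ, ℂ) (halfLine.prod I) g z w)) {z : ℂ} (hz : z ∈ s) :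
    fderiv ℝ (fun y => fderiv ℝ (fun y => ((g y).1.1.1 : ℝ)) y 1) z 1 +
        fderiv ℝ (fun y => fderiv ℝ (fun y => ((g y).1.1.1 : ℝ)) y Complex.I) z Complex.I =
      extD I α (g z).2 ![mfderiv 𝓘(ℝ, ℂ) I (fun y => (g y).2) z (1 : ℂ),
        mfderiv 𝓘(ℝ, ℂ) I (fun y => (g y).2) z Complex.I] := by
  have hx : ContMDiffOn 𝓘(ℝ, ℂ) I ∞ (fun y => (g y).2) s := contMDiff_snd.comp_contMDiffOn hg
  have hmd : ∀ y ∈ s, MDifferentiableAt 𝓘(ℝ, ℂ) (halfLine.prod I) g y := fun y hy =>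
    (hg.contMDiffAt (hs.mem_nhds hy)).mdifferentiableAt (by simp)
  set h : ℂ → ℝ := fun y => ((g y).1.1.1 : ℝ) with hh
  set β := pullbackOn I (fun y => (g y).2) s α with hβ
  have hβ1 : ∀ y ∈ s, ∀ w : ℂ, β y ![w] = -fderiv ℝ h y (Complex.I * w) := by
    intro y hy w
    have h1 := (contact_cauchyRiemann hJ (hmd y hy) (hJg y hy) w).1
    rw [h1, neg_neg]
    have h2 : mfderivWithin 𝓘(ℝ, ℂ) I (fun y => (g y).2) s y =
        mfderiv 𝓘(ℝ, ℂ) I (fun y => (g y).2) y := mfderivWithin_of_isOpen hs hy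
    refine (congrArg (fun L : ℂ →L[ℝ] E => α (g y).2 (L ∘ ![w])) h2).trans ?_
    congr 1
    funext i
    fin_cases i
    rfl
  have hβd : DifferentiableWithinAt ℝ β s z :=
    (contDiffOn_pullbackOn hα hs.uniqueDiffOn hx).differentiableOn (by simp) z hz
  have h1 := extDerivWithin_pullbackOn hα hs.uniqueDiffOn hx hz
    (by rw [hs.interior_eq]; exact subset_closure hz)
  have h2 := extDerivWithin_apply hβd (hs.uniqueDiffWithinAt hz) ![1, Complex.I]
  have h3 : pullbackOn I (fun y => (g y).2) s (extD I α) z ![1, Complex.I] =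
      extD I α (g z).2 ![mfderiv 𝓘(ℝ, ℂ) I (fun y => (g y).2) z (1 : ℂ),
        mfderiv 𝓘(ℝ, ℂ) I (fun y => (g y).2) z Complex.I] := by
    have h2 : mfderivWithin 𝓘(ℝ, ℂ) I (fun y => (g y).2) s z =
        mfderiv 𝓘(ℝ, ℂ) I (fun y => (g y).2) z := mfderivWithin_of_isOpen hs hz
    refine (congrArg (fun L : ℂ →L[ℝ] E =>
      extD I α (g z).2 (L ∘ ![1, Complex.I])) h2).trans ?_
    congr 1
    funext i
    fin_cases i <;> rfl
  have hcongr : ∀ (u w : ℂ), fderivWithin ℝ (fun y => β y ![w]) s z u =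
      -fderiv ℝ (fun y => fderiv ℝ h y (Complex.I * w)) z u := by
    intro u w
    rw [fderivWithin_congr (hβ1 · · w) (hβ1 z hz w), fderivWithin_of_isOpen hs hz, fderiv_fun_neg]
    rfl
  rw [← h3, ← h1, h2, Fin.sum_univ_two]
  have e0 : (0 : Fin 2).removeNth (![1, Complex.I] : Fin 2 → ℂ) = ![Complex.I] := by
    funext i; fin_cases i; rfl
  have e1 : (1 : Fin 2).removeNth (![1, Complex.I] : Fin 2 → ℂ) = ![1] := by
    funext i; fin_cases i; rfl
  rw [e0, e1, hcongr, hcongr]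
  have e2 : (fun y => fderiv ℝ h y (Complex.I * Complex.I)) = fun y => -fderiv ℝ h y 1 := by
    funext y
    rw [Complex.I_mul_I, map_neg]
  rw [e2, fderiv_fun_neg]
  simp

end Collar

/-! ### The maximum principle for holomorphic curves in the collar -/

section Collar

variable {ε : ℝ} {E H : Type*} [NormedAddCommGroup E] [NormedSpace ℝ E] [TopologicalSpace H]
  {I : ModelWithCorners ℝ E H} {N : Type*} [TopologicalSpace N] [ChartedSpace H N]
  [IsManifold I ∞ N] {α : DForm I N 1} {J : EndoField (halfLine.prod I) (Collar ε × N)}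
  {C : Type*} [TopologicalSpace C] [ChartedSpace ℂ C] [IsManifold 𝓘(ℂ) ∞ C]

theorem mdifferentiableAt_chart_symm (p : C) {z : ℂ} (hz : z ∈ (chartAt ℂ p).target) :
    MDifferentiableAt 𝓘(ℂ) 𝓘(ℂ) (chartAt ℂ p).symm z :=
  mdifferentiableAt_atlas_symm (I := 𝓘(ℂ)) (ChartedSpace.chart_mem_atlas (H := ℂ) p) hz

theorem contMDiffOn_chart_symm_real (p : C) :
    ContMDiffOn 𝓘(ℝ, ℂ) 𝓘(ℝ, ℂ) ∞ (chartAt ℂ p).symm (chartAt ℂ p).target := by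
  have := isManifold_real_of_complex C
  exact contMDiffOn_chart_symm

/-- The strong maximum principle: where the collar coordinate of a holomorphic curve attains a local
maximum, it is locally constant. -/
theorem collar_eventually_eq_of_isLocalMax (hα : IsSmoothForm I α) (hJ : IsContactCompatible ε α J)
    {v : C → Collar ε × N} {U : Set C} (hU : IsOpen U)
    (hv : ContMDiffOn 𝓘(ℝ, ℂ) (halfLine.prod I) ∞ v U)
    (hJv : ∀ p ∈ U, ∀ ξ : TangentSpace 𝓘(ℝ, ℂ) p,
      mfderiv 𝓘(ℝ, ℂ) (halfLine.prod I) v p (complexJ C p ξ) =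
        J (v p) (mfderiv 𝓘(ℝ, ℂ) (halfLine.prod I) v p ξ)) {p : C} (hp : p ∈ U)
    (hmax : ∀ᶠ q in 𝓝 p, ((v q).1.1.1 : ℝ) ≤ (v p).1.1.1) :
    ∀ᶠ q in 𝓝 p, ((v q).1.1.1 : ℝ) = (v p).1.1.1 := by
  set c := chartAt ℂ p with hc
  set z₀ := c p with hz₀
  have hpt : z₀ ∈ c.target := c.map_source (mem_chart_source ℂ p)
  have hsymm : c.symm z₀ = p := c.left_inv (mem_chart_source ℂ p)
  have hcs : Filter.Tendsto c.symm (𝓝 z₀) (𝓝 p) := by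
    have := (c.continuousAt_symm hpt).tendsto
    rwa [hsymm] at this
  obtain ⟨R, hR, hball⟩ := Metric.mem_nhds_iff.1 (Filter.inter_mem (c.open_target.mem_nhds hpt)
    (hcs (Filter.inter_mem (hU.mem_nhds hp) hmax)))
  -- The half-plane Re w < log R covers the punctured coordinate disc of radius `R` around `p`. As
  -- `e` is holomorphic, the composed curve is holomorphic and its collar coordinate subharmonic in
  -- `w`.
  set e : ℂ → C := fun w => c.symm (z₀ + Complex.exp w) with he
  set s : Set ℂ := {w | w.re < Real.log R} with hs
  have hmem : ∀ w ∈ s, z₀ + Complex.exp w ∈ Metric.ball z₀ R := by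
    intro w hw
    rw [mem_ball_iff_norm, add_sub_cancel_left, Complex.norm_exp]
    exact (Real.lt_log_iff_exp_lt hR).1 hw
  have heU : ∀ w ∈ s, e w ∈ U := fun w hw => (hball (hmem w hw)).2.1
  have hexp : ContMDiff 𝓘(ℝ, ℂ) 𝓘(ℝ, ℂ) ∞ fun w : ℂ => z₀ + Complex.exp w :=
    ((contDiff_const.add Complex.contDiff_exp).contMDiff)
  have hes : ContMDiffOn 𝓘(ℝ, ℂ) 𝓘(ℝ, ℂ) ∞ e s :=
    (contMDiffOn_chart_symm_real p).comp hexp.contMDiffOn fun w hw => (hball (hmem w hw)).1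
  have hved : ContMDiffOn 𝓘(ℝ, ℂ) (halfLine.prod I) ∞ (v ∘ e) s := hv.comp hes heU
  have hehol : ∀ w ∈ s, MDifferentiableAt 𝓘(ℂ) 𝓘(ℂ) e w := fun w hw =>
    MDifferentiableAt.comp (g := c.symm) (f := fun w : ℂ => z₀ + Complex.exp w) w
      (mdifferentiableAt_chart_symm p (hball (hmem w hw)).1)
      ((Complex.differentiableAt_exp.const_add z₀).mdifferentiableAt)
  have hJe : ∀ w ∈ s, ∀ ξ : ℂ, mfderiv 𝓘(ℝ, ℂ) (halfLine.prod I) (v ∘ e) w (Complex.I * ξ) =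
      J ((v ∘ e) w) (mfderiv 𝓘(ℝ, ℂ) (halfLine.prod I) (v ∘ e) w ξ) := fun w hw ξ =>
    mfderiv_comp_holomorphic (hehol w hw) ((hv.contMDiffAt (hU.mem_nhds (heU w hw))).mdifferentiableAt
      (by simp)) (hJv _ (heU w hw)) ξ
  have hmd : ∀ y ∈ s, MDifferentiableAt 𝓘(ℝ, ℂ) (halfLine.prod I) (v ∘ e) y := fun y hy =>
    (hved.contMDiffAt ((isOpen_re_lt _).mem_nhds hy)).mdifferentiableAt (by simp)
  have hsmooth : ContDiffOn ℝ ∞ (fun w => (((v ∘ e) w).1.1.1 : ℝ)) s := by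
    rw [← contMDiffOn_iff_contDiffOn]
    exact contMDiff_collar_coe.comp_contMDiffOn (contMDiff_fst.comp_contMDiffOn hved)
  have hmain := eq_of_laplacian_nonneg (M := ((v p).1.1.1 : ℝ)) hsmooth ?_ ?_ ?_ ?_
  · have hcp : Filter.Tendsto c (𝓝 p) (𝓝 z₀) :=
      (c.continuousAt (mem_chart_source ℂ p)).tendsto
    filter_upwards [c.open_source.mem_nhds (mem_chart_source ℂ p),
      hcp (Metric.ball_mem_nhds z₀ hR)] with q hq hqb
    by_cases hne : c q = z₀
    · rw [c.injOn hq (mem_chart_source ℂ p) hne]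
    · have hne' : c q - z₀ ≠ 0 := sub_ne_zero.2 hne
      have hre : (Complex.log (c q - z₀)).re < Real.log R := by
        rw [Complex.log_re]
        exact Real.log_lt_log (norm_pos_iff.2 hne') (mem_ball_iff_norm.1 hqb)
      have h1 := hmain _ hre
      have h2 : e (Complex.log (c q - z₀)) = q := by
        simp only [he]
        rw [Complex.exp_log hne', add_sub_cancel]
        exact c.left_inv hq
      simpa only [Function.comp, h2] using h1
  · intro w
    have : e (w + 2 * Real.pi * Complex.I) = e w := by
      simp only [he]
      rw [Complex.exp_periodic w]
    simp only [Function.comp, this]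
  · intro w hw
    rw [laplacian_collar hα hJ (isOpen_re_lt _) hved hJe hw]
    have h1 := (contact_cauchyRiemann hJ (hmd w hw) (hJe w hw) 1).2.1
    rwa [mul_one] at h1
  · exact fun w hw => (hball (hmem w hw)).2.2
  · intro δ hδ
    have hcont : Filter.Tendsto (fun z => ((v (c.symm z)).1.1.1 : ℝ)) (𝓝 z₀)
        (𝓝 ((v p).1.1.1 : ℝ)) := by
      have h1 : ContinuousAt v p := hv.continuousOn.continuousAt (hU.mem_nhds hp)
      have h2 : Continuous fun x : Collar ε × N => (x.1.1.1 : ℝ) := by fun_prop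
      exact (h2.tendsto (v p)).comp (h1.tendsto.comp hcs)
    obtain ⟨r, hr, hrb⟩ := Metric.mem_nhds_iff.1 (hcont (Ioi_mem_nhds (sub_lt_self _ hδ)))
    refine ⟨Real.log r, fun w hw => ?_⟩
    have : z₀ + Complex.exp w ∈ Metric.ball z₀ r := by
      rw [mem_ball_iff_norm, add_sub_cancel_left, Complex.norm_exp]
      exact (Real.lt_log_iff_exp_lt hr).1 hw
    exact (hrb this).le

/-- A holomorphic curve in the collar on which the collar coordinate is constant is constant. -/
theorem mfderiv_eq_zero_of_collar_const (hα : IsSmoothForm I α) (hJ : IsContactCompatible ε α J)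
    {v : C → Collar ε × N} (hv : ContMDiff 𝓘(ℝ, ℂ) (halfLine.prod I) ∞ v)
    (hJv : ∀ (p : C) (ξ : TangentSpace 𝓘(ℝ, ℂ) p),
      mfderiv 𝓘(ℝ, ℂ) (halfLine.prod I) v p (complexJ C p ξ) =
        J (v p) (mfderiv 𝓘(ℝ, ℂ) (halfLine.prod I) v p ξ)) {a : ℝ}
    (ha : ∀ p, ((v p).1.1.1 : ℝ) = a) (p : C) :
    mfderiv 𝓘(ℝ, ℂ) (halfLine.prod I) v p = 0 := by
  have := isManifold_real_of_complex C
  set c := chartAt ℂ p with hc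
  set g : ℂ → Collar ε × N := v ∘ c.symm with hg
  have hpt : c p ∈ c.target := c.map_source (mem_chart_source ℂ p)
  have hgs : ContMDiffOn 𝓘(ℝ, ℂ) (halfLine.prod I) ∞ g c.target :=
    hv.comp_contMDiffOn (contMDiffOn_chart_symm_real p)
  have hJg : ∀ w ∈ c.target, ∀ ξ : ℂ, mfderiv 𝓘(ℝ, ℂ) (halfLine.prod I) g w (Complex.I * ξ) =
      J (g w) (mfderiv 𝓘(ℝ, ℂ) (halfLine.prod I) g w ξ) := fun w hw ξ =>
    mfderiv_comp_holomorphic (mdifferentiableAt_chart_symm p hw)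
      (hv.mdifferentiableAt (by simp)) (hJv _) ξ
  have hmd : MDifferentiableAt 𝓘(ℝ, ℂ) (halfLine.prod I) g (c p) :=
    (hgs.contMDiffAt (c.open_target.mem_nhds hpt)).mdifferentiableAt (by simp)
  have hconst : (fun y => ((g y).1.1.1 : ℝ)) = fun _ => a := funext fun y => ha _
  have hlap := laplacian_collar hα hJ c.open_target hgs hJg hpt
  have hcr := (contact_cauchyRiemann hJ hmd (hJg _ hpt) 1).2.2
  rw [mul_one] at hcr
  -- For constant `a` the Laplacian vanishes, hence so does the dα-area. Since da also vanishes,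
  -- neither a contact nor a Reeb direction is left for the derivative.
  have h1 : mfderiv 𝓘(ℝ, ℂ) (halfLine.prod I) g (c p) (1 : ℂ) = 0 := by
    refine hcr (hlap.symm.trans ?_) (by rw [hconst]; simp)
    rw [hconst]
    simp
  have h2 : mfderiv 𝓘(ℝ, ℂ) (halfLine.prod I) g (c p) Complex.I = 0 := by
    have h3 := hJg (c p) hpt 1
    rw [mul_one] at h3
    exact h3.trans ((congrArg (J (g (c p))) h1).trans (map_zero (J (g (c p)))))
  have h0 : mfderiv 𝓘(ℝ, ℂ) (halfLine.prod I) g (c p) = 0 := by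
    refine ContinuousLinearMap.ext fun (ξ : ℂ) => ?_
    have hξ : ξ = ξ.re • (1 : ℂ) + ξ.im • Complex.I := by
      simp [Complex.re_add_im]
    let L : ℂ →L[ℝ] ℝ × E := mfderiv 𝓘(ℝ, ℂ) (halfLine.prod I) g (c p)
    change L ξ = 0
    have h1' : L 1 = 0 := h1
    have h2' : L Complex.I = 0 := h2
    rw [hξ, map_add, map_smul, map_smul, h1', h2', smul_zero, smul_zero, add_zero]
  have heq : v =ᶠ[𝓝 p] g ∘ c := by
    filter_upwards [c.open_source.mem_nhds (mem_chart_source ℂ p)] with q hq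
    exact (congrArg v (c.left_inv hq)).symm
  have hcd : MDifferentiableAt 𝓘(ℝ, ℂ) 𝓘(ℝ, ℂ) c p :=
    mdifferentiableAt_atlas (I := 𝓘(ℝ, ℂ)) (ChartedSpace.chart_mem_atlas p) (mem_chart_source ℂ p)
  rw [heq.mfderiv_eq, mfderiv_comp p hmd hcd]
  exact ContinuousLinearMap.ext fun ξ =>
    congrArg (fun L : ℂ →L[ℝ] ℝ × E => L (mfderiv 𝓘(ℝ, ℂ) 𝓘(ℝ, ℂ) c p ξ)) h0

end Collar

/-! ## Holomorphic maps between Riemann surfaces -/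

section RiemannSurfaces

variable {C C' : Type*} [TopologicalSpace C] [ChartedSpace ℂ C] [TopologicalSpace C']
  [ChartedSpace ℂ C'] {f : C → C'}

/-- The expression of a map in the charts around `p` and `f p`. -/
def chartRep (f : C → C') (p : C) : ℂ → ℂ := fun y =>
  chartAt ℂ (f p) (f ((chartAt ℂ p).symm y))

/-- The natural domain of the expression of a map in charts. -/
def chartDomain (f : C → C') (p : C) : Set ℂ :=
  (chartAt ℂ p).target ∩ (chartAt ℂ p).symm ⁻¹' (f ⁻¹' (chartAt ℂ (f p)).source)


theorem isOpen_chartDomain (hf : Continuous f) (p : C) : IsOpen (chartDomain f p) :=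
  (chartAt ℂ p).isOpen_inter_preimage_symm ((chartAt ℂ (f p)).open_source.preimage hf)

theorem chart_mem_chartDomain (f : C → C') {p q : C} (hq : q ∈ (chartAt ℂ p).source)
    (hfq : f q ∈ (chartAt ℂ (f p)).source) : chartAt ℂ p q ∈ chartDomain f p := by
  refine ⟨(chartAt ℂ p).map_source hq, ?_⟩
  rwa [mem_preimage, (chartAt ℂ p).left_inv hq]

theorem chart_self_mem_chartDomain (f : C → C') (p : C) : chartAt ℂ p p ∈ chartDomain f p :=
  chart_mem_chartDomain f (mem_chart_source ℂ p) (mem_chart_source ℂ (f p))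

theorem chartRep_chart (f : C → C') {p q : C} (hq : q ∈ (chartAt ℂ p).source) :
    chartRep f p (chartAt ℂ p q) = chartAt ℂ (f p) (f q) := by
  rw [chartRep, (chartAt ℂ p).left_inv hq]

theorem eventually_mem_source (hf : Continuous f) (p : C) :
    ∀ᶠ q in 𝓝 p, q ∈ (chartAt ℂ p).source ∧ f q ∈ (chartAt ℂ (f p)).source :=
  Filter.inter_mem ((chartAt ℂ p).open_source.mem_nhds (mem_chart_source ℂ p))
    (hf.continuousAt ((chartAt ℂ (f p)).open_source.mem_nhds (mem_chart_source ℂ (f p))))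

theorem tendsto_chart (p : C) : Filter.Tendsto (chartAt ℂ p) (𝓝 p) (𝓝 (chartAt ℂ p p)) :=
  ((chartAt ℂ p).continuousAt (mem_chart_source ℂ p)).tendsto

theorem tendsto_chart_symm (p : C) :
    Filter.Tendsto (chartAt ℂ p).symm (𝓝 (chartAt ℂ p p)) (𝓝 p) := by
  have h := ((chartAt ℂ p).continuousAt_symm (mem_chart_target ℂ p)).tendsto
  rwa [(chartAt ℂ p).left_inv (mem_chart_source ℂ p)] at h

theorem not_eventually_chartRep_eq (hf : Continuous f) {p : C}
    (h : ¬ ∀ᶠ q in 𝓝 p, f q = f p) :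
    ¬ ∀ᶠ y in 𝓝 (chartAt ℂ p p), chartRep f p y = chartRep f p (chartAt ℂ p p) := by
  intro hy
  refine h ?_
  filter_upwards [eventually_mem_source hf p, tendsto_chart p hy] with q hq hqy
  have hqy' : chartRep f p (chartAt ℂ p q) = chartRep f p (chartAt ℂ p p) := hqy
  rw [chartRep_chart f hq.1, chartRep_chart f (mem_chart_source ℂ p)] at hqy'
  exact (chartAt ℂ (f p)).injOn hq.2 (mem_chart_source ℂ (f p)) hqy'

variable [IsManifold 𝓘(ℂ) ∞ C] [IsManifold 𝓘(ℂ) ∞ C']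

theorem differentiableOn_chartRep (hf : MDifferentiable 𝓘(ℂ) 𝓘(ℂ) f) (p : C) :
    DifferentiableOn ℂ (chartRep f p) (chartDomain f p) := by
  intro y hy
  refine DifferentiableAt.differentiableWithinAt ?_
  rw [← mdifferentiableAt_iff_differentiableAt]
  exact MDifferentiableAt.comp (g := chartAt ℂ (f p)) (f := fun y => f ((chartAt ℂ p).symm y)) y
    (mdifferentiableAt_atlas (I := 𝓘(ℂ)) (ChartedSpace.chart_mem_atlas _) hy.2)
    (MDifferentiableAt.comp (g := f) y (hf _) (mdifferentiableAt_chart_symm p hy.1))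

theorem analyticAt_chartRep (hf : MDifferentiable 𝓘(ℂ) 𝓘(ℂ) f) {p : C} {y : ℂ}
    (hy : y ∈ chartDomain f p) : AnalyticAt ℂ (chartRep f p) y :=
  (differentiableOn_chartRep hf p).analyticOnNhd (isOpen_chartDomain hf.continuous p) y hy

theorem contMDiff_of_mdifferentiable (hf : MDifferentiable 𝓘(ℂ) 𝓘(ℂ) f) :
    ContMDiff 𝓘(ℂ) 𝓘(ℂ) ∞ f := by
  intro p
  rw [contMDiffAt_iff]
  exact ⟨hf.continuous.continuousAt,
    (analyticAt_chartRep hf (chart_self_mem_chartDomain f p)).contDiffAt.contDiffWithinAt⟩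

/-- The identity theorem: a holomorphic map that is not constant is nowhere locally constant. -/
theorem not_eventually_eq_of_not_const [PreconnectedSpace C]
    (hf : MDifferentiable 𝓘(ℂ) 𝓘(ℂ) f) (hnc : ¬ ∃ w, ∀ q, f q = w) (p : C) :
    ¬ ∀ᶠ q in 𝓝 p, f q = f p := by
  intro hp
  -- Local constancy is an open condition; the identity theorem on a coordinate ball shows that it
  -- is also closed.
  set A : Set C := {p | ∀ᶠ q in 𝓝 p, f q = f p} with hA
  have hAo : IsOpen A := by
    refine isOpen_iff_mem_nhds.2 fun q hq => ?_
    have hq' : ∀ᶠ r in 𝓝 q, f r = f q := hq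
    filter_upwards [hq'.eventually_nhds, hq'] with r hr hrq
    filter_upwards [hr] with t ht
    rw [ht, hrq]
  have hAc : IsClosed A := by
    refine isClosed_of_closure_subset fun q hq => ?_
    obtain ⟨r, hr, hrs⟩ := Metric.isOpen_iff.1 (isOpen_chartDomain hf.continuous q) _
      (chart_self_mem_chartDomain f q)
    have hnb : ∀ᶠ t in 𝓝 q, t ∈ (chartAt ℂ q).source ∧ f t ∈ (chartAt ℂ (f q)).source ∧
        chartAt ℂ q t ∈ Metric.ball (chartAt ℂ q q) r := by
      filter_upwards [eventually_mem_source hf.continuous q,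
        tendsto_chart q (Metric.ball_mem_nhds _ hr)] with t ht htb
      exact ⟨ht.1, ht.2, htb⟩
    obtain ⟨t, ⟨ht, hft, htb⟩, htA⟩ := mem_closure_iff_nhds.1 hq _ hnb
    have htA' : ∀ᶠ s in 𝓝 t, f s = f t := htA
    have hsymm : Filter.Tendsto (chartAt ℂ q).symm (𝓝 (chartAt ℂ q t)) (𝓝 t) := by
      have h := ((chartAt ℂ q).continuousAt_symm ((chartAt ℂ q).map_source ht)).tendsto
      rwa [(chartAt ℂ q).left_inv ht] at h
    have hloc : chartRep f q =ᶠ[𝓝 (chartAt ℂ q t)] fun _ => chartAt ℂ (f q) (f t) := by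
      filter_upwards [hsymm htA'] with y hy
      have hy' : f ((chartAt ℂ q).symm y) = f t := hy
      rw [chartRep, hy']
    have hball : EqOn (chartRep f q) (fun _ => chartAt ℂ (f q) (f t))
        (Metric.ball (chartAt ℂ q q) r) :=
      AnalyticOnNhd.eqOn_of_preconnected_of_eventuallyEq
        (fun y hy => analyticAt_chartRep hf (hrs hy)) (fun y _ => analyticAt_const)
        (convex_ball _ _).isPreconnected htb hloc
    have hval : ∀ s, s ∈ (chartAt ℂ q).source → f s ∈ (chartAt ℂ (f q)).source →
        chartAt ℂ q s ∈ Metric.ball (chartAt ℂ q q) r → f s = f t := by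
      intro s hs hfs hsb
      have := hball hsb
      rw [chartRep_chart f hs] at this
      exact (chartAt ℂ (f q)).injOn hfs hft this
    have hq0 := hval q (mem_chart_source ℂ q) (mem_chart_source ℂ (f q)) (Metric.mem_ball_self hr)
    change ∀ᶠ s in 𝓝 q, f s = f q
    filter_upwards [hnb] with s hs
    rw [hq0, hval s hs.1 hs.2.1 hs.2.2]
  have huniv : A = univ := IsClopen.eq_univ ⟨hAc, hAo⟩ ⟨p, hp⟩
  refine hnc ⟨f p, fun q => ?_⟩
  exact ((IsLocallyConstant.iff_eventually_eq f).2 fun r =>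
    (huniv ▸ mem_univ r : r ∈ A)).apply_eq_of_isPreconnected isPreconnected_univ
    (mem_univ q) (mem_univ p)

/-- The open mapping theorem. -/
theorem nhds_le_map_of_not_eventually_eq (hf : MDifferentiable 𝓘(ℂ) 𝓘(ℂ) f) {p : C}
    (h : ¬ ∀ᶠ q in 𝓝 p, f q = f p) : 𝓝 (f p) ≤ Filter.map f (𝓝 p) := by
  have h1 := (analyticAt_chartRep hf
    (chart_self_mem_chartDomain f p)).eventually_constant_or_nhds_le_map_nhds.resolve_left
    (not_eventually_chartRep_eq hf.continuous h)
  rw [chartRep_chart f (mem_chart_source ℂ p)] at h1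
  intro s hs
  have hs' : f ⁻¹' s ∈ 𝓝 p := hs
  have h2 : chartRep f p '' (chartDomain f p ∩ (chartAt ℂ p).symm ⁻¹' (f ⁻¹' s)) ∈
      𝓝 (chartAt ℂ (f p) (f p)) :=
    h1 (Filter.image_mem_map (Filter.inter_mem ((isOpen_chartDomain hf.continuous p).mem_nhds
      (chart_self_mem_chartDomain f p)) (tendsto_chart_symm p hs')))
  filter_upwards [tendsto_chart (f p) h2, (chartAt ℂ (f p)).open_source.mem_nhds
    (mem_chart_source ℂ (f p))] with q hq hqs
  obtain ⟨y, ⟨hy, hys⟩, hyq⟩ := hq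
  have : f ((chartAt ℂ p).symm y) = q := (chartAt ℂ (f p)).injOn hy.2 hqs hyq
  rw [← this]
  exact hys

/-- The critical points of a holomorphic map are isolated. -/
theorem eventually_deriv_chartRep_ne_zero (hf : MDifferentiable 𝓘(ℂ) 𝓘(ℂ) f) {p : C}
    (h : ¬ ∀ᶠ q in 𝓝 p, f q = f p) :
    ∀ᶠ y in 𝓝[≠] (chartAt ℂ p p), deriv (chartRep f p) y ≠ 0 := by
  have han := analyticAt_chartRep hf (chart_self_mem_chartDomain f p)
  refine han.deriv.eventually_eq_zero_or_eventually_ne_zero.resolve_left fun h0 => ?_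
  refine not_eventually_chartRep_eq hf.continuous h ?_
  -- If the derivative vanished on a neighbourhood, the chart expression would be constant on a
  -- ball.
  obtain ⟨r, hr, hrs⟩ := Metric.mem_nhds_iff.1 (h0.and
    ((isOpen_chartDomain hf.continuous p).mem_nhds (chart_self_mem_chartDomain f p)))
  filter_upwards [Metric.ball_mem_nhds _ hr] with y hy
  refine (convex_ball (chartAt ℂ p p) r).is_const_of_fderivWithin_eq_zero (𝕜 := ℂ)
    ((differentiableOn_chartRep hf p).mono fun z hz => (hrs hz).2) (fun z hz => ?_) hy
    (Metric.mem_ball_self hr)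
  rw [fderivWithin_of_isOpen Metric.isOpen_ball hz]
  ext
  have : deriv (chartRep f p) z = 0 := (hrs hz).1
  simpa using this

theorem exists_injOn_of_deriv_ne_zero {h : ℂ → ℂ} {y : ℂ} (hh : AnalyticAt ℂ h y)
    (h0 : deriv h y ≠ 0) : ∃ D ∈ 𝓝 y, InjOn h D := by
  have hs := (hh.hasStrictDerivAt).hasStrictFDerivAt_equiv h0
  exact ⟨_, (hs.toOpenPartialHomeomorph h).open_source.mem_nhds
    hs.mem_toOpenPartialHomeomorph_source, (hs.toOpenPartialHomeomorph h).injOn⟩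

/-- Away from isolated points, a holomorphic map is locally injective. -/
theorem eventually_exists_injOn (hf : MDifferentiable 𝓘(ℂ) 𝓘(ℂ) f) {p : C}
    (h : ¬ ∀ᶠ q in 𝓝 p, f q = f p) : ∀ᶠ q in 𝓝[≠] p, ∃ D ∈ 𝓝 q, InjOn f D := by
  have h1 := eventually_nhdsWithin_iff.1 (eventually_deriv_chartRep_ne_zero hf h)
  rw [eventually_nhdsWithin_iff]
  filter_upwards [tendsto_chart p h1, eventually_mem_source hf.continuous p] with q hq hqs hqp
  have hy : chartAt ℂ p q ∈ chartDomain f p := chart_mem_chartDomain f hqs.1 hqs.2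
  have hne : chartAt ℂ p q ≠ chartAt ℂ p p := fun he =>
    hqp ((chartAt ℂ p).injOn hqs.1 (mem_chart_source ℂ p) he)
  obtain ⟨D, hD, hinj⟩ := exists_injOn_of_deriv_ne_zero (analyticAt_chartRep hf hy) (hq hne)
  refine ⟨(chartAt ℂ p).source ∩ chartAt ℂ p ⁻¹' D, Filter.inter_mem
    ((chartAt ℂ p).open_source.mem_nhds hqs.1) ((chartAt ℂ p).continuousAt hqs.1 hD), ?_⟩
  intro a ha b hb hab
  refine (chartAt ℂ p).injOn ha.1 hb.1 (hinj ha.2 hb.2 ?_)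
  rw [chartRep_chart f ha.1, chartRep_chart f hb.1, hab]

/-- A bijective holomorphic map between compact Riemann surfaces is biholomorphic. -/
theorem exists_diffeomorph_of_bijective [CompactSpace C] [T2Space C'] [PreconnectedSpace C]
    (hf : MDifferentiable 𝓘(ℂ) 𝓘(ℂ) f) (hb : Function.Bijective f)
    (hnc : ¬ ∃ w, ∀ q, f q = w) : ∃ φ : C ≃ₘ^∞⟮𝓘(ℂ), 𝓘(ℂ)⟯ C', ∀ p, φ p = f p := by
  set F := Equiv.ofBijective f hb with hF
  have hcF : Continuous F := hf.continuous
  have hcinv : Continuous F.symm := (hcF.homeoOfEquivCompactToT2).symm.continuous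
  have hinv : MDifferentiable 𝓘(ℂ) 𝓘(ℂ) F.symm := by
    intro w
    obtain ⟨p, rfl⟩ := F.surjective w
    have hFp : F.symm (F p) = p := F.symm_apply_apply p
    have hfp : F p = f p := rfl
    set k : ℂ → ℂ := fun y => chartAt ℂ p (F.symm ((chartAt ℂ (f p)).symm y)) with hk
    set y₀ := chartAt ℂ (f p) (f p) with hy₀
    have hky₀ : k y₀ = chartAt ℂ p p := by
      simp only [hk, hy₀]
      rw [(chartAt ℂ (f p)).left_inv (mem_chart_source ℂ (f p)), ← hfp, hFp]
    have ht : Filter.Tendsto (fun y => F.symm ((chartAt ℂ (f p)).symm y)) (𝓝 y₀) (𝓝 p) := by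
      have := (hcinv.tendsto (f p)).comp (tendsto_chart_symm (f p))
      rwa [← hfp, hFp] at this
    have hev : ∀ᶠ y in 𝓝 y₀, y ∈ (chartAt ℂ (f p)).target ∧
        F.symm ((chartAt ℂ (f p)).symm y) ∈ (chartAt ℂ p).source :=
      Filter.inter_mem ((chartAt ℂ (f p)).open_target.mem_nhds (mem_chart_target ℂ (f p)))
        (ht ((chartAt ℂ p).open_source.mem_nhds (mem_chart_source ℂ p)))
    have hleft : ∀ y, y ∈ (chartAt ℂ (f p)).target →
        F.symm ((chartAt ℂ (f p)).symm y) ∈ (chartAt ℂ p).source → chartRep f p (k y) = y := by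
      intro y hy hys
      rw [hk, chartRep_chart f hys]
      change chartAt ℂ (f p) (F (F.symm _)) = y
      rw [F.apply_symm_apply, (chartAt ℂ (f p)).right_inv hy]
    have hkc : ∀ y, y ∈ (chartAt ℂ (f p)).target →
        F.symm ((chartAt ℂ (f p)).symm y) ∈ (chartAt ℂ p).source → ContinuousAt k y := by
      intro y hy hys
      have h1 : ContinuousAt (fun y => F.symm ((chartAt ℂ (f p)).symm y)) y :=
        hcinv.continuousAt.comp (f := (chartAt ℂ (f p)).symm)
          ((chartAt ℂ (f p)).continuousAt_symm hy)
      exact ContinuousAt.comp (g := chartAt ℂ p) ((chartAt ℂ p).continuousAt hys) h1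
    have hne := eventually_nhdsWithin_iff.1 (eventually_deriv_chartRep_ne_zero hf
      (not_eventually_eq_of_not_const hf hnc p))
    rw [← hky₀] at hne
    have hkcont : ContinuousAt k y₀ := hkc y₀ hev.self_of_nhds.1 hev.self_of_nhds.2
    -- `p` may still be a critical point. It is an isolated one, so the inverse is differentiable on
    -- a punctured neighbourhood, and continuity removes the singularity.
    have han : AnalyticAt ℂ k y₀ := by
      refine Complex.analyticAt_of_differentiable_on_punctured_nhds_of_continuousAt ?_ hkcont
      rw [eventually_nhdsWithin_iff]
      filter_upwards [hev.eventually_nhds, hkcont hne] with y hy hyne hyy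
      have hy1 := hy.self_of_nhds
      have hkne : k y ≠ k y₀ := fun he => hyy <| by
        rw [mem_singleton_iff, ← hleft y hy1.1 hy1.2, he,
          hleft y₀ hev.self_of_nhds.1 hev.self_of_nhds.2]
      have hdom : k y ∈ chartDomain f p := by
        refine chart_mem_chartDomain f hy1.2 ?_
        change F (F.symm _) ∈ _
        rw [F.apply_symm_apply]
        exact (chartAt ℂ (f p)).map_target hy1.1
      exact (HasDerivAt.of_local_left_inverse (hkc y hy1.1 hy1.2)
        (analyticAt_chartRep hf hdom).differentiableAt.hasDerivAt (hyne hkne)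
        (hy.mono fun z hz => hleft z hz.1 hz.2)).differentiableAt
    rw [mdifferentiableAt_iff]
    refine ⟨hcinv.continuousAt, DifferentiableAt.differentiableWithinAt ?_⟩
    have : writtenInExtChartAt 𝓘(ℂ) 𝓘(ℂ) (F p) F.symm = k := by
      funext y
      simp only [writtenInExtChartAt, hFp, hk]
      rfl
    rw [this]
    exact han.differentiableAt
  exact ⟨⟨F, contMDiff_of_mdifferentiable hf, contMDiff_of_mdifferentiable hinv⟩, fun p => rfl⟩

end RiemannSurfaces

/-! ## Holomorphic maps of degree one -/

section Degree

variable {C C' : Type*} [TopologicalSpace C] [ChartedSpace ℂ C] [TopologicalSpace C']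
  [ChartedSpace ℂ C'] {f : C → C'}

theorem isNonnegForm_pullback {E H : Type*} [NormedAddCommGroup E] [NormedSpace ℝ E]
    [TopologicalSpace H] {I : ModelWithCorners ℝ E H} {M : Type*} [TopologicalSpace M]
    [ChartedSpace H M] {J : EndoField I M} {η : DForm I M 2} (hη : ∀ x v, 0 ≤ η x ![v, J x v])
    {u : C → M} (hu : ∀ (p : C) (v : TangentSpace 𝓘(ℝ, ℂ) p),
      mfderiv 𝓘(ℝ, ℂ) I u p (complexJ C p v) = J (u p) (mfderiv 𝓘(ℝ, ℂ) I u p v)) :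
    IsNonnegForm (pullback 𝓘(ℝ, ℂ) I u η) := by
  intro p v
  refine (hη (u p) (mfderiv 𝓘(ℝ, ℂ) I u p v)).trans_eq ?_
  change _ = η (u p) (mfderiv 𝓘(ℝ, ℂ) I u p ∘ ![v, complexJ C p v])
  congr 1
  funext i
  fin_cases i
  · rfl
  · exact (hu p v).symm

theorem mfderiv_complexJ_of_mdifferentiable (hf : MDifferentiable 𝓘(ℂ) 𝓘(ℂ) f) (p : C)
    (v : TangentSpace 𝓘(ℝ, ℂ) p) : mfderiv 𝓘(ℝ, ℂ) 𝓘(ℝ, ℂ) f p (complexJ C p v) =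
      complexJ C' (f p) (mfderiv 𝓘(ℝ, ℂ) 𝓘(ℝ, ℂ) f p v) :=
  realDeriv_I_smul (hf p) v

theorem mdifferentiable_of_mfderiv_complexJ (hf : MDifferentiable 𝓘(ℝ, ℂ) 𝓘(ℝ, ℂ) f)
    (h : ∀ (p : C) (v : TangentSpace 𝓘(ℝ, ℂ) p),
      mfderiv 𝓘(ℝ, ℂ) 𝓘(ℝ, ℂ) f p (complexJ C p v) =
        complexJ C' (f p) (mfderiv 𝓘(ℝ, ℂ) 𝓘(ℝ, ℂ) f p v)) : MDifferentiable 𝓘(ℂ) 𝓘(ℂ) f :=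
  fun p => mdifferentiableAt_complex_of_real (hf p) (h p)

variable [IsManifold 𝓘(ℂ) ∞ C] [IsManifold 𝓘(ℂ) ∞ C']

/-- The chart expression of `f` is holomorphic, so its derivative is multiplication by a complex
number and scales area by the squared modulus. This is the integrand in
`integral_image_holomorphic`. -/
theorem chartForm_pullback (hf : MDifferentiable 𝓘(ℂ) 𝓘(ℂ) f) (θ : DForm 𝓘(ℝ, ℂ) C' 2) (p : C)
    {y : ℂ} (hy : y ∈ chartDomain f p) :
    chartForm 𝓘(ℝ, ℂ) (pullback 𝓘(ℝ, ℂ) 𝓘(ℝ, ℂ) f θ) p y ![1, Complex.I] =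
      ‖deriv (chartRep f p) y‖ ^ 2 *
        chartForm 𝓘(ℝ, ℂ) θ (f p) (chartRep f p y) ![1, Complex.I] := by
  have := isManifold_real_of_complex C
  have := isManifold_real_of_complex C'
  have hsy : MDifferentiableAt 𝓘(ℝ, ℂ) 𝓘(ℝ, ℂ) (chartAt ℂ p).symm y :=
    mdifferentiableAt_real_of_complex (mdifferentiableAt_chart_symm p hy.1)
  have hfy : MDifferentiableAt 𝓘(ℝ, ℂ) 𝓘(ℝ, ℂ) f ((chartAt ℂ p).symm y) :=
    mdifferentiableAt_real_of_complex (hf _)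
  have h1 : chartForm 𝓘(ℝ, ℂ) (pullback 𝓘(ℝ, ℂ) 𝓘(ℝ, ℂ) f θ) p y =
      pullbackOn 𝓘(ℝ, ℂ) (chartAt ℂ p).symm univ (pullback 𝓘(ℝ, ℂ) 𝓘(ℝ, ℂ) f θ) y := by
    refine Eq.trans rfl (pullbackOn_congr_set _ _ (s := range 𝓘(ℝ, ℂ)) ?_)
    simp
  have h2 := pullbackOn_pullback 𝓘(ℝ, ℂ) θ (g := (chartAt ℂ p).symm) (s := univ) (z := y)
    uniqueDiffWithinAt_univ hfy hsy.mdifferentiableWithinAt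
  have hbase : (f ∘ (chartAt ℂ p).symm) (chartAt ℂ p p) = f p :=
    congrArg f ((chartAt ℂ p).left_inv (mem_chart_source ℂ p))
  have h3 := pullbackOn_eq_comp_chartForm θ (g := f ∘ (chartAt ℂ p).symm) (s := univ)
    (z₀ := chartAt ℂ p p) (z := y) uniqueDiffWithinAt_univ
    (MDifferentiableAt.comp (g := f) y hfy hsy).mdifferentiableWithinAt (by
      rw [hbase, extChartAt_source]
      exact hy.2)
  have hcoord : coordMap 𝓘(ℝ, ℂ) (f ∘ (chartAt ℂ p).symm) (chartAt ℂ p p) = chartRep f p := by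
    unfold coordMap
    rw [hbase]
    rfl
  rw [hcoord, hbase] at h3
  have hd : fderivWithin ℝ (chartRep f p) univ y =
      (ContinuousLinearMap.toSpanSingleton ℂ (deriv (chartRep f p) y)).restrictScalars ℝ := by
    rw [fderivWithin_univ]
    exact ((analyticAt_chartRep hf hy).differentiableAt.hasDerivAt.hasFDerivAt.restrictScalars
      ℝ).fderiv
  rw [h1, h2, h3, hd, ← alternating_self_I_mul]
  change chartForm 𝓘(ℝ, ℂ) θ (f p) (chartRep f p y) (_ ∘ ![1, Complex.I]) = _
  congr 1
  funext i
  fin_cases i <;> simp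

variable {c : Chain 𝓘(ℝ, ℂ) C ℤ 2} {e : Chain 𝓘(ℝ, ℂ) C' ℤ 2}

/-- A sheet of a holomorphic map over a set contributes the integral of a form supported there. -/
theorem chainIntegral_sheet (hc : IsFundamentalCycle c) (he : IsFundamentalCycle e)
    (hf : MDifferentiable 𝓘(ℂ) 𝓘(ℂ) f) (hfr : ContMDiff 𝓘(ℝ, ℂ) 𝓘(ℝ, ℂ) ∞ f) {p : C} {D : Set C}
    (hD : IsOpen D) (hDs : D ⊆ (chartAt ℂ p).source)
    (hDf : ∀ q ∈ D, f q ∈ (chartAt ℂ (f p)).source) (hinj : InjOn f D) {κ : C → ℝ}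
    (hκ : ContMDiff 𝓘(ℝ, ℂ) 𝓘(ℝ) ∞ κ) (hκD : tsupport κ ⊆ D) {θ : DForm 𝓘(ℝ, ℂ) C' 2}
    (hθ : IsSmoothForm 𝓘(ℝ, ℂ) θ) (hsupp : closure {x | θ x ≠ 0} ⊆ (chartAt ℂ (f p)).source)
    (hθD : ∀ w, θ w ≠ 0 → ∃ q ∈ D, f q = w ∧ κ q = 1) :
    chainIntegral 𝓘(ℝ, ℂ) (fun x => κ x • pullback 𝓘(ℝ, ℂ) 𝓘(ℝ, ℂ) f θ x) c =
      chainIntegral 𝓘(ℝ, ℂ) θ e := by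
  have := isManifold_real_of_complex C
  have := isManifold_real_of_complex C'
  rw [hc.integral_eq p _ (isSmoothForm_smul hκ (isSmoothForm_pullback 𝓘(ℝ, ℂ) hθ hfr))
    (((closure_support_smul_subset _ _).trans hκD).trans hDs), he.integral_eq (f p) θ hθ hsupp]
  set T : Set ℂ := (chartAt ℂ p).target ∩ (chartAt ℂ p).symm ⁻¹' D with hT
  have hTo : IsOpen T := (chartAt ℂ p).isOpen_inter_preimage_symm hD
  have hTd : T ⊆ chartDomain f p := fun y hy => ⟨hy.1, hDf _ hy.2⟩
  have hTinj : InjOn (chartRep f p) T := by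
    intro y hy y' hy' h
    exact (chartAt ℂ p).symm.injOn hy.1 hy'.1 (hinj hy.2 hy'.2
      ((chartAt ℂ (f p)).injOn (hDf _ hy.2) (hDf _ hy'.2) h))
  have hzero : ∀ (w : ℂ), θ ((chartAt ℂ (f p)).symm w) = 0 →
      chartForm 𝓘(ℝ, ℂ) θ (f p) w ![1, Complex.I] = 0 := by
    intro w hw
    rw [chartForm_apply, hw]
    rfl
  have h1 : ∫ y in (chartAt ℂ p).target,
      chartForm 𝓘(ℝ, ℂ) (fun x => κ x • pullback 𝓘(ℝ, ℂ) 𝓘(ℝ, ℂ) f θ x) p y ![1, Complex.I] =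
      ∫ y in T, ‖deriv (chartRep f p) y‖ ^ 2 *
        chartForm 𝓘(ℝ, ℂ) θ (f p) (chartRep f p y) ![1, Complex.I] := by
    have hval : ∀ y, chartForm 𝓘(ℝ, ℂ) (fun x => κ x • pullback 𝓘(ℝ, ℂ) 𝓘(ℝ, ℂ) f θ x) p y
        ![1, Complex.I] = κ ((chartAt ℂ p).symm y) *
          chartForm 𝓘(ℝ, ℂ) (pullback 𝓘(ℝ, ℂ) 𝓘(ℝ, ℂ) f θ) p y ![1, Complex.I] := fun y => rfl
    -- Outside `T` the cut-off vanishes. Inside, wherever the pulled-back form is non-zero the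
    -- cut-off equals 1, because injectivity on `D` identifies the point with the one supplied by
    -- `hθD`.
    rw [setIntegral_eq_of_subset_of_forall_sdiff_eq_zero
      (chartAt ℂ p).open_target.measurableSet (inter_subset_left : T ⊆ _)]
    · refine setIntegral_congr_fun hTo.measurableSet fun y hy => ?_
      simp only [hval]
      rw [chartForm_pullback hf θ p (hTd hy)]
      by_cases h0 : θ (f ((chartAt ℂ p).symm y)) = 0
      · have : (chartAt ℂ (f p)).symm (chartRep f p y) = f ((chartAt ℂ p).symm y) :=
          (chartAt ℂ (f p)).left_inv (hDf _ hy.2)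
        rw [hzero (chartRep f p y) (by rw [this, h0])]
        simp
      · obtain ⟨q, hq, hfq, hκq⟩ := hθD _ h0
        rw [← hinj hq hy.2 hfq, hκq, one_mul]
    · rintro y ⟨hy, hyT⟩
      have hyD : (chartAt ℂ p).symm y ∉ D := fun h => hyT ⟨hy, h⟩
      rw [hval, image_eq_zero_of_notMem_tsupport fun h => hyD (hκD h), zero_mul]
  rw [h1, ← integral_image_holomorphic hTo.measurableSet
    (fun y hy => (analyticAt_chartRep hf (hTd hy)).differentiableAt.hasDerivAt) hTinj
    (fun w => chartForm 𝓘(ℝ, ℂ) θ (f p) w ![1, Complex.I])]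
  refine (setIntegral_eq_of_subset_of_forall_sdiff_eq_zero
    (chartAt ℂ (f p)).open_target.measurableSet ?_ ?_).symm
  · rintro _ ⟨y, hy, rfl⟩
    exact (chartAt ℂ (f p)).map_source (hDf _ hy.2)
  · rintro w ⟨hw, hwT⟩
    refine hzero w ?_
    by_contra h0
    obtain ⟨q, hq, hfq, -⟩ := hθD _ h0
    refine hwT ⟨chartAt ℂ p q, ⟨(chartAt ℂ p).map_source (hDs hq), ?_⟩, ?_⟩
    · rwa [mem_preimage, (chartAt ℂ p).left_inv (hDs hq)]
    · rw [chartRep_chart f (hDs hq), hfq, (chartAt ℂ (f p)).right_inv hw]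

end Degree

/-! ### Holomorphic maps of degree one to the projective line -/

section DegreeOne

variable {C : Type*} [TopologicalSpace C] [ChartedSpace ℂ C] {f : C → CP1} {c : Chain 𝓘(ℝ, ℂ) C ℤ 2}
  {e : Chain 𝓘(ℝ, ℂ) CP1 ℤ 2}

theorem CP1.fubiniStudy_ne_zero (p : CP1) : CP1.fubiniStudy p ≠ 0 := by
  intro h
  have h1 : CP1.density (chartAt ℂ p p) * CP1.areaForm ![1, Complex.I * 1] = 0 := by
    rw [← CP1.fubiniStudy_apply, h]
    rfl
  rw [areaForm_self_I_mul] at h1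
  have := CP1.density_pos (chartAt ℂ p p)
  simp at h1
  linarith

/-- Together with connectedness this ensures that points are not isolated, which is used to avoid
critical values. -/
instance : Nontrivial CP1 := ⟨⟨CP1.coe 0, CP1.infty, CP1.coe_ne_infty 0⟩⟩

/-- The pull-back of the Fubini–Study form under a constant map vanishes, whereas the form has area
π. -/
theorem not_const_of_degree_one [Nonempty C] (he : IsFundamentalCycle e)
    (hdeg : ∀ θ : DForm 𝓘(ℝ, ℂ) CP1 2, IsSmoothForm 𝓘(ℝ, ℂ) θ →
      chainIntegral 𝓘(ℝ, ℂ) (pullback 𝓘(ℝ, ℂ) 𝓘(ℝ, ℂ) f θ) c = chainIntegral 𝓘(ℝ, ℂ) θ e) :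
    ¬ ∃ w, ∀ q, f q = w := by
  rintro ⟨w, hw⟩
  have h1 := hdeg _ CP1.isSmoothForm_fubiniStudy
  have h2 : f = fun _ => w := funext hw
  have h3 : pullback 𝓘(ℝ, ℂ) 𝓘(ℝ, ℂ) f CP1.fubiniStudy = (0 : ℝ) •
      pullback 𝓘(ℝ, ℂ) 𝓘(ℝ, ℂ) f CP1.fubiniStudy := by
    rw [zero_smul]
    funext p
    have h4 : mfderiv 𝓘(ℝ, ℂ) 𝓘(ℝ, ℂ) f p = 0 := by
      rw [h2]
      exact mfderiv_const
    refine ContinuousAlternatingMap.ext fun v => ?_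
    refine (CP1.fubiniStudy (f p)).map_coord_zero 0 ?_
    exact congrArg (fun L : ℂ →L[ℝ] ℂ => L (v 0)) h4
  rw [h3, chainIntegral_smul_form, zero_mul, CP1.chainIntegral_fubiniStudy he] at h1
  exact Real.pi_ne_zero h1.symm

variable [IsManifold 𝓘(ℂ) ∞ C] [CompactSpace C] [T2Space C]

/-- Two points with the same value yield, by openness, two disjoint injective sheets over a
neighbourhood of some value `w`. A bump form θ at `w` is counted once by each sheet, and the
remainder of its pull-back is non-negative. Degree one then gives ∫θ ≥ 2∫θ, although ∫θ is positive.
-/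
theorem injective_of_degree_one [PreconnectedSpace C] [Nonempty C] (hc : IsFundamentalCycle c)
    (he : IsFundamentalCycle e) (hf : MDifferentiable 𝓘(ℂ) 𝓘(ℂ) f)
    (hfr : ContMDiff 𝓘(ℝ, ℂ) 𝓘(ℝ, ℂ) ∞ f)
    (hdeg : ∀ θ : DForm 𝓘(ℝ, ℂ) CP1 2, IsSmoothForm 𝓘(ℝ, ℂ) θ →
      chainIntegral 𝓘(ℝ, ℂ) (pullback 𝓘(ℝ, ℂ) 𝓘(ℝ, ℂ) f θ) c = chainIntegral 𝓘(ℝ, ℂ) θ e) :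
    Function.Injective f := by
  have := isManifold_real_of_complex C
  have hloc := not_eventually_eq_of_not_const hf (not_const_of_degree_one he hdeg)
  intro p₁ p₂ hp
  by_contra hne
  obtain ⟨U₁, U₂, hU₁, hU₂, hp₁, hp₂, hdis⟩ := t2_separation hne
  have hR : ∀ (p : C) (U : Set C), IsOpen U → p ∈ U →
      f '' {q | q ∈ U ∧ (q = p ∨ ∃ D ∈ 𝓝 q, InjOn f D)} ∈ 𝓝 (f p) := by
    intro p U hU hpU
    refine nhds_le_map_of_not_eventually_eq hf (hloc p) (Filter.image_mem_map ?_)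
    filter_upwards [hU.mem_nhds hpU,
      eventually_nhdsWithin_iff.1 (eventually_exists_injOn hf (hloc p))] with q hq hq'
    exact ⟨hq, or_iff_not_imp_left.2 hq'⟩
  have hR₂ := hR p₂ U₂ hU₂ hp₂
  rw [← hp] at hR₂
  -- The two given points may be critical. Taking `w` different from their common value forces the
  -- preimages `q₁` and `q₂` to be different from them, hence locally injective.
  obtain ⟨w, ⟨⟨q₁, ⟨hq₁, hq₁'⟩, hw₁⟩, q₂, ⟨hq₂, hq₂'⟩, hw₂⟩, hw⟩ :=
    (mem_closure_iff_nhdsWithin_neBot.1 (mem_closure_iff_nhdsWithin_neBot.2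
      (inferInstance : (𝓝[≠] f p₁).NeBot))).nonempty_of_mem
      (Filter.inter_mem (mem_nhdsWithin_of_mem_nhds (Filter.inter_mem (hR p₁ U₁ hU₁ hp₁) hR₂))
        self_mem_nhdsWithin)
  have hi₁ := hq₁'.resolve_left fun h => hw (by rw [mem_singleton_iff, ← hw₁, h])
  have hi₂ := hq₂'.resolve_left fun h => hw (by rw [mem_singleton_iff, ← hw₂, h, hp])
  have key : ∀ (q : C) (U : Set C), IsOpen U → q ∈ U → (∃ D ∈ 𝓝 q, InjOn f D) →
      ∃ (D : Set C) (κ : C → ℝ), IsOpen D ∧ D ⊆ U ∧ D ⊆ (chartAt ℂ q).source ∧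
        (∀ r ∈ D, f r ∈ (chartAt ℂ (f q)).source) ∧ InjOn f D ∧
        ContMDiff 𝓘(ℝ, ℂ) 𝓘(ℝ) ∞ κ ∧ tsupport κ ⊆ D ∧ (∀ r, κ r ≤ 1) ∧
        {w | ∃ r ∈ D, f r = w ∧ κ r = 1} ∈ 𝓝 (f q) := by
    rintro q U hU hqU ⟨D₀, hD₀, hinj⟩
    obtain ⟨D, hDs, hDo, hqD⟩ := mem_nhds_iff.1 (Filter.inter_mem (Filter.inter_mem hD₀
      (hU.mem_nhds hqU)) (eventually_mem_source hf.continuous q))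
    obtain ⟨κ, -, hκ⟩ := (SmoothBumpFunction.nhds_basis_tsupport (I := 𝓘(ℝ, ℂ)) q).mem_iff.1
      (hDo.mem_nhds hqD)
    refine ⟨D, κ, hDo, fun r hr => (hDs hr).1.2, fun r hr => (hDs hr).2.1,
      fun r hr => (hDs hr).2.2, hinj.mono fun r hr => (hDs hr).1.1, κ.contMDiff, hκ,
      fun r => κ.le_one, ?_⟩
    refine Filter.mem_of_superset (nhds_le_map_of_not_eventually_eq hf (hloc q)
      (Filter.image_mem_map (Filter.inter_mem (hDo.mem_nhds hqD) κ.eventuallyEq_one))) ?_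
    rintro _ ⟨r, ⟨hr, hr1⟩, rfl⟩
    exact ⟨r, hr, rfl, hr1⟩
  obtain ⟨D₁, κ₁, hD₁, hDU₁, hDs₁, hDf₁, hinj₁, hκ₁, hκD₁, hκ1₁, hn₁⟩ := key q₁ U₁ hU₁ hq₁ hi₁
  obtain ⟨D₂, κ₂, hD₂, hDU₂, hDs₂, hDf₂, hinj₂, hκ₂, hκD₂, hκ1₂, hn₂⟩ := key q₂ U₂ hU₂ hq₂ hi₂
  rw [hw₁] at hn₁ hDf₁
  rw [hw₂] at hn₂ hDf₂
  obtain ⟨χ, -, hχ⟩ := (SmoothBumpFunction.nhds_basis_tsupport (I := 𝓘(ℝ, ℂ)) w).mem_iff.1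
    (Filter.inter_mem hn₁ hn₂)
  set θ : DForm 𝓘(ℝ, ℂ) CP1 2 := fun x => χ x • CP1.fubiniStudy x with hθ
  have hχs : ContMDiff 𝓘(ℝ, ℂ) 𝓘(ℝ) ∞ χ := χ.contMDiff
  have hθs : IsSmoothForm 𝓘(ℝ, ℂ) θ := isSmoothForm_smul hχs CP1.isSmoothForm_fubiniStudy
  have hθn : IsNonnegForm θ := fun x v => mul_nonneg χ.nonneg (CP1.isNonnegForm_fubiniStudy x v)
  have hθsupp : closure {x | θ x ≠ 0} ⊆ (chartAt ℂ w).source :=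
    (closure_support_smul_subset _ _).trans χ.tsupport_subset_chartAt_source
  have hθD : ∀ x, θ x ≠ 0 → x ∈ tsupport χ := fun x hx =>
    closure_support_smul_subset χ CP1.fubiniStudy (subset_closure hx)
  have h₁ := chainIntegral_sheet hc he hf hfr (p := q₁) hD₁ hDs₁ (by rwa [hw₁]) hinj₁ hκ₁ hκD₁ hθs
    (by rwa [hw₁]) fun x hx => (hχ (hθD x hx)).1
  have h₂ := chainIntegral_sheet hc he hf hfr (p := q₂) hD₂ hDs₂ (by rwa [hw₂]) hinj₂ hκ₂ hκD₂ hθs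
    (by rwa [hw₂]) fun x hx => (hχ (hθD x hx)).2
  set η := pullback 𝓘(ℝ, ℂ) 𝓘(ℝ, ℂ) f θ with hη
  have hηs : IsSmoothForm 𝓘(ℝ, ℂ) η := isSmoothForm_pullback 𝓘(ℝ, ℂ) hθs hfr
  have hηn : IsNonnegForm η := isNonnegForm_pullback hθn (mfderiv_complexJ_of_mdifferentiable hf)
  have hκ₃ : ContMDiff 𝓘(ℝ, ℂ) 𝓘(ℝ) ∞ fun q => 1 - κ₁ q - κ₂ q :=
    (contMDiff_const.sub hκ₁).sub hκ₂
  -- The sheets are disjoint, so at most one of the cut-offs is non-zero at any point.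
  have hκ₃n : ∀ q, 0 ≤ 1 - κ₁ q - κ₂ q := by
    intro q
    by_cases hq : q ∈ D₁
    · have : κ₂ q = 0 := image_eq_zero_of_notMem_tsupport fun h =>
        disjoint_left.1 hdis (hDU₁ hq) (hDU₂ (hκD₂ h))
      rw [this, sub_zero]
      exact sub_nonneg.2 (hκ1₁ q)
    · have : κ₁ q = 0 := image_eq_zero_of_notMem_tsupport fun h => hq (hκD₁ h)
      rw [this, sub_zero]
      exact sub_nonneg.2 (hκ1₂ q)
  have hsum : η = ((fun q => κ₁ q • η q) + fun q => κ₂ q • η q) +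
      fun q => (1 - κ₁ q - κ₂ q) • η q := by
    funext q
    change η q = (κ₁ q • η q + κ₂ q • η q) + (1 - κ₁ q - κ₂ q) • η q
    rw [← add_smul, ← add_smul]
    ring_nf
    rw [one_smul]
  have hs₁ := isSmoothForm_smul hκ₁ hηs
  have hs₂ := isSmoothForm_smul hκ₂ hηs
  have hs₃ := isSmoothForm_smul hκ₃ hηs
  have hpos := chainIntegral_nonneg hc hs₃ fun q v => mul_nonneg (hκ₃n q) (hηn q v)
  have htot := hdeg θ hθs
  rw [← hη, hsum, chainIntegral_add_form _ (isSmoothForm_add hs₁ hs₂) hs₃,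
    chainIntegral_add_form _ hs₁ hs₂, h₁, h₂] at htot
  have hθpos := chainIntegral_nonneg he hθs hθn
  have hz := eq_zero_of_chainIntegral_eq_zero he hθs hθn (by linarith) w
  have : CP1.fubiniStudy w = 0 := by
    rw [hθ] at hz
    simpa [χ.eq_one] using hz
  exact CP1.fubiniStudy_ne_zero w this

/-- A holomorphic map of degree one to the complex projective line is biholomorphic. -/
theorem exists_diffeomorph_of_degree_one [PreconnectedSpace C] [Nonempty C]
    (hc : IsFundamentalCycle c) (he : IsFundamentalCycle e)
    (hf : MDifferentiable 𝓘(ℂ) 𝓘(ℂ) f) (hfr : ContMDiff 𝓘(ℝ, ℂ) 𝓘(ℝ, ℂ) ∞ f)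
    (hdeg : ∀ θ : DForm 𝓘(ℝ, ℂ) CP1 2, IsSmoothForm 𝓘(ℝ, ℂ) θ →
      chainIntegral 𝓘(ℝ, ℂ) (pullback 𝓘(ℝ, ℂ) 𝓘(ℝ, ℂ) f θ) c = chainIntegral 𝓘(ℝ, ℂ) θ e) :
    ∃ φ : C ≃ₘ^∞⟮𝓘(ℂ), 𝓘(ℂ)⟯ CP1, ∀ p, φ p = f p := by
  have hnc := not_const_of_degree_one he hdeg
  refine exists_diffeomorph_of_bijective hf ⟨injective_of_degree_one hc he hf hfr hdeg, ?_⟩ hnc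
  -- The image is open, and closed by compactness, hence all of the connected space `CP1`.
  have hopen : IsOpenMap f := isOpenMap_iff_nhds_le.2 fun p =>
    nhds_le_map_of_not_eventually_eq hf (not_eventually_eq_of_not_const hf hnc p)
  rw [← range_eq_univ]
  exact IsClopen.eq_univ ⟨(isCompact_range hf.continuous).isClosed, hopen.isOpen_range⟩
    (range_nonempty f)

end DegreeOne

/-! ## Holomorphic curves in products -/

section Products

variable {E H : Type*} [NormedAddCommGroup E] [NormedSpace ℝ E] [TopologicalSpace H]
  {I : ModelWithCorners ℝ E H} {M : Type*} [TopologicalSpace M] [ChartedSpace H M]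
  {E' H' : Type*} [NormedAddCommGroup E'] [NormedSpace ℝ E'] [TopologicalSpace H']
  {I' : ModelWithCorners ℝ E' H'} {M' : Type*} [TopologicalSpace M'] [ChartedSpace H' M']
  {E₀ H₀ : Type*} [NormedAddCommGroup E₀] [NormedSpace ℝ E₀] [TopologicalSpace H₀]
  {I₀ : ModelWithCorners ℝ E₀ H₀} {X : Type*} [TopologicalSpace X] [ChartedSpace H₀ X]
  {C : Type*} [TopologicalSpace C] [ChartedSpace ℂ C]

theorem pullback_sumForm {k : ℕ} (η₁ : DForm I M k) (r : ℝ) (η₂ : DForm I' M' k) {w : X → M × M'}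
    {p : X} (hw : MDifferentiableAt I₀ (I.prod I') w p) :
    pullback I₀ (I.prod I') w (sumForm I I' η₁ r η₂) p =
      pullback I₀ I (fun q => (w q).1) η₁ p + r • pullback I₀ I' (fun q => (w q).2) η₂ p := by
  have h1 := pullback_pullback η₁ (g := Prod.fst) (f := w) (x := p) (I := I₀)
    (I' := I.prod I') mdifferentiableAt_fst hw
  have h2 := pullback_pullback η₂ (g := Prod.snd) (f := w) (x := p) (I := I₀)
    (I' := I.prod I') mdifferentiableAt_snd hw
  exact congrArg₂ (fun a b => a + r • b) h1 h2

theorem pullback_eq_zero {k : ℕ} (η : DForm I M (k + 1)) {w : X → M} {p : X}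
    (hw : mfderiv I₀ I w p = 0) : pullback I₀ I w η p = 0 := by
  refine ContinuousAlternatingMap.ext fun v => (η (w p)).map_coord_zero 0 ?_
  exact congrArg (fun L : E₀ →L[ℝ] E => L (v 0)) hw

theorem pullback_id {k : ℕ} (η : DForm I M k) : pullback I I (fun p => p) η = η := by
  funext p
  refine ContinuousAlternatingMap.ext fun v => ?_
  have h : mfderiv I I (fun p : M => p) p = ContinuousLinearMap.id ℝ (TangentSpace I p) :=
    mfderiv_id
  change η p (mfderiv I I (fun p : M => p) p ∘ v) = η p v
  congr 1
  funext i
  exact congrArg (fun L : E →L[ℝ] E => L (v i)) h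

theorem mfderiv_fst_apply {w : X → M × M'} {p : X} (hw : MDifferentiableAt I₀ (I.prod I') w p)
    (v : TangentSpace I₀ p) : mfderiv I₀ I (fun q => (w q).1) p v =
      (show E × E' from mfderiv I₀ (I.prod I') w p v).1 := by
  have h := mfderiv_comp (g := Prod.fst) (I' := I.prod I') (I'' := I) p mdifferentiableAt_fst hw
  rw [mfderiv_fst] at h
  exact congrArg (fun L : E₀ →L[ℝ] E => L v) h

theorem mfderiv_snd_apply {w : X → M × M'} {p : X} (hw : MDifferentiableAt I₀ (I.prod I') w p)
    (v : TangentSpace I₀ p) : mfderiv I₀ I' (fun q => (w q).2) p v =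
      (show E × E' from mfderiv I₀ (I.prod I') w p v).2 := by
  have h := mfderiv_comp (g := Prod.snd) (I' := I.prod I') (I'' := I') p mdifferentiableAt_snd hw
  rw [mfderiv_snd] at h
  exact congrArg (fun L : E₀ →L[ℝ] E' => L v) h

/-- `u` solves the Cauchy–Riemann equation `Tu ∘ j = J(u) ∘ Tu` at the point `p`. -/
def IsHolomorphicAt (J : EndoField I M) (u : C → M) (p : C) : Prop :=
  ∀ v : TangentSpace 𝓘(ℝ, ℂ) p,
    mfderiv 𝓘(ℝ, ℂ) I u p (complexJ C p v) = J (u p) (mfderiv 𝓘(ℝ, ℂ) I u p v)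

theorem IsHolomorphicAt.fst {J₁ : EndoField I M} {J₂ : EndoField I' M'} {w : C → M × M'} {p : C}
    (h : IsHolomorphicAt (splitJ I I' J₁ J₂) w p)
    (hw : MDifferentiableAt 𝓘(ℝ, ℂ) (I.prod I') w p) :
    IsHolomorphicAt J₁ (fun q => (w q).1) p := fun v =>
  (mfderiv_fst_apply hw _).trans ((congrArg (fun x : E × E' => x.1) (h v)).trans
    (congrArg (J₁ (w p).1) (mfderiv_fst_apply hw v)).symm)

theorem IsHolomorphicAt.snd {J₁ : EndoField I M} {J₂ : EndoField I' M'} {w : C → M × M'} {p : C}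
    (h : IsHolomorphicAt (splitJ I I' J₁ J₂) w p)
    (hw : MDifferentiableAt 𝓘(ℝ, ℂ) (I.prod I') w p) :
    IsHolomorphicAt J₂ (fun q => (w q).2) p := fun v =>
  (mfderiv_snd_apply hw _).trans ((congrArg (fun x : E × E' => x.2) (h v)).trans
    (congrArg (J₂ (w p).2) (mfderiv_snd_apply hw v)).symm)

/-- The Cauchy–Riemann equation for the composition is the image under dF of the equation for `w`,
and dF is injective. -/
theorem isHolomorphicAt_of_comp {J : EndoField I M} {J' : EndoField I' M'} {F : M → M'} {w : C → M}
    {p : C} (hF : MDifferentiableAt I I' F (w p)) (hw : MDifferentiableAt 𝓘(ℝ, ℂ) I w p)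
    (hinj : Function.Injective (mfderiv I I' F (w p)))
    (hJ : ∀ v : TangentSpace I (w p), J' (F (w p)) (mfderiv I I' F (w p) v) =
      mfderiv I I' F (w p) (J (w p) v)) (h : IsHolomorphicAt J' (F ∘ w) p) :
    IsHolomorphicAt J w p := by
  intro v
  have h1 : ∀ v, mfderiv 𝓘(ℝ, ℂ) I' (F ∘ w) p v =
      mfderiv I I' F (w p) (mfderiv 𝓘(ℝ, ℂ) I w p v) := fun v =>
    congrArg (fun L : ℂ →L[ℝ] E' => L v) (mfderiv_comp p hF hw)
  refine hinj ?_
  exact (h1 _).symm.trans ((h v).trans ((congrArg (J' (F (w p))) (h1 v)).trans (hJ _)))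

theorem IsHolomorphicAt.congr {J : EndoField I M} {u u' : C → M} {p : C}
    (h : IsHolomorphicAt J u p) (he : u' =ᶠ[𝓝 p] u) : IsHolomorphicAt J u' p := by
  intro v
  have h1 := h v
  have h2 : u' p = u p := he.self_of_nhds
  have h3 : ∀ v, mfderiv 𝓘(ℝ, ℂ) I u' p v = mfderiv 𝓘(ℝ, ℂ) I u p v := fun v =>
    congrArg (fun L : ℂ →L[ℝ] E => L v) he.mfderiv_eq
  refine (h3 _).trans (h1.trans ?_)
  refine (congrArg (J (u p)) (h3 v).symm).trans ?_
  rw [h2]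

/-- On a holomorphic curve the form measures energy: by positivity it detects every non-zero tangent
vector. This converts vanishing area into constancy. -/
theorem mfderiv_eq_zero_of_pullback_eq_zero {Ω : DForm I M 2} {J : EndoField I M}
    (hJ : ∀ (x : M) (v : TangentSpace I x), v ≠ 0 → 0 < Ω x ![v, J x v]) {u : C → M} {p : C} (hu : IsHolomorphicAt J u p)
    (h0 : pullback 𝓘(ℝ, ℂ) I u Ω p = 0) : mfderiv 𝓘(ℝ, ℂ) I u p = 0 := by
  refine ContinuousLinearMap.ext fun v => ?_
  by_contra hv
  refine (hJ (u p) _ hv).ne' ?_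
  have h1 : pullback 𝓘(ℝ, ℂ) I u Ω p ![v, complexJ C p v] = 0 := by rw [h0]; rfl
  refine Eq.trans ?_ h1
  change Ω (u p) _ = Ω (u p) (mfderiv 𝓘(ℝ, ℂ) I u p ∘ ![v, complexJ C p v])
  congr 1
  funext i
  fin_cases i
  · rfl
  · exact (hu v).symm

theorem nonneg_of_isCompatible {Ω : DForm I M 2} {J : EndoField I M} (hJ : IsCompatible I Ω J)
    (x : M) (v : TangentSpace I x) : 0 ≤ Ω x ![v, J x v] := by
  by_cases hv : v = 0
  · exact ((Ω x).map_coord_zero (m := ![v, J x v]) 0 hv).ge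
  · exact (hJ.positive x v hv).le

end Products

/-! ## The degree of a map to the projective line -/

section DegreeOfMap

variable {C : Type*} [TopologicalSpace C] [ChartedSpace ℂ C] [IsManifold 𝓘(ℂ) ∞ C]

/-- The class of `e` generates the second homology, so the pushed-forward cycle is `m • e` plus a
boundary. Every 2-form on a surface is closed, and Stokes' theorem compares the integrals. -/
theorem exists_degree {c : Chain 𝓘(ℝ, ℂ) C ℤ 2} (hc : boundary 𝓘(ℝ, ℂ) c = 0)
    {e : Chain 𝓘(ℝ, ℂ) CP1 ℤ 2} (he : IsFundamentalCycle e) (f : C^∞⟮𝓘(ℝ, ℂ), C; 𝓘(ℝ, ℂ), CP1⟯) :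
    ∃ m : ℤ, ∀ θ : DForm 𝓘(ℝ, ℂ) CP1 2, IsSmoothForm 𝓘(ℝ, ℂ) θ →
      chainIntegral 𝓘(ℝ, ℂ) (pullback 𝓘(ℝ, ℂ) 𝓘(ℝ, ℂ) f θ) c = m * chainIntegral 𝓘(ℝ, ℂ) θ e := by
  have := isManifold_real_of_complex C
  obtain ⟨m, b, hb⟩ := he.generates (pushforward 𝓘(ℝ, ℂ) 𝓘(ℝ, ℂ) f c) (by
    rw [boundary_pushforward, hc]
    simp [pushforward])
  refine ⟨m, fun θ hθ => ?_⟩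
  have h1 := chainIntegral_boundary 𝓘(ℝ, ℂ) hθ (extD_two_form_eq_zero θ) b
  rw [← hb, ← chainIntegralHom_apply, map_sub, map_zsmul, chainIntegralHom_apply,
    chainIntegralHom_apply, chainIntegral_pushforward, zsmul_eq_mul] at h1
  exact sub_eq_zero.1 h1

end DegreeOfMap

/-! ## Holomorphic spheres that meet the local foliation -/

/-- The collar is closed at 0 and open only at -ε, so a superlevel set is a compact interval. This
prevents the maximum of the collar coordinate from escaping. -/
theorem Collar.isCompact_Ici {ε : ℝ} (c : Collar ε) : IsCompact {a : Collar ε | c.1.1 ≤ a.1.1} := by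
  have hemb : IsEmbedding fun a : Collar ε => (a.1.1 : ℝ) :=
    IsEmbedding.subtypeVal.comp IsEmbedding.subtypeVal
  refine hemb.isCompact_iff.2 ?_
  have : (fun a : Collar ε => (a.1.1 : ℝ)) '' {a : Collar ε | c.1.1 ≤ a.1.1} =
      Icc (c.1.1 : ℝ) 0 := by
    ext t
    constructor
    · rintro ⟨a, ha, rfl⟩
      exact ⟨ha, a.1.2⟩
    · rintro ⟨h1, h2⟩
      have h3 : -ε < (c.1.1 : ℝ) := c.2
      exact ⟨⟨⟨t, h2⟩, show -ε < t by linarith⟩, h1, rfl⟩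
  rw [this]
  exact isCompact_Icc

instance (ε : ℝ) : LocallyCompactSpace (Collar ε) := by
  have : LocallyCompactSpace (Iic (0 : ℝ)) :=
    isClosed_Iic.isClosedEmbedding_subtypeVal.locallyCompactSpace
  exact (Collar ε).2.locallyCompactSpace

/-! ### Lifting holomorphic curves through the local foliation -/

section

variable {d k n : ℕ} [NeZero n]
    {N : Type*} [TopologicalSpace N] [ChartedSpace (EuclideanSpace ℝ (Fin d)) N]
    [IsManifold (𝓡 d) ∞ N] [CompactSpace N] [T2Space N]
    {Q : Type*} [TopologicalSpace Q] [ChartedSpace (EuclideanSpace ℝ (Fin k)) Q]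
    [IsManifold (𝓡 k) ∞ Q] [CompactSpace Q] [T2Space Q]
    {W : Type*} [TopologicalSpace W] [ChartedSpace (EuclideanHalfSpace n) W]
    [IsManifold (𝓡∂ n) ∞ W] [T2Space W]
    {Ω : DForm (𝓡∂ n) W 2} {ε ϱ : ℝ}
    {F : C^∞⟮((halfLine.prod (𝓡 d)).prod (𝓡 k)).prod 𝓘(ℝ, ℂ),
      ((Collar ε × N) × Q) × CP1; 𝓡∂ n, W⟯}
    {ΩB : DForm ((halfLine.prod (𝓡 d)).prod (𝓡 k)) ((Collar ε × N) × Q) 2}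

theorem IsLocalFoliation.isOpen_range
    (hF : IsLocalFoliation (𝓡∂ n) ((halfLine.prod (𝓡 d)).prod (𝓡 k)) Ω ΩB ϱ F) :
    IsOpen (range F) := by
  refine isOpen_range_of_boundary F.contMDiff hF.bijective_mfderiv hF.isEmbedding.injective ?_
  rw [ModelWithCorners.boundary_of_boundaryless_right]
  exact hF.boundary_image

variable {C : Type*} [TopologicalSpace C] [ChartedSpace ℂ C] [IsManifold 𝓘(ℂ) ∞ C]
  {u : C → W} {α : DForm (𝓡 d) N 1} {JV : EndoField (halfLine.prod (𝓡 d)) (Collar ε × N)}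
  {JQ : EndoField (𝓡 k) Q} {J : EndoField (𝓡∂ n) W}

/-- A holomorphic curve lifts through the local foliation wherever it meets it. -/
theorem IsLocalFoliation.exists_lift
    (hF : IsLocalFoliation (𝓡∂ n) ((halfLine.prod (𝓡 d)).prod (𝓡 k)) Ω ΩB ϱ F)
    (hJ : IsAdmissible (𝓡∂ n) Ω (splitJ (halfLine.prod (𝓡 d)) (𝓡 k) JV JQ) F J)
    (hu : ContMDiff 𝓘(ℝ, ℂ) (𝓡∂ n) ∞ u) (hol : ∀ p, IsHolomorphicAt J u p) {p₀ : C}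
    (hp₀ : u p₀ ∈ range F) :
    ∃ w : C → ((Collar ε × N) × Q) × CP1, (∀ p, u p ∈ range F → F (w p) = u p) ∧
      ContMDiffOn 𝓘(ℝ, ℂ) (((halfLine.prod (𝓡 d)).prod (𝓡 k)).prod 𝓘(ℝ, ℂ)) ∞ w
        (u ⁻¹' range F) ∧
      ∀ p, u p ∈ range F → IsHolomorphicAt (splitJ ((halfLine.prod (𝓡 d)).prod (𝓡 k)) 𝓘(ℝ, ℂ)
        (splitJ (halfLine.prod (𝓡 d)) (𝓡 k) JV JQ) (complexJ CP1)) w p := by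
  have := isManifold_real_of_complex C
  obtain ⟨x₀, -⟩ := hp₀
  have : Nonempty (((Collar ε × N) × Q) × CP1) := ⟨x₀⟩
  set w : C → ((Collar ε × N) × Q) × CP1 := fun p => Function.invFun F (u p) with hw
  have hFw : ∀ p, u p ∈ range F → F (w p) = u p := fun p hp => Function.invFun_eq hp
  have hU : IsOpen (u ⁻¹' range F) := hF.isOpen_range.preimage hu.continuous
  have hFw' : EqOn (F ∘ w) u (u ⁻¹' range F) := fun p hp => hFw p hp
  have hwc : ContinuousOn w (u ⁻¹' range F) := by
    rw [hF.isEmbedding.continuousOn_iff]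
    exact hu.continuous.continuousOn.congr hFw'
  have hws := contMDiffOn_of_comp F.contMDiff hF.bijective_mfderiv hU hwc
    (hu.contMDiffOn.congr hFw')
  refine ⟨w, hFw, hws, fun p hp => ?_⟩
  refine isHolomorphicAt_of_comp (F.contMDiff.mdifferentiableAt (by simp))
    ((hws.contMDiffAt (hU.mem_nhds hp)).mdifferentiableAt (by simp))
    (hF.bijective_mfderiv _).injective (hJ.restricts (w p)) ((hol p).congr ?_)
  filter_upwards [hU.mem_nhds hp] with q hq
  exact hFw q hq

/-- A closed connected holomorphic curve that meets the local foliation is contained in it, and its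
component in the collar is constant. -/
theorem IsLocalFoliation.exists_lift_of_compact [CompactSpace C] [ConnectedSpace C]
    (hα : IsSmoothForm (𝓡 d) α) (hJV : IsContactCompatible ε α JV)
    (hF : IsLocalFoliation (𝓡∂ n) ((halfLine.prod (𝓡 d)).prod (𝓡 k)) Ω ΩB ϱ F)
    (hJ : IsAdmissible (𝓡∂ n) Ω (splitJ (halfLine.prod (𝓡 d)) (𝓡 k) JV JQ) F J)
    (hu : ContMDiff 𝓘(ℝ, ℂ) (𝓡∂ n) ∞ u) (hol : ∀ p, IsHolomorphicAt J u p) {p₀ : C}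
    (hp₀ : u p₀ ∈ range F) :
    ∃ w : C → ((Collar ε × N) × Q) × CP1, (∀ p, F (w p) = u p) ∧
      ContMDiff 𝓘(ℝ, ℂ) (((halfLine.prod (𝓡 d)).prod (𝓡 k)).prod 𝓘(ℝ, ℂ)) ∞ w ∧
      (∀ p, mfderiv 𝓘(ℝ, ℂ) (halfLine.prod (𝓡 d)) (fun q => (w q).1.1) p = 0) ∧
      (∀ p, IsHolomorphicAt JQ (fun q => (w q).1.2) p) ∧
      ∀ p, IsHolomorphicAt (complexJ CP1) (fun q => (w q).2) p := by
  have := isManifold_real_of_complex C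
  obtain ⟨w, hFw, hws, hwJ⟩ := hF.exists_lift hJ hu hol hp₀
  set U : Set C := u ⁻¹' range F with hUdef
  have hU : IsOpen U := hF.isOpen_range.preimage hu.continuous
  have hmd : ∀ p ∈ U, MDifferentiableAt 𝓘(ℝ, ℂ)
      (((halfLine.prod (𝓡 d)).prod (𝓡 k)).prod 𝓘(ℝ, ℂ)) w p := fun p hp =>
    (hws.contMDiffAt (hU.mem_nhds hp)).mdifferentiableAt (by simp)
  set h : C → ℝ := fun p => ((w p).1.1.1.1.1 : ℝ) with hh
  have hvs : ContMDiffOn 𝓘(ℝ, ℂ) (halfLine.prod (𝓡 d)) ∞ (fun q => (w q).1.1) U :=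
    contMDiff_fst.comp_contMDiffOn (contMDiff_fst.comp_contMDiffOn hws)
  have hvJ : ∀ p ∈ U, IsHolomorphicAt JV (fun q => (w q).1.1) p := fun p hp =>
    ((hwJ p hp).fst (hmd p hp)).fst (hmd p hp).fst
  have hcont : ContinuousOn h U := by
    have h1 : Continuous fun x : ((Collar ε × N) × Q) × CP1 => (x.1.1.1.1.1 : ℝ) := by fun_prop
    exact h1.comp_continuousOn hws.continuousOn
  -- Compactness of the image in the Hausdorff space `W` makes superlevel sets of the collar
  -- coordinate closed in all of `C`, although the coordinate is meaningful only on the open set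
  -- `U`.
  have hcomp : ∀ c : Collar ε, IsCompact (F '' {x | c.1.1 ≤ x.1.1.1.1.1}) := by
    intro c
    have h1 : {x : ((Collar ε × N) × Q) × CP1 | c.1.1 ≤ x.1.1.1.1.1} =
        (({a : Collar ε | c.1.1 ≤ a.1.1} ×ˢ univ) ×ˢ univ) ×ˢ univ := by
      ext x
      simp
    rw [h1]
    exact ((((Collar.isCompact_Ici c).prod isCompact_univ).prod isCompact_univ).prod isCompact_univ).image
      F.contMDiff.continuous
  have hpre : ∀ c : Collar ε, u ⁻¹' (F '' {x | c.1.1 ≤ x.1.1.1.1.1}) = {p ∈ U | c.1.1 ≤ h p} := by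
    intro c
    ext p
    constructor
    · rintro ⟨x, hx, hxp⟩
      have hp : p ∈ U := ⟨x, hxp⟩
      refine ⟨hp, ?_⟩
      have : w p = x := hF.isEmbedding.injective ((hFw p hp).trans hxp.symm)
      rw [hh]
      simp only [this]
      exact hx
    · rintro ⟨hp, hpc⟩
      exact ⟨w p, hpc, hFw p hp⟩
  have hclosed : ∀ c : Collar ε, IsClosed {p ∈ U | c.1.1 ≤ h p} := by
    intro c
    rw [← hpre]
    exact (hcomp c).isClosed.preimage hu.continuous
  -- The maximum is taken over the compact set of points at least as high as `p₀`; lower points of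
  -- `U` cannot exceed it.
  obtain ⟨p₁, ⟨hp₁, hp₁c⟩, hmax⟩ := (hclosed (w p₀).1.1.1).isCompact.exists_isMaxOn
    (f := h) ⟨p₀, hp₀, le_refl (h p₀)⟩ (hcont.mono fun p hp => hp.1)
  have hle : ∀ p ∈ U, h p ≤ h p₁ := by
    intro p hp
    by_cases hc : h p₀ ≤ h p
    · exact hmax ⟨hp, hc⟩
    · exact (not_le.1 hc).le.trans hp₁c
  -- The maximum set is closed as a superlevel set and open by the strong maximum principle. Being
  -- all of `C`, it shows at once that the curve stays in the image and that the collar coordinate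
  -- is constant.
  set A : Set C := {p ∈ U | h p₁ ≤ h p} with hA
  have hAc : IsClosed A := hclosed (w p₁).1.1.1
  have hAo : IsOpen A := by
    refine isOpen_iff_mem_nhds.2 fun p hp => ?_
    have heq : h p = h p₁ := le_antisymm (hle p hp.1) hp.2
    have h1 := collar_eventually_eq_of_isLocalMax hα hJV hU hvs hvJ hp.1 (by
      filter_upwards [hU.mem_nhds hp.1] with q hq
      exact (hle q hq).trans_eq heq.symm)
    filter_upwards [h1, hU.mem_nhds hp.1] with q hq hqU
    exact ⟨hqU, (heq.symm.trans hq.symm).le⟩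
  have huniv : A = univ := IsClopen.eq_univ ⟨hAc, hAo⟩ ⟨p₁, hp₁, le_rfl⟩
  have hall : ∀ p, p ∈ U := fun p => ((huniv ▸ mem_univ p : p ∈ A)).1
  have hUuniv : U = univ := eq_univ_of_forall hall
  have hconst : ∀ p, h p = h p₁ := fun p =>
    le_antisymm (hle p (hall p)) ((huniv ▸ mem_univ p : p ∈ A)).2
  rw [hUuniv, contMDiffOn_univ] at hws hvs
  exact ⟨w, fun p => hFw p (hall p), hws,
    mfderiv_eq_zero_of_collar_const hα hJV hvs (fun p => hvJ p (hall p)) hconst,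
    fun p => ((hwJ p (hall p)).fst (hmd p (hall p))).snd (hmd p (hall p)).fst,
    fun p => (hwJ p (hall p)).snd (hmd p (hall p))⟩

end

/-! ## Nodal spheres -/

namespace NodalSurface

variable (S : NodalSurface) (i : S.ι)

instance : CompactSpace (S.C i) := (S.sphere i).some.symm.toHomeomorph.compactSpace

instance : T2Space (S.C i) := (S.sphere i).some.symm.toHomeomorph.t2Space

instance : ConnectedSpace (S.C i) := by
  have h : IsConnected (Metric.sphere (0 : EuclideanSpace ℝ (Fin 3)) 1) :=
    isConnected_sphere (by
      rw [← Module.finrank_eq_rank]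
      simp) 0 zero_le_one
  have := isConnected_iff_connectedSpace.1 h
  exact (S.sphere i).some.symm.toHomeomorph.surjective.connectedSpace
    (S.sphere i).some.symm.toHomeomorph.continuous

/-- A set of components that is closed under nodal adjacency and non-empty contains all
components. -/
theorem forall_of_adjacent {P : S.ι → Prop}
    (hadj : ∀ x y : Σ i, S.C i, s(x, y) ∈ S.D → P x.1 → P y.1) {i₀ : S.ι} (h₀ : P i₀) (i : S.ι) :
    P i := by
  have := S.connected
  have hiff : ∀ x y : Σ i, S.C i, s(x, y) ∈ S.D → P x.1 = P y.1 := fun x y hxy =>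
    propext ⟨hadj x y hxy, hadj y x (by rwa [Sym2.eq_swap])⟩
  -- A property constant on components and preserved across nodes defines a clopen subset of the
  -- connected nodal quotient.
  set T : Set (Quot fun x y : (Σ i, S.C i) => s(x, y) ∈ S.D) :=
    {q | Quot.lift (fun x => P x.1) hiff q} with hT
  have hpre : ∀ p : S.ι → Prop, IsOpen {x : Σ i, S.C i | p x.1} := by
    intro p
    refine isOpen_sigma_iff.2 fun j => ?_
    by_cases hj : p j
    · convert! isOpen_univ
      ext
      simp [hj]
    · convert! isOpen_empty
      ext
      simp [hj]
  have hopen : IsOpen T := isQuotientMap_quot_mk.isOpen_preimage.1 (hpre P)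
  have hclosed : IsClosed T := ⟨isQuotientMap_quot_mk.isOpen_preimage.1 (hpre fun j => ¬ P j)⟩
  obtain ⟨p₀⟩ : Nonempty (S.C i₀) := inferInstance
  obtain ⟨p⟩ : Nonempty (S.C i) := inferInstance
  have huniv : T = univ := IsClopen.eq_univ ⟨hclosed, hopen⟩ ⟨Quot.mk _ ⟨i₀, p₀⟩, h₀⟩
  have : Quot.mk _ ⟨i, p⟩ ∈ T := huniv ▸ mem_univ _
  exact this

end NodalSurface

/-! ## Areas of spheres in the local foliation -/

theorem CP1.fubiniStudy_pos (p : CP1) (v : TangentSpace 𝓘(ℝ, ℂ) p) (hv : v ≠ 0) :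
    0 < CP1.fubiniStudy p ![v, complexJ CP1 p v] := by
  have h : ∀ v : ℂ, v ≠ 0 → 0 < CP1.areaForm ![v, Complex.I * v] := fun v hv => by
    rw [areaForm_self_I_mul]
    exact pow_pos (norm_pos_iff.2 hv) 2
  exact mul_pos (CP1.density_pos _) (h v hv)

/-- Rational combinations of pushed forward cycles have areas in the rational area spectrum. -/
theorem smul_sum_chainIntegral_mem_rationalAreaSpectrum {E H : Type*} [NormedAddCommGroup E]
    [NormedSpace ℝ E] [TopologicalSpace H] {I : ModelWithCorners ℝ E H} {M : Type*}
    [TopologicalSpace M] [ChartedSpace H M] [IsManifold I ∞ M] {ι : Type*} [Fintype ι]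
    {C : ι → Type*} [∀ i, TopologicalSpace (C i)] [∀ i, ChartedSpace ℂ (C i)]
    [∀ i, IsManifold 𝓘(ℂ) ∞ (C i)] {c : ∀ i, Chain 𝓘(ℝ, ℂ) (C i) ℤ 2}
    (hc : ∀ i, boundary 𝓘(ℝ, ℂ) (c i) = 0) (f : ∀ i, C^∞⟮𝓘(ℝ, ℂ), C i; I, M⟯) (η : DForm I M 2)
    (r : ℚ) : (r : ℝ) * ∑ i, chainIntegral 𝓘(ℝ, ℂ) (pullback 𝓘(ℝ, ℂ) I (f i) η) (c i) ∈
      rationalAreaSpectrum I η := by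
  have := fun i => isManifold_real_of_complex (C i)
  refine ⟨r • rationalChain I (∑ i, pushforward 𝓘(ℝ, ℂ) I (f i) (c i)), ?_, ?_⟩
  · rw [boundary_smul_rat, boundary_rationalChain, ← boundaryHom_apply, map_sum]
    have h : ∀ i, boundaryHom I ℤ 1 (pushforward 𝓘(ℝ, ℂ) I (f i) (c i)) = 0 := fun i => by
      rw [boundaryHom_apply, boundary_pushforward, hc i]
      exact Finsupp.mapDomain_zero
    simp [h]
  · rw [chainIntegral_smul_rat, chainIntegral_rationalChain, ← chainIntegralHom_apply, map_sum]
    simp_rw [chainIntegralHom_apply, chainIntegral_pushforward]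

/-! ### Areas and nodal spheres in the local foliation -/

section

variable {d k n : ℕ} [NeZero n]
    {N : Type*} [TopologicalSpace N] [ChartedSpace (EuclideanSpace ℝ (Fin d)) N]
    {Q : Type*} [TopologicalSpace Q] [ChartedSpace (EuclideanSpace ℝ (Fin k)) Q]
    {W : Type*} [TopologicalSpace W] [ChartedSpace (EuclideanHalfSpace n) W]
    {Ω : DForm (𝓡∂ n) W 2} {ε ϱ : ℝ} {α : DForm (𝓡 d) N 1} {ΩQ : DForm (𝓡 k) Q 2}
    {F : C^∞⟮((halfLine.prod (𝓡 d)).prod (𝓡 k)).prod 𝓘(ℝ, ℂ),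
      ((Collar ε × N) × Q) × CP1; 𝓡∂ n, W⟯}

/-- The embedding is symplectic for the split form, and the summand of the collar drops out because
that part of the map has zero derivative. -/
theorem IsLocalFoliation.pullback_comp {C : Type*} [TopologicalSpace C] [ChartedSpace ℂ C]
    (hF : IsLocalFoliation (𝓡∂ n) ((halfLine.prod (𝓡 d)).prod (𝓡 k)) Ω
      (sumForm (halfLine.prod (𝓡 d)) (𝓡 k) (symplectizationForm ε α) 1 ΩQ) ϱ F)
    {u : C → W} {w : C → ((Collar ε × N) × Q) × CP1} (hu : ∀ p, F (w p) = u p)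
    (hw : ContMDiff 𝓘(ℝ, ℂ) (((halfLine.prod (𝓡 d)).prod (𝓡 k)).prod 𝓘(ℝ, ℂ)) ∞ w)
    (hv : ∀ p, mfderiv 𝓘(ℝ, ℂ) (halfLine.prod (𝓡 d)) (fun q => (w q).1.1) p = 0) :
    pullback 𝓘(ℝ, ℂ) (𝓡∂ n) u Ω = pullback 𝓘(ℝ, ℂ) (𝓡 k) (fun q => (w q).1.2) ΩQ +
      ϱ ^ 2 • pullback 𝓘(ℝ, ℂ) 𝓘(ℝ, ℂ) (fun q => (w q).2) CP1.fubiniStudy := by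
  obtain rfl : F ∘ w = u := funext hu
  funext p
  have hwp := hw.mdifferentiableAt (by simp) (x := p)
  have h1 := pullback_pullback (((halfLine.prod (𝓡 d)).prod (𝓡 k)).prod 𝓘(ℝ, ℂ)) Ω (g := F) (f := w)
    (F.contMDiff.mdifferentiableAt (by simp)) hwp
  have h2 : pullback (((halfLine.prod (𝓡 d)).prod (𝓡 k)).prod 𝓘(ℝ, ℂ)) (𝓡∂ n) F Ω = _ :=
    funext hF.pullback_eq
  rw [h2] at h1
  refine h1.symm.trans ((pullback_sumForm _ _ _ hwp).trans ?_)
  refine congrArg₂ (· + ·) ((pullback_sumForm _ _ _ hwp.fst).trans ?_) rfl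
  rw [pullback_eq_zero _ (hv p), zero_add, one_smul]

theorem IsLocalFoliation.pullback_leaf
    (hF : IsLocalFoliation (𝓡∂ n) ((halfLine.prod (𝓡 d)).prod (𝓡 k)) Ω
      (sumForm (halfLine.prod (𝓡 d)) (𝓡 k) (symplectizationForm ε α) 1 ΩQ) ϱ F)
    (b : (Collar ε × N) × Q) :
    pullback 𝓘(ℝ, ℂ) (𝓡∂ n) (leaf (𝓡∂ n) F b) Ω = ϱ ^ 2 • CP1.fubiniStudy := by
  have h := hF.pullback_comp (u := leaf (𝓡∂ n) F b) (w := fun z => (b, z)) (fun _ => rfl)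
    (contMDiff_const.prodMk contMDiff_id) (fun p => mfderiv_const (c := b.1))
  rw [h, pullback_id, add_eq_right]
  funext p
  exact pullback_eq_zero _ (mfderiv_const (c := b.2))

variable [IsManifold (𝓡 d) ∞ N] [CompactSpace N] [T2Space N] [IsManifold (𝓡 k) ∞ Q] [CompactSpace Q]
  [T2Space Q] [IsManifold (𝓡∂ n) ∞ W] [T2Space W]
  {JV : EndoField (halfLine.prod (𝓡 d)) (Collar ε × N)} {JQ : EndoField (𝓡 k) Q}
  {J : EndoField (𝓡∂ n) W} {S : NodalSurface} {u : NodalMap (𝓡∂ n) W S}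

/-- A nodal holomorphic sphere that meets the local foliation is contained in it. -/
theorem IsLocalFoliation.exists_nodal_lift {ΩB : DForm ((halfLine.prod (𝓡 d)).prod (𝓡 k))
      ((Collar ε × N) × Q) 2}
    (hα : IsSmoothForm (𝓡 d) α) (hJV : IsContactCompatible ε α JV)
    (hF : IsLocalFoliation (𝓡∂ n) ((halfLine.prod (𝓡 d)).prod (𝓡 k)) Ω ΩB ϱ F)
    (hJ : IsAdmissible (𝓡∂ n) Ω (splitJ (halfLine.prod (𝓡 d)) (𝓡 k) JV JQ) F J)
    (hol : u.IsHolomorphic (𝓡∂ n) J) (hmeet : ∃ i p, u.map i p ∈ range F) (i : S.ι) :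
    ∃ w : S.C i → ((Collar ε × N) × Q) × CP1, (∀ p, F (w p) = u.map i p) ∧
      ContMDiff 𝓘(ℝ, ℂ) (((halfLine.prod (𝓡 d)).prod (𝓡 k)).prod 𝓘(ℝ, ℂ)) ∞ w ∧
      (∀ p, mfderiv 𝓘(ℝ, ℂ) (halfLine.prod (𝓡 d)) (fun q => (w q).1.1) p = 0) ∧
      (∀ p, IsHolomorphicAt JQ (fun q => (w q).1.2) p) ∧
      ∀ p, IsHolomorphicAt (complexJ CP1) (fun q => (w q).2) p := by
  have hlift := fun i (p₀ : S.C i) (hp₀ : u.map i p₀ ∈ range F) =>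
    hF.exists_lift_of_compact hα hJV hJ (u.map i).contMDiff (hol i) hp₀
  obtain ⟨i₀, p₀, hp₀⟩ := hmeet
  obtain ⟨p, hp⟩ : ∃ p, u.map i p ∈ range F := by
    -- A component that meets the image lies in it entirely, so its nodal points do too, and every
    -- adjacent component meets the image at the matching point.
    refine S.forall_of_adjacent (P := fun i => ∃ p, u.map i p ∈ range F) ?_ ⟨p₀, hp₀⟩ i
    rintro x y hxy ⟨p, hp⟩
    obtain ⟨w, hw, -⟩ := hlift x.1 p hp
    exact ⟨y.2, w x.2, (hw x.2).trans (u.descends x y hxy)⟩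
  exact hlift i p hp

end

end EssFol

end

/-! ### The comparison of areas and the proof of essentiality -/

theorem mainTheorem7 {d k n : ℕ} [NeZero n]
    {N : Type*} [TopologicalSpace N] [ChartedSpace (EuclideanSpace ℝ (Fin d)) N]
    [IsManifold (𝓡 d) ∞ N] [CompactSpace N] [T2Space N] [Nonempty N]
    {Q : Type*} [TopologicalSpace Q] [ChartedSpace (EuclideanSpace ℝ (Fin k)) Q]
    [IsManifold (𝓡 k) ∞ Q] [CompactSpace Q] [T2Space Q] [Nonempty Q]
    {W : Type*} [TopologicalSpace W] [ChartedSpace (EuclideanHalfSpace n) W]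
    [IsManifold (𝓡∂ n) ∞ W] [T2Space W] [SecondCountableTopology W]
    (α : DForm (𝓡 d) N 1) (hα : IsContactForm (𝓡 d) α)
    (ΩQ : DForm (𝓡 k) Q 2) (hΩQ : IsSymplectic (𝓡 k) ΩQ)
    (Ω : DForm (𝓡∂ n) W 2) (hΩ : IsSymplectic (𝓡∂ n) Ω)
    (ε : ℝ) (hε : 0 < ε)
    (JV : EndoField (halfLine.prod (𝓡 d)) (Collar ε × N)) (hJV : IsContactCompatible ε α JV)
    (JQ : EndoField (𝓡 k) Q) (hJQ : IsCompatible (𝓡 k) ΩQ JQ)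
    (ϱ : ℝ)
    (F : C^∞⟮((halfLine.prod (𝓡 d)).prod (𝓡 k)).prod 𝓘(ℝ, ℂ),
      ((Collar ε × N) × Q) × CP1; 𝓡∂ n, W⟯)
    (hF : IsLocalFoliation (𝓡∂ n) ((halfLine.prod (𝓡 d)).prod (𝓡 k)) Ω
      (sumForm (halfLine.prod (𝓡 d)) (𝓡 k) (symplectizationForm ε α) 1 ΩQ) ϱ F)
    (hϱ : Real.pi * ϱ ^ 2 ∉ rationalAreaSpectrum (𝓡 k) ΩQ) :
    IsEssential (𝓡∂ n) Ω (splitJ (halfLine.prod (𝓡 d)) (𝓡 k) JV JQ) F := by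
  obtain ⟨x₀⟩ := ‹Nonempty N›
  obtain ⟨y₀⟩ := ‹Nonempty Q›
  have hε' : -ε < 0 := by linarith
  -- Any base point would do: the leaf enters only through its area, which is πϱ² for every leaf.
  let a₀ : Collar ε := ⟨⟨0, mem_Iic.2 le_rfl⟩, hε'⟩
  refine ⟨((a₀, x₀), y₀), fun J hJ S u hol ⟨c, e, b, hc, he, hhom⟩ hnc hmeet => ?_⟩
  have := fun i => isManifold_real_of_complex (S.C i)
  choose w hFw hws hv hq hz using
    fun i => hF.exists_nodal_lift hα.smooth hJV hJ hol hmeet i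
  let q : ∀ i, C^∞⟮𝓘(ℝ, ℂ), S.C i; 𝓡 k, Q⟯ := fun i =>
    ⟨fun p => (w i p).1.2, contMDiff_snd.comp (contMDiff_fst.comp (hws i))⟩
  let z : ∀ i, C^∞⟮𝓘(ℝ, ℂ), S.C i; 𝓘(ℝ, ℂ), CP1⟯ := fun i =>
    ⟨fun p => (w i p).2, contMDiff_snd.comp (hws i)⟩
  have hqs : ∀ i, IsSmoothForm 𝓘(ℝ, ℂ) (pullback 𝓘(ℝ, ℂ) (𝓡 k) (q i) ΩQ) := fun i =>
    isSmoothForm_pullback (𝓡 k) hΩQ.smooth (q i).contMDiff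
  have hzs : ∀ i, IsSmoothForm 𝓘(ℝ, ℂ) (pullback 𝓘(ℝ, ℂ) 𝓘(ℝ, ℂ) (z i) CP1.fubiniStudy) :=
    fun i => isSmoothForm_pullback 𝓘(ℝ, ℂ) CP1.isSmoothForm_fubiniStudy (z i).contMDiff
  have hqn : ∀ i, IsNonnegForm (pullback 𝓘(ℝ, ℂ) (𝓡 k) (q i) ΩQ) := fun i =>
    isNonnegForm_pullback (nonneg_of_isCompatible hJQ) (hq i)
  have hzn : ∀ i, IsNonnegForm (pullback 𝓘(ℝ, ℂ) 𝓘(ℝ, ℂ) (z i) CP1.fubiniStudy) := fun i =>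
    isNonnegForm_pullback CP1.isNonnegForm_fubiniStudy (hz i)
  choose m hm using fun i => exists_degree (hc i).cycle he (z i)
  have hmz : ∀ i, chainIntegral 𝓘(ℝ, ℂ) (pullback 𝓘(ℝ, ℂ) 𝓘(ℝ, ℂ) (z i) CP1.fubiniStudy) (c i) =
      m i * Real.pi := fun i => by
    rw [hm i _ CP1.isSmoothForm_fubiniStudy, CP1.chainIntegral_fubiniStudy he]
  set a : ∀ i, ℝ := fun i => chainIntegral 𝓘(ℝ, ℂ) (pullback 𝓘(ℝ, ℂ) (𝓡 k) (q i) ΩQ) (c i) with ha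
  have hϱ0 := hF.radius_pos
  have hpi := Real.pi_pos
  -- The form on `W` is integrated over the bounding 3-chain; the collar contributes nothing to the
  -- areas of the components.
  have harea : ∑ i, a i + ϱ ^ 2 * ((∑ i, m i : ℤ) * Real.pi) = ϱ ^ 2 * Real.pi := by
    have h := chainIntegral_boundary (𝓡∂ n) hΩ.smooth hΩ.closed b
    rw [← hhom, ← chainIntegralHom_apply, map_sub, map_sum, sub_eq_zero] at h
    simp_rw [chainIntegralHom_apply, chainIntegral_pushforward] at h
    rw [hF.pullback_leaf, chainIntegral_smul_form, CP1.chainIntegral_fubiniStudy he] at h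
    rw [← h]
    push_cast
    rw [Finset.sum_mul, Finset.mul_sum, ← Finset.sum_add_distrib]
    refine Finset.sum_congr rfl fun i _ => ?_
    have h1 := congrArg (fun η => chainIntegral 𝓘(ℝ, ℂ) η (c i))
      (hF.pullback_comp (hFw i) (hws i) (hv i))
    refine Eq.trans ?_ h1.symm
    refine Eq.trans ?_ (chainIntegral_add_form 𝓘(ℝ, ℂ) (hqs i)
      (isSmoothForm_const_smul (ϱ ^ 2) (hzs i)) (c i)).symm
    rw [chainIntegral_smul_form, hmz]
  -- Otherwise the area identity can be solved for πϱ², with the rational factor 1/(1 - ∑ m i) in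
  -- front of the area of an integral cycle in `Q`.
  have hsum : ∑ i, m i = 1 := by
    by_contra hne
    refine hϱ ?_
    have h := smul_sum_chainIntegral_mem_rationalAreaSpectrum (fun i => (hc i).cycle) q ΩQ
      (1 - (∑ i, m i : ℤ))⁻¹
    have hne' : (1 - ((∑ i, m i : ℤ) : ℝ)) ≠ 0 := by
      rw [sub_ne_zero]
      exact_mod_cast Ne.symm hne
    convert h using 1
    push_cast at harea hne' ⊢
    change _ = _ * ∑ i, a i
    field_simp
    linarith
  have ha0 : ∀ i, a i = 0 := by
    rw [hsum] at harea
    have h : ∑ i, a i = 0 := by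
      push_cast at harea
      linarith
    exact fun i => (Finset.sum_eq_zero_iff_of_nonneg fun i _ =>
      chainIntegral_nonneg (hc i) (hqs i) (hqn i)).1 h i (Finset.mem_univ i)
  -- With vanishing area the `Q`-part is constant, and so is the collar part; each component thus
  -- lies in a single leaf.
  have hqc : ∀ i p p', (w i p).1 = (w i p').1 := fun i p p' => Prod.ext
    (eq_of_mfderiv_eq_zero (I := halfLine.prod (𝓡 d))
      (contMDiff_fst.comp (contMDiff_fst.comp (hws i))) (hv i) p p')
    (eq_of_mfderiv_eq_zero (q i).contMDiff (fun p =>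
      mfderiv_eq_zero_of_pullback_eq_zero hJQ.positive (hq i p)
        (eq_zero_of_chainIntegral_eq_zero (hc i) (hqs i) (hqn i) (ha0 i) p)) p p')
  -- The degree is non-negative since its product with π is the area of a holomorphic map. Degree
  -- zero would make the `CP1`-part, and with it the whole component, constant.
  have hm1 : ∀ i, 1 ≤ m i := by
    intro i
    have h0 : 0 ≤ m i := by
      have h := chainIntegral_nonneg (hc i) (hzs i) (hzn i)
      rw [hmz] at h
      exact_mod_cast nonneg_of_mul_nonneg_left h hpi
    by_contra hlt
    have hmi : m i = 0 := by lia
    obtain ⟨p₀⟩ : Nonempty (S.C i) := inferInstance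
    have hzc : ∀ p, (w i p).2 = (w i p₀).2 := fun p =>
      eq_of_mfderiv_eq_zero (z i).contMDiff (fun p =>
        mfderiv_eq_zero_of_pullback_eq_zero CP1.fubiniStudy_pos (hz i p)
          (eq_zero_of_chainIntegral_eq_zero (hc i) (hzs i) (hzn i) (by simp [hmz, hmi]) p)) p p₀
    refine hnc i ⟨F (w i p₀), fun p => ?_⟩
    rw [← hFw i p, Prod.ext (hqc i p p₀) (hzc p)]
  -- The number of components, `S.D.card + 1`, is at most the sum of the degrees, which is 1.
  have hcard : S.D.card = 0 := by
    have h1 : ∑ _i : S.ι, (1 : ℤ) ≤ ∑ i, m i := Finset.sum_le_sum fun i _ => hm1 i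
    rw [hsum] at h1
    have h2 := S.card_components
    simp at h1
    lia
  have hsub : Subsingleton S.ι := by
    rw [← Fintype.card_le_one_iff_subsingleton, S.card_components, hcard]
  obtain ⟨i, -⟩ := hmeet
  obtain ⟨p₀⟩ : Nonempty (S.C i) := inferInstance
  refine ⟨Finset.card_eq_zero.1 hcard, (w i p₀).1, fun j => ?_⟩
  obtain rfl := Subsingleton.elim i j
  have hmi : m i = 1 := by
    rw [← hsum]
    exact (Fintype.sum_subsingleton m i).symm
  obtain ⟨φ, hφ⟩ := exists_diffeomorph_of_degree_one (hc i) he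
    (mdifferentiable_of_mfderiv_complexJ ((z i).contMDiff.mdifferentiable (by simp)) (hz i))
    (z i).contMDiff (fun θ hθ => by rw [hm i θ hθ, hmi]; simp)
  refine ⟨φ, fun p => ?_⟩
  rw [hφ p, ← hqc i p p₀]
  exact (hFw i p).symm
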